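/- Throughout, matroids may be infinite, and a matroid is connected if it is $2$-connected, i.e. has no $1$-separation. A graph-like space $G$ is a topological space on the set $V\sqcup((0,1)\times E)$ with vertex set $V$ and edge set $E$, together with continuous maps $\iota_e:[0,1]\to G$ for $e\in E$ such that $\iota_e(0),\iota_e(1)\in V$, $\iota_e(x)=(x,e)$ for $0<x<1$, $\iota_e\restriction(0,1)$ is open, and any two distinct vertices lie in different members of some pair of disjoint open sets that together cover $V$. A map of graph-like spaces is a continuous map sending vertices to vertices and, for each edge $e$, either collapsing all of $(0,1)\times\{e\}$ to one vertex or sending it onto $(0,1)\times\{f\}$ for some edge $f$ by $(r,e)\mapsto(r,f)$ or by $(r,e)\mapsto(1-r,f)$. Removing an edge means removing its interior points. A pseudo-line is a compact connected graph-like space with two vertices $s,t$ such that removing any edge separates $s$ from $t$ and any two vertices can be separated by removing one edge; a pseudo-circle is a compact connected graph-like space with at least one edge such that removing any edge does not disconnect it, removing any pair of edges does, and any two vertices can be separated by removing a pair of edges. Pseudo-arcs and pseudo-circles in $G$ are (images of) injective maps of graph-like spaces into $G$ from a pseudo-line and from a pseudo-circle, respectively; a pseudo-arc joins the images of $s$ and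 $t$ ($s=t$ is allowed, for a pseudo-line consisting of one vertex). $\hat G$ is the subspace of $G$ with the same edges and with the vertices of $G$ that lie on at least one edge or pseudo-circle of $G$. For $X\subseteq E$, the standard subspace $\bar X$ of $G$ is the subspace with edge set $X$ and with the vertices in the closure of $(0,1)\times X$. A set $H$ of points of $G$ is pseudo-arc connected in $G$ if either it is a connected set of interior points of one edge, or any two vertices in $H$ are joined by a pseudo-arc of $G$ included in $H$ and any interior point in $H$ of an edge $e$ can be joined to an endvertex of $e$ by an arc in $H\cap\iota_e([0,1])$. A graph-like space $G$ is locally pseudo-arc connected if every open neighbourhood $U$ of any vertex $x$ of $G$ includes an open neighbourhood $U'$ of $x$ that is pseudo-arc connected in $G$. A graph framework $\Gamma$ on a matroid $M$ with ground set $E$ requires $M$ to be tame (circuit-cocircuit intersections are finite) and consists of functions $c_o:o\to\{-1,1\}$ for each circuit $o$, and $d_b:b\to\{-1,1\}$ and $\sigma_b:E\setminus b\to\{-1,1\}$ for each cocircuit $b$, such that $\sum_{e\in o\cap b}c_o(e)d_b(e)=0$ for all $o,b$; for each circuit $o$ the relation $R_o$, where $[e,f,g]_{R_o}$ holds iff $e,f,g\in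 o$ are distinct and some cocircuit $b$ has $b\cap o=\{e,f\}$ and $\sigma_b(g)=c_o(f)d_b(f)$, is a cyclic order on $o$; and for each circuit $o$, cocircuit $b$, finite $s$ with $o\cap b\subseteq s\subseteq o$, and distinct $p,q\in s$ with $[p,q,g]_{R_o}$ for all $g\in s\setminus\{p,q\}$: (1) if $p,q\in b$ then $c_o(p)d_b(p)=-c_o(q)d_b(q)$; (2) if $p,q\notin b$ then $\sigma_b(p)=\sigma_b(q)$; (3) if $p\in b$, $q\notin b$ then $c_o(p)d_b(p)=\sigma_b(q)$; (4) if $p\notin b$, $q\in b$ then $c_o(q)d_b(q)=-\sigma_b(p)$. The graph-like space $G(M,\Gamma)$ has edge set $E$ and vertex set $\{-1,1\}^{\mathcal C^*(M)}$, where $\mathcal C^*(M)$ is the set of cocircuits of $M$. Its edges satisfy $\iota_e(0)(b)=\iota_e(1)(b)=\sigma_b(e)$ if $e\notin b$, and $\iota_e(0)(b)=-d_b(e)$, $\iota_e(1)(b)=d_b(e)$ if $e\in b$. Its topology is generated by the sets $W\times\{e\}$ with $W\subseteq(0,1)$ open and $e\in E$, and the sets $$U_b^i(\epsilon)=\{v: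 v(b)=i\}\cup\bigcup_{e\notin b,\ \sigma_b(e)=i}(0,1)\times\{e\}\cup\bigcup_{e\in b,\ d_b(e)=i}(1-\epsilon(e),1)\times\{e\}\cup\bigcup_{e\in b,\ d_b(e)=-i}(0,\epsilon(e))\times\{e\}$$ for $b\in\mathcal C^*(M)$, $i\in\{-1,1\}$ and $\epsilon:b\to(0,1)$. Let $\hat G(M,\Gamma)=\widehat{G(M,\Gamma)}$. **Theorem.** Let $M$ be a connected matroid with a graph framework $\Gamma$ on it. If $X$ is a set of edges such that the standard subspace $\bar X$ of $\hat G(M,\Gamma)$ is pseudo-arc connected, then $\bar X$, as a graph-like space, is locally pseudo-arc connected. Moreover, $\hat G(M,\Gamma)$ itself is locally pseudo-arc connected. -/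

import Mathlib

open Set

universe u

/-! ### Infinite matroids: tameness, separations, connectedness -/

/-- A matroid is tame if every circuit meets every cocircuit in a finite set. -/
def Matroid.Tame {α : Type u} (M : Matroid α) : Prop :=
  ∀ o b : Set α, M.IsCircuit o → M.IsCocircuit b → (o ∩ b).Finite

/-- `(A, B)` is a `k`-separation of `M`: a partition of the ground set into two sets of size at
least `k`, with bases `sA` of `A`, `sB` of `B` and `s` of `M` such that `|(sA ∪ sB) \ s| < k`. -/
def Matroid.IsKSeparation {α : Type u} (M : Matroid α) (k : ℕ) (A B : Set α) : Prop :=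
  A ∪ B = M.E ∧ Disjoint A B ∧ (k : ℕ∞) ≤ A.encard ∧ (k : ℕ∞) ≤ B.encard ∧
    ∃ sA sB s : Set α, M.IsBasis sA A ∧ M.IsBasis sB B ∧ M.IsBase s ∧
      ((sA ∪ sB) \ s).encard < (k : ℕ∞)

/-- A matroid is `k`-connected if it has no `l`-separation for any `l < k`. -/
def Matroid.KConnected {α : Type u} (M : Matroid α) (k : ℕ) : Prop :=
  ∀ l < k, ∀ A B : Set α, ¬ M.IsKSeparation l A B

/-- A matroid is connected if it is `2`-connected. -/
def Matroid.IsConnectedMatroid {α : Type u} (M : Matroid α) : Prop :=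
  M.KConnected 2

/-! ### Graph-like spaces -/

/-- The underlying set `V ⊔ ((0,1) × E)` of a graph-like space. -/
inductive GraphLikePoint (V E : Type u) : Type u
  /-- a vertex -/
  | vertex (v : V) : GraphLikePoint V E
  /-- the interior point `(r, e)` of the edge `e` -/
  | edgePt (r : Ioo (0 : ℝ) 1) (e : E) : GraphLikePoint V E

namespace GraphLikePoint

open scoped Classical in
/-- The map `ι_e : [0,1] → V ⊔ ((0,1) × E)` with `ι_e(0) = src e`, `ι_e(1) = tgt e` and
`ι_e(x) = (x, e)` for `0 < x < 1`. -/
noncomputable def edgeMap {V E : Type u} (src tgt : E → V) (e : E) (x : unitInterval) :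
    GraphLikePoint V E :=
  if h0 : x = 0 then vertex (src e)
  else if h1 : x = 1 then vertex (tgt e)
  else edgePt ⟨(x : ℝ), unitInterval.pos_iff_ne_zero.2 h0, unitInterval.lt_one_iff_ne_one.2 h1⟩ e

end GraphLikePoint

/-- A graph-like space. The maps `ι_e` are recorded through the endvertices `src e = ι_e(0)` and
`tgt e = ι_e(1)`, which determine them. -/
structure GraphLikeSpace : Type (u + 1) where
  /-- the vertex set -/
  V : Type u
  /-- the edge set -/
  E : Type u
  /-- `ι_e(0)` -/
  src : E → V
  /-- `ι_e(1)` -/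
  tgt : E → V
  /-- the topology -/
  top : TopologicalSpace (GraphLikePoint V E)
  continuous_edge : ∀ e : E, Continuous (GraphLikePoint.edgeMap src tgt e)
  isOpenMap_inner : ∀ e : E,
    IsOpenMap (fun r : Ioo (0 : ℝ) 1 => (GraphLikePoint.edgePt r e : GraphLikePoint V E))
  separated : ∀ v v' : V, v ≠ v' → ∃ U U' : Set (GraphLikePoint V E),
    IsOpen U ∧ IsOpen U' ∧ Disjoint U U' ∧
      (∀ w : V, GraphLikePoint.vertex w ∈ U ∨ GraphLikePoint.vertex w ∈ U') ∧
      GraphLikePoint.vertex v ∈ U ∧ GraphLikePoint.vertex v' ∈ U'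

namespace GraphLikeSpace

open GraphLikePoint

/-- The points of a graph-like space. -/
abbrev Point (G : GraphLikeSpace.{u}) : Type u := GraphLikePoint G.V G.E

instance instTopologicalSpacePoint (G : GraphLikeSpace.{u}) : TopologicalSpace G.Point := G.top

/-- The map `ι_e : [0,1] → G`. -/
noncomputable def edge (G : GraphLikeSpace.{u}) (e : G.E) : unitInterval → G.Point :=
  edgeMap G.src G.tgt e

/-- The set of interior points of the edges in `F`, i.e. `(0,1) × F`. -/
def innerPoints (G : GraphLikeSpace.{u}) (F : Set G.E) : Set G.Point :=
  {p | ∃ r : Ioo (0 : ℝ) 1, ∃ e ∈ F, p = edgePt r e}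

/-! ### Maps of graph-like spaces -/

/-- The function on points induced by `φV : V(G) → V(G')` and
`φE : E(G) → (E(G') × {+,-}) ⊔ V(G')`; the sign `+` is `true` and `-` is `false`. -/
def inducedFun {V E V' E' : Type u} (φV : V → V') (φE : E → (E' × Bool) ⊕ V') :
    GraphLikePoint V E → GraphLikePoint V' E'
  | vertex v => vertex (φV v)
  | edgePt r e =>
    match φE e with
    | Sum.inl (f, true) => edgePt r f
    | Sum.inl (f, false) => edgePt ⟨1 - (r : ℝ), sub_pos.2 r.2.2, sub_lt_self 1 r.2.1⟩ f
    | Sum.inr v => vertex v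

/-- A map of graph-like spaces. -/
structure Hom (G G' : GraphLikeSpace.{u}) : Type u where
  /-- the action on vertices -/
  onV : G.V → G'.V
  /-- the action on edges -/
  onE : G.E → (G'.E × Bool) ⊕ G'.V
  continuous_inducedFun :
    Continuous (inducedFun onV onE : G.Point → G'.Point)

/-- The function on points underlying a map of graph-like spaces. -/
def Hom.toFun {G G' : GraphLikeSpace.{u}} (φ : Hom G G') : G.Point → G'.Point :=
  inducedFun φ.onV φ.onE

/-! ### Pseudo-lines, pseudo-arcs and pseudo-circles -/

/-- What remains of `G` after removing the edges in `F` (that is, their interior points). -/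
def removeEdges (G : GraphLikeSpace.{u}) (F : Set G.E) : Set G.Point :=
  (G.innerPoints F)ᶜ

/-- Removing the edges in `F` separates `v` from `w`: they are in different components of what
remains. -/
def EdgesSeparate (G : GraphLikeSpace.{u}) (F : Set G.E) (v w : G.V) : Prop :=
  (vertex w : G.Point) ∉ connectedComponentIn (G.removeEdges F) (vertex v)

/-- `L` is a pseudo-line with start-vertex `s` and end-vertex `t`. -/
structure IsPseudoLine (L : GraphLikeSpace.{u}) (s t : L.V) : Prop where
  compact : CompactSpace L.Point
  connected : ConnectedSpace L.Point
  edge_separates : ∀ e : L.E, L.EdgesSeparate {e} s t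
  exists_separating : ∀ v w : L.V, v ≠ w → ∃ e : L.E, L.EdgesSeparate {e} v w

/-- `C` is a pseudo-circle. -/
structure IsPseudoCircle (C : GraphLikeSpace.{u}) : Prop where
  compact : CompactSpace C.Point
  connected : ConnectedSpace C.Point
  nonempty_edges : Nonempty C.E
  remove_one : ∀ e : C.E, IsConnected (C.removeEdges {e})
  remove_two : ∀ e f : C.E, e ≠ f → ¬ IsConnected (C.removeEdges {e, f})
  exists_separating : ∀ v w : C.V, v ≠ w → ∃ e f : C.E, e ≠ f ∧ C.EdgesSeparate {e, f} v w

/-- `v` and `w` are joined by a pseudo-arc of `G` (an injective map of graph-like spaces from a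
pseudo-line to `G`) that is included in the set of points `H`. -/
def JoinedByPseudoArcIn (G : GraphLikeSpace.{u}) (H : Set G.Point) (v w : G.V) : Prop :=
  ∃ (L : GraphLikeSpace.{u}) (s t : L.V) (φ : Hom L G), L.IsPseudoLine s t ∧
    Function.Injective φ.toFun ∧ φ.onV s = v ∧ φ.onV t = w ∧ range φ.toFun ⊆ H

/-- The vertex `v` lies on a pseudo-circle of `G` (the image of an injective map of graph-like
spaces from a pseudo-circle to `G`). -/
def LiesOnPseudoCircle (G : GraphLikeSpace.{u}) (v : G.V) : Prop :=
  ∃ (C : GraphLikeSpace.{u}) (φ : Hom C G), C.IsPseudoCircle ∧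
    Function.Injective φ.toFun ∧ (vertex v : G.Point) ∈ range φ.toFun

/-- A set `H` of points of `G` is pseudo-arc connected (in `G`) if it is a connected set of interior
points of one edge, or else any two vertices in `H` can be joined by a pseudo-arc of `G` included
in `H` and any interior point in `H` of an edge `e` can be joined to an endvertex of `e` by an arc
in `H ∩ ι_e[0,1]`. -/
def IsPseudoArcConnected (G : GraphLikeSpace.{u}) (H : Set G.Point) : Prop :=
  (∃ e : G.E, H ⊆ G.innerPoints {e} ∧ IsPreconnected H) ∨
    ((∀ v w : G.V, vertex v ∈ H → vertex w ∈ H → G.JoinedByPseudoArcIn H v w) ∧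
      ∀ (e : G.E) (r : Ioo (0 : ℝ) 1), edgePt r e ∈ H →
        ∃ γ : unitInterval → G.Point, Continuous γ ∧ Function.Injective γ ∧
          γ 0 = edgePt r e ∧ (γ 1 = vertex (G.src e) ∨ γ 1 = vertex (G.tgt e)) ∧
          range γ ⊆ H ∩ range (G.edge e))

/-- Local pseudo-arc connectedness of a graph-like space. -/
def LocallyPseudoArcConnected (G : GraphLikeSpace.{u}) : Prop :=
  ∀ (x : G.V) (U : Set G.Point), IsOpen U → vertex x ∈ U →
    ∃ U' : Set G.Point, U' ⊆ U ∧ IsOpen U' ∧ vertex x ∈ U' ∧ G.IsPseudoArcConnected U'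

/-! ### Subspaces -/

/-- The inclusion of the points on a subset of the vertices and a subset of the edges. -/
def inclusion {V E : Type u} (V' : Set V) (E' : Set E) :
    GraphLikePoint V' E' → GraphLikePoint V E
  | vertex v => vertex v
  | edgePt r e => edgePt r e

theorem inclusion_edgeMap {V E : Type u} (V' : Set V) (E' : Set E) (src tgt : E → V)
    (h0 : ∀ e ∈ E', src e ∈ V') (h1 : ∀ e ∈ E', tgt e ∈ V') (e : E') (x : unitInterval) :
    inclusion V' E' (edgeMap (fun e : E' => (⟨src e, h0 e e.2⟩ : V'))
      (fun e : E' => (⟨tgt e, h1 e e.2⟩ : V')) e x) = edgeMap src tgt (e : E) x := by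
  unfold edgeMap
  split_ifs <;> rfl

/-- The graph-like subspace of `G` with vertex set `V'` and edge set `E'`, where `V'` contains all
endvertices of edges in `E'`; it carries the subspace topology. -/
def subspace (G : GraphLikeSpace.{u}) (V' : Set G.V) (E' : Set G.E)
    (h0 : ∀ e ∈ E', G.src e ∈ V') (h1 : ∀ e ∈ E', G.tgt e ∈ V') : GraphLikeSpace.{u} where
  V := V'
  E := E'
  src e := ⟨G.src e, h0 e e.2⟩
  tgt e := ⟨G.tgt e, h1 e e.2⟩
  top := TopologicalSpace.induced (inclusion V' E') G.top
  continuous_edge e := by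
    let _ := G.top
    refine continuous_induced_rng.2 ?_
    have h : inclusion V' E' ∘ (edgeMap (fun e : E' => (⟨G.src e, h0 e e.2⟩ : V'))
        (fun e : E' => (⟨G.tgt e, h1 e e.2⟩ : V')) e) = edgeMap G.src G.tgt (e : G.E) :=
      funext fun x => inclusion_edgeMap V' E' G.src G.tgt h0 h1 e x
    rw [h]
    exact G.continuous_edge e
  isOpenMap_inner e := by
    let _ := G.top
    intro W hW
    refine isOpen_induced_iff.2 ⟨_, G.isOpenMap_inner (e : G.E) W hW, ?_⟩
    ext p
    cases p with
    | vertex v => simp [inclusion]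
    | edgePt r f => simp [inclusion, Subtype.ext_iff]
  separated v v' hv := by
    let _ := G.top
    obtain ⟨U, U', hU, hU', hd, hc, hm, hm'⟩ :=
      G.separated v v' (fun h => hv (Subtype.ext h))
    exact ⟨inclusion V' E' ⁻¹' U, inclusion V' E' ⁻¹' U', isOpen_induced_iff.2 ⟨U, hU, rfl⟩,
      isOpen_induced_iff.2 ⟨U', hU', rfl⟩, hd.preimage _, fun w => hc w, hm, hm'⟩

/-- The vertices of `Ĝ`: those lying on at least one edge or pseudo-circle of `G`. -/
def hatVertices (G : GraphLikeSpace.{u}) : Set G.V :=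
  {v | (∃ e : G.E, G.src e = v ∨ G.tgt e = v) ∨ G.LiesOnPseudoCircle v}

/-- The subspace `Ĝ` of `G`, with all edges of `G` and with the vertices of `G` that lie on at
least one edge or pseudo-circle of `G`. -/
def hat (G : GraphLikeSpace.{u}) : GraphLikeSpace.{u} :=
  G.subspace G.hatVertices univ (fun e _ => Or.inl ⟨e, Or.inl rfl⟩)
    (fun e _ => Or.inl ⟨e, Or.inr rfl⟩)

/-- The vertices in the closure of `(0,1) × R`. -/
def closureVertices (G : GraphLikeSpace.{u}) (R : Set G.E) : Set G.V :=
  {v | (vertex v : G.Point) ∈ closure (G.innerPoints R)}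

theorem edge_mem_closure (G : GraphLikeSpace.{u}) {R : Set G.E} {e : G.E} (he : e ∈ R)
    (x : unitInterval) : G.edge e x ∈ closure (G.innerPoints R) := by
  have hd : Dense (Ioo (0 : unitInterval) 1) := by
    rw [dense_iff_closure_eq, closure_Ioo (zero_ne_one)]
    exact Set.eq_univ_of_forall fun y => ⟨unitInterval.nonneg y, unitInterval.le_one y⟩
  have hx : x ∈ closure (Ioo (0 : unitInterval) 1) := hd x
  refine map_mem_closure (G.continuous_edge e) hx ?_
  intro y hy
  have h0 : y ≠ 0 := ne_of_gt hy.1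
  have h1 : y ≠ 1 := ne_of_lt hy.2
  refine ⟨⟨(y : ℝ), unitInterval.pos_iff_ne_zero.2 h0, unitInterval.lt_one_iff_ne_one.2 h1⟩,
    e, he, ?_⟩
  simp [edge, edgeMap, h0, h1]

/-- The standard subspace `R̄` of `G` with edge set `R`: its edges are those in `R`, and its
vertices are those in the closure of `(0,1) × R`. -/
def standardSubspace (G : GraphLikeSpace.{u}) (R : Set G.E) : GraphLikeSpace.{u} :=
  G.subspace (G.closureVertices R) R
    (fun e he => by
      have h := G.edge_mem_closure he 0
      simpa [edge, edgeMap, closureVertices] using h)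
    (fun e he => by
      have h := G.edge_mem_closure he 1
      simpa [edge, edgeMap, closureVertices] using h)

/-- The set of points of the standard subspace `R̄`, as a subset of `G`. -/
def standardSet (G : GraphLikeSpace.{u}) (R : Set G.E) : Set G.Point :=
  range (inclusion (G.closureVertices R) R)

end GraphLikeSpace

/-! ### Graph frameworks -/

/-- The axioms for `R` to be a cyclic order on the set `X`. -/
structure IsCyclicOrderOn {α : Type u} (X : Set α) (R : α → α → α → Prop) : Prop where
  mem : ∀ a b c, R a b c → a ∈ X ∧ b ∈ X ∧ c ∈ X
  cyclic : ∀ a b c, R a b c → R b c a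
  asymm : ∀ a b c, R a b c → ¬ R c b a
  trans : ∀ a b c d, R a b c → R a c d → R a b d
  total : ∀ a ∈ X, ∀ b ∈ X, ∀ c ∈ X, a ≠ b → b ≠ c → a ≠ c → R a b c ∨ R c b a

/-- A signing of a tame matroid `M`, with signs in `ℤˣ = {1, -1}`. Only the values `c o e` for
circuits `o` and `e ∈ o`, and `d b e` for cocircuits `b` and `e ∈ b`, carry meaning. -/
structure Matroid.Signing {α : Type u} (M : Matroid α) : Type u where
  tame : M.Tame
  /-- the functions `c_o : o → {1, -1}` -/
  c : Set α → α → ℤˣ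
  /-- the functions `d_b : b → {1, -1}` -/
  d : Set α → α → ℤˣ
  sum_eq_zero : ∀ (o b : Set α) (ho : M.IsCircuit o) (hb : M.IsCocircuit b),
    ∑ e ∈ (tame o b ho hb).toFinset, ((c o e : ℤ) * (d b e : ℤ)) = 0

/-- The relation `R_o` that a signing together with maps `σ_b` defines on the circuit `o`. -/
def Matroid.Signing.cyc {α : Type u} {M : Matroid α} (S : M.Signing) (σ : Set α → α → ℤˣ)
    (o : Set α) (e f g : α) : Prop :=
  (e ∈ o ∧ f ∈ o ∧ g ∈ o) ∧ (e ≠ f ∧ f ≠ g ∧ e ≠ g) ∧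
    ∃ b : Set α, M.IsCocircuit b ∧ b ∩ o = {e, f} ∧ σ b g = S.c o f * S.d b f

/-- `p` and `q` are clockwise adjacent in the restriction of the relation `R` to `s`. -/
def ClockwiseAdjacent {α : Type u} (R : α → α → α → Prop) (s : Set α) (p q : α) : Prop :=
  p ∈ s ∧ q ∈ s ∧ p ≠ q ∧ ∀ g ∈ s, g ≠ p → g ≠ q → R p q g

/-- A graph framework on the matroid `M`. Only the values `σ b e` for cocircuits `b` and
`e ∈ M.E \ b` carry meaning. -/
structure Matroid.GraphFramework {α : Type u} (M : Matroid α) : Type u extends M.Signing where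
  /-- the functions `σ_b : E \ b → {1, -1}` -/
  σ : Set α → α → ℤˣ
  isCyclicOrder : ∀ o : Set α, M.IsCircuit o → IsCyclicOrderOn o (toSigning.cyc σ o)
  /-- In `R_o`, the edges `e, f, g` being in cyclic order does not depend on the witness `b`. -/
  independent : ∀ (o b b' : Set α) (e f g : α), M.IsCircuit o → M.IsCocircuit b →
    M.IsCocircuit b' → e ∈ o → f ∈ o → g ∈ o → e ≠ f → f ≠ g → e ≠ g →
    b ∩ o = {e, f} → b' ∩ o = {e, f} →
    (σ b g = c o f * d b f ↔ σ b' g = c o f * d b' f)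
  adjacent_mem_mem : ∀ (o b s : Set α) (p q : α), M.IsCircuit o → M.IsCocircuit b →
    s.Finite → b ∩ o ⊆ s → s ⊆ o → ClockwiseAdjacent (toSigning.cyc σ o) s p q →
    p ∈ b → q ∈ b → c o p * d b p = -(c o q * d b q)
  adjacent_not_not : ∀ (o b s : Set α) (p q : α), M.IsCircuit o → M.IsCocircuit b →
    s.Finite → b ∩ o ⊆ s → s ⊆ o → ClockwiseAdjacent (toSigning.cyc σ o) s p q →
    p ∉ b → q ∉ b → σ b p = σ b q
  adjacent_mem_not : ∀ (o b s : Set α) (p q : α), M.IsCircuit o → M.IsCocircuit b →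
    s.Finite → b ∩ o ⊆ s → s ⊆ o → ClockwiseAdjacent (toSigning.cyc σ o) s p q →
    p ∈ b → q ∉ b → c o p * d b p = σ b q
  adjacent_not_mem : ∀ (o b s : Set α) (p q : α), M.IsCircuit o → M.IsCocircuit b →
    s.Finite → b ∩ o ⊆ s → s ⊆ o → ClockwiseAdjacent (toSigning.cyc σ o) s p q →
    p ∉ b → q ∈ b → c o q * d b q = -(σ b p)

namespace Matroid.GraphFramework

open GraphLikePoint

variable {α : Type u} {M : Matroid α}

/-- The vertex set `{1, -1}^{C*(M)}` of `G(M, Γ)`. -/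
abbrev Vert (M : Matroid α) : Type u := {b : Set α // M.IsCocircuit b} → ℤˣ

open scoped Classical in
/-- The endvertex `ι_e(0)`. -/
noncomputable def srcV (Γ : M.GraphFramework) (e : M.E) : Vert M :=
  fun b => if (e : α) ∈ b.1 then -(Γ.d b.1 e) else Γ.σ b.1 e

open scoped Classical in
/-- The endvertex `ι_e(1)`. -/
noncomputable def tgtV (Γ : M.GraphFramework) (e : M.E) : Vert M :=
  fun b => if (e : α) ∈ b.1 then Γ.d b.1 e else Γ.σ b.1 e

/-- The subbasic open set `U_b^i(ε_b)`. (Only the values of `ε` on `b` matter.) -/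
def sideSet (Γ : M.GraphFramework) (b : {b : Set α // M.IsCocircuit b}) (i : ℤˣ)
    (ε : M.E → Ioo (0 : ℝ) 1) : Set (GraphLikePoint (Vert M) M.E) :=
  {p | match p with
    | vertex v => v b = i
    | edgePt r e =>
        ((e : α) ∉ b.1 ∧ Γ.σ b.1 e = i) ∨
        ((e : α) ∈ b.1 ∧ Γ.d b.1 e = i ∧ 1 - (ε e : ℝ) < (r : ℝ)) ∨
        ((e : α) ∈ b.1 ∧ Γ.d b.1 e = -i ∧ (r : ℝ) < (ε e : ℝ))}

/-- The topology of `G(M, Γ)`, generated by the sets `W × {e}` with `W` open in `(0,1)` and the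
sets `U_b^i(ε_b)`. -/
@[reducible] def topology (Γ : M.GraphFramework) : TopologicalSpace (GraphLikePoint (Vert M) M.E) :=
  TopologicalSpace.generateFrom
    {S | (∃ (W : Set (Ioo (0 : ℝ) 1)) (e : M.E), IsOpen W ∧ S = (fun r => edgePt r e) '' W) ∨
      ∃ b i ε, S = Γ.sideSet b i ε}

theorem continuous_edgeMap (Γ : M.GraphFramework) (e : M.E) :
    @Continuous _ _ _ Γ.topology (edgeMap Γ.srcV Γ.tgtV e) := by
  refine continuous_generateFrom_iff.2 ?_
  rintro S (⟨W, f, hW, rfl⟩ | ⟨b, i, ε, rfl⟩)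
  · by_cases hef : e = f
    · subst hef
      obtain ⟨W', hW', rfl⟩ := isOpen_induced_iff.1 hW
      have : edgeMap Γ.srcV Γ.tgtV e ⁻¹' ((fun r => edgePt r e) '' (Subtype.val ⁻¹' W')) =
          Subtype.val ⁻¹' W' ∩ Ioo (0 : unitInterval) 1 := by
        ext x
        by_cases h0 : x = 0
        · simp [edgeMap, h0]
        by_cases h1 : x = 1
        · simp [edgeMap, h1]
        have h0' : 0 < x := unitInterval.pos_iff_ne_zero.2 h0
        have h1' : x < 1 := unitInterval.lt_one_iff_ne_one.2 h1
        simp [edgeMap, h0, h1, h0', h1']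
      rw [this]
      exact (hW'.preimage continuous_subtype_val).inter isOpen_Ioo
    · have : edgeMap Γ.srcV Γ.tgtV e ⁻¹' ((fun r => edgePt r f) '' W) = ∅ := by
        ext x
        simp only [edgeMap, mem_preimage, mem_image, mem_empty_iff_false, iff_false]
        rintro ⟨r, -, hr⟩
        split_ifs at hr
        exact hef (by simpa using (GraphLikePoint.edgePt.inj hr).2.symm)
      rw [this]
      exact isOpen_empty
  · by_cases hb : (e : α) ∈ b.1
    · rcases Int.units_eq_one_or (Γ.d b.1 e * i) with hi | hi
      · have hd : Γ.d b.1 e = i := by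
          rcases Int.units_eq_one_or (Γ.d b.1 e) with h | h <;>
          rcases Int.units_eq_one_or i with h' | h' <;> simp_all
        have hne : i ≠ -i := by
          rcases Int.units_eq_one_or i with h' | h' <;> rw [h'] <;> decide
        have : edgeMap Γ.srcV Γ.tgtV e ⁻¹' (Γ.sideSet b i ε) =
            {x : unitInterval | 1 - (ε e : ℝ) < (x : ℝ)} := by
          ext x
          have hε := (ε e).2
          by_cases h0 : x = 0
          · simp [edgeMap, h0, sideSet, srcV, hb, hd, hne.symm, hε.2.le]
          by_cases h1 : x = 1
          · simp [edgeMap, h1, sideSet, tgtV, hb, hd, hε.1]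
          simp [edgeMap, h0, h1, sideSet, hb, hd, hne]
        rw [this]
        exact isOpen_lt continuous_const continuous_subtype_val
      · have hd : Γ.d b.1 e = -i := by
          rcases Int.units_eq_one_or (Γ.d b.1 e) with h | h <;>
          rcases Int.units_eq_one_or i with h' | h' <;> simp_all
        have hne : -i ≠ i := by
          rcases Int.units_eq_one_or i with h' | h' <;> rw [h'] <;> decide
        have : edgeMap Γ.srcV Γ.tgtV e ⁻¹' (Γ.sideSet b i ε) =
            {x : unitInterval | (x : ℝ) < (ε e : ℝ)} := by
          ext x
          have hε := (ε e).2
          by_cases h0 : x = 0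
          · simp [edgeMap, h0, sideSet, srcV, hb, hd, hε.1]
          by_cases h1 : x = 1
          · simp [edgeMap, h1, sideSet, tgtV, hb, hd, hne, hε.2.le]
          simp [edgeMap, h0, h1, sideSet, hb, hd, hne]
          exact Iff.rfl
        rw [this]
        exact isOpen_lt continuous_subtype_val continuous_const
    · have : edgeMap Γ.srcV Γ.tgtV e ⁻¹' (Γ.sideSet b i ε) = {_x | Γ.σ b.1 e = i} := by
        ext x
        by_cases h0 : x = 0
        · simp [edgeMap, h0, sideSet, srcV, hb]
        by_cases h1 : x = 1
        · simp [edgeMap, h1, sideSet, tgtV, hb]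
        simp [edgeMap, h0, h1, sideSet, hb]
      rw [this]
      exact isOpen_const

theorem disjoint_sideSet_half (Γ : M.GraphFramework) (b : {b : Set α // M.IsCocircuit b})
    (i : ℤˣ) :
    Disjoint (Γ.sideSet b i fun _ => ⟨1 / 2, by norm_num, by norm_num⟩)
      (Γ.sideSet b (-i) fun _ => ⟨1 / 2, by norm_num, by norm_num⟩) := by
  have hne : i ≠ -i := by
    rcases Int.units_eq_one_or i with h' | h' <;> rw [h'] <;> decide
  rw [Set.disjoint_left]
  rintro (v | ⟨r, e⟩) h h'
  · exact hne (Eq.trans (Eq.symm h) h')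
  · simp only [sideSet, mem_ofPred_eq, neg_neg] at h h'
    rcases h with ⟨h1, h2⟩ | ⟨h1, h2, h3⟩ | ⟨h1, h2, h3⟩ <;>
    rcases h' with ⟨k1, k2⟩ | ⟨k1, k2, k3⟩ | ⟨k1, k2, k3⟩ <;>
    first
      | exact h1 k1
      | exact k1 h1
      | exact hne (h2.symm.trans k2)
      | exact hne (k2.symm.trans h2)
      | linarith

/-- The graph-like space `G(M, Γ)`. -/
noncomputable def toGraphLikeSpace (Γ : M.GraphFramework) : GraphLikeSpace.{u} where
  V := Vert M
  E := M.E
  src := Γ.srcV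
  tgt := Γ.tgtV
  top := Γ.topology
  continuous_edge := Γ.continuous_edgeMap
  isOpenMap_inner e := fun W hW =>
    TopologicalSpace.isOpen_generateFrom_of_mem (Or.inl ⟨W, e, hW, rfl⟩)
  separated v v' hv := by
    obtain ⟨b, hb⟩ := Function.ne_iff.1 hv
    have key : ∀ i j : ℤˣ, i ≠ j → j = -i := by decide
    refine ⟨Γ.sideSet b (v b) fun _ => ⟨1 / 2, by norm_num, by norm_num⟩,
      Γ.sideSet b (-(v b)) fun _ => ⟨1 / 2, by norm_num, by norm_num⟩,
      TopologicalSpace.isOpen_generateFrom_of_mem (Or.inr ⟨_, _, _, rfl⟩),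
      TopologicalSpace.isOpen_generateFrom_of_mem (Or.inr ⟨_, _, _, rfl⟩),
      Γ.disjoint_sideSet_half b (v b), fun w => ?_, rfl, key _ _ hb⟩
    by_cases hw : w b = v b
    · exact Or.inl hw
    · exact Or.inr (key _ _ (Ne.symm hw))

/-- The graph-like space `Ĝ(M, Γ)`. -/
noncomputable def hatSpace (Γ : M.GraphFramework) : GraphLikeSpace.{u} :=
  Γ.toGraphLikeSpace.hat

end Matroid.GraphFramework

/-! ### Matroid lemmas -/

/-! Pseudo-arcs are traded for continua: `Linked H u v` says that a compact connected union of
vertices and edges inside `H` contains both vertices. In a Hausdorff space, Zorn's lemma shrinks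
such a set to a minimal one, in which every edge separates `u` from `v`, and this is a pseudo-line
(`Linked.joinedByPseudoArcIn`). Conversely the image of a pseudo-line is a continuum. Being linked,
unlike being joined by a pseudo-arc, is evidently transitive.

A vertex `x` has basic neighbourhoods given by finitely many cocircuits `b`, each with the side `x
b`. Hence it suffices to enlarge any finite set of cocircuits so that the vertices agreeing with `x`
on all of them are still pairwise linked within their common side
(`locallyPseudoArcConnected_of_cut`). The heart is `IsLinked.exists_cut`: if `H` is linked, then for
each cocircuit `b` a single further cocircuit `c` makes the part of `H` on the side of `x` linked.
To find it, let `C` be the set of vertices linked to `x` in `H` without using `b`, and let `f` be an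
edge of `b` leaving `C`. Colour the edges inside `C`, those of `H` avoiding `C`, and those on the
far side of `b`. Either `f` closes a circuit with coloured edges, or some cocircuit `c` contains `f`
and no coloured edge. A circuit would have to return through `b` from a vertex of `C` along a
coloured edge, which is impossible; the cocircuit separates `C` from the other vertices of `H` on
the same side of `b`. Adding one pair `b, c` after another gives `IsLinked.exists_isLinked_cut`.

Walking along circuits requires that the closure of a circuit stays connected when one edge is
removed. This comes from the framework axioms by induction along finite subsets of the cyclic order
(`tailV_mem_of_headV_mem`, `isPreconnected_circ_sdiff`). The closure of a circuit is then a
pseudo-circle, so all its vertices belong to the hat space. Conversely each pseudo-circle lies in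
the closure of a circuit, so chains of circuits link the whole hat space when `M` is connected. The
one non-Hausdorff obstruction, an edge in no cocircuit, forces a connected matroid to have a single
element and no cocircuits, leaving just one vertex. -/

namespace Matroid

variable {α : Type u} {M : Matroid α}

/-- If `e` is not spanned by `Y`, add `e` to a basis of `Y` and take a cocircuit meeting this
independent set in `e` only. Were it to meet `Y` in some `f`, it would meet the fundamental circuit
of `f` in `f` alone. -/
theorem exists_isCircuit_or_isCocircuit {e : α} (he : e ∈ M.E) {Y : Set α} (hY : Y ⊆ M.E)
    (heY : e ∉ Y) :
    (∃ o, M.IsCircuit o ∧ e ∈ o ∧ o ⊆ insert e Y) ∨ ∃ c, M.IsCocircuit c ∧ e ∈ c ∧ Disjoint c Y := by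
  by_cases hcl : e ∈ M.closure Y
  · obtain ⟨C, hC, hc, heC⟩ := exists_isCircuit_of_mem_closure hcl heY
    exact Or.inl ⟨C, hc, heC, hC⟩
  · right
    obtain ⟨I, hI⟩ := M.exists_isBasis Y hY
    have hI' : M.Indep (insert e I) := by
      rw [← hI.closure_eq_closure] at hcl
      exact (hI.indep.insert_indep_iff).2 (Or.inl ⟨he, hcl⟩)
    obtain ⟨K, hK, hKI⟩ := hI'.exists_isCocircuit_inter_eq_mem (mem_insert e I)
    refine ⟨K, hK, (hKI.symm ▸ mem_singleton e : e ∈ K ∩ _).1, disjoint_left.2 fun f hf hfY => ?_⟩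
    have hfe : f ≠ e := fun h => heY (h ▸ hfY)
    have hfI : f ∉ I := fun h => hfe (hKI.subset ⟨hf, mem_insert_of_mem e h⟩)
    obtain ⟨C, hC, hc, hfC⟩ := exists_isCircuit_of_mem_closure (hI.subset_closure hfY) hfI
    refine hc.inter_isCocircuit_ne_singleton hK (e := f) (Subset.antisymm ?_ ?_)
    · rintro g ⟨hg, hgK⟩
      rcases hC hg with rfl | hgI
      · rfl
      · have : g = e := hKI.subset ⟨hgK, mem_insert_of_mem e hgI⟩
        subst this
        exact absurd (hI.subset hgI) heY
    · rintro g rfl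
      exact ⟨hfC, hf⟩

/-- A cocircuit meeting the independent set `o \ {f}` in `e` only must also contain `f`, since a
circuit and a cocircuit never meet in exactly one element. -/
theorem IsCircuit.exists_isCocircuit_inter_eq_pair {o : Set α} (ho : M.IsCircuit o) {e f : α}
    (he : e ∈ o) (hf : f ∈ o) (hef : e ≠ f) : ∃ b, M.IsCocircuit b ∧ b ∩ o = {e, f} := by
  obtain ⟨K, hK, hKo⟩ := (ho.sdiff_singleton_indep hf).exists_isCocircuit_inter_eq_mem
    (show e ∈ o \ {f} from ⟨he, hef⟩)
  have heK : e ∈ K := (hKo.symm ▸ mem_singleton e : e ∈ K ∩ (o \ {f})).1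
  have h1 : ∀ g ∈ o, g ∈ K → g = e ∨ g = f := fun g hg hgK => by
    by_cases hgf : g = f
    · exact Or.inr hgf
    · exact Or.inl (hKo.subset ⟨hgK, hg, hgf⟩)
  have hfK : f ∈ K := by
    by_contra hfK
    refine ho.inter_isCocircuit_ne_singleton hK (e := e) (Subset.antisymm ?_ ?_)
    · rintro g ⟨hg, hgK⟩
      rcases h1 g hg hgK with h | rfl
      · exact h
      · exact absurd hgK hfK
    · rintro g rfl
      exact ⟨he, heK⟩
  refine ⟨K, hK, Subset.antisymm (fun g hg => h1 g hg.2 hg.1) ?_⟩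
  rintro g (rfl | rfl)
  exacts [⟨heK, he⟩, ⟨hfK, hf⟩]

theorem IsCocircuit.exists_isCircuit_inter_eq_pair {b : Set α} (hb : M.IsCocircuit b) {e f : α}
    (he : e ∈ b) (hf : f ∈ b) (hef : e ≠ f) : ∃ o, M.IsCircuit o ∧ o ∩ b = {e, f} := by
  obtain ⟨o, ho, h⟩ := hb.isCircuit.exists_isCocircuit_inter_eq_pair he hf hef
  exact ⟨o, dual_isCocircuit_iff.1 ho, h⟩

/-- Two elements lie on a common circuit. -/
def OnCommonCircuit (M : Matroid α) (e f : α) : Prop :=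
  ∃ o, M.IsCircuit o ∧ e ∈ o ∧ f ∈ o

/-- Every circuit lies inside or outside the class `A` of `e`. So the union of a basis of `A` and a
basis of its complement contains no circuit, and a nonempty complement would give a 1-separation. -/
theorem IsConnectedMatroid.reflTransGen (hM : M.IsConnectedMatroid) {e f : α} (he : e ∈ M.E)
    (hf : f ∈ M.E) : Relation.ReflTransGen M.OnCommonCircuit e f := by
  by_contra hef
  set A : Set α := {g ∈ M.E | Relation.ReflTransGen M.OnCommonCircuit e g} with hA
  have hcirc : ∀ o, M.IsCircuit o → ∀ g ∈ o, g ∈ A → o ⊆ A := fun o ho g hg hgA k hk =>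
    ⟨ho.subset_ground hk, hgA.2.tail ⟨o, ho, hg, hk⟩⟩
  obtain ⟨sA, hsA⟩ := M.exists_isBasis A (sep_subset _ _)
  obtain ⟨sB, hsB⟩ := M.exists_isBasis (M.E \ A) sdiff_subset
  have hind : M.Indep (sA ∪ sB) := by
    rw [indep_iff_forall_subset_not_isCircuit
      (union_subset hsA.indep.subset_ground hsB.indep.subset_ground)]
    intro o ho hoc
    by_cases h : ∃ g ∈ o, g ∈ A
    · obtain ⟨g, hg, hgA⟩ := h
      refine hoc.not_indep (hsA.indep.subset fun k hk => ?_)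
      rcases ho hk with h | h
      · exact h
      · exact absurd (hcirc o hoc g hg hgA hk) (hsB.subset h).2
    · push Not at h
      refine hoc.not_indep (hsB.indep.subset fun k hk => ?_)
      rcases ho hk with h' | h'
      · exact absurd (hsA.subset h') (h k hk)
      · exact h'
  obtain ⟨s, hs, hsub⟩ := hind.exists_isBase_superset
  refine hM 1 (by norm_num) A (M.E \ A) ⟨union_sdiff_cancel (sep_subset _ _), disjoint_sdiff_right,
    ?_, ?_, sA, sB, s, hsA, hsB, hs, ?_⟩
  · rw [Nat.cast_one, one_le_encard_iff_nonempty]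
    exact ⟨e, he, Relation.ReflTransGen.refl⟩
  · rw [Nat.cast_one, one_le_encard_iff_nonempty]
    exact ⟨f, hf, fun h => hef h.2⟩
  · rw [sdiff_eq_empty.2 hsub]
    simp

/-- A circuit through `e` and a second element is met by some cocircuit in just these two. If `e` is
in no cocircuit, a chain of circuits starting at `e` therefore never leaves `e`. -/
theorem IsConnectedMatroid.ground_eq_singleton (hM : M.IsConnectedMatroid) {e : α} (he : e ∈ M.E)
    (hc : ∀ b, M.IsCocircuit b → e ∉ b) : M.E = {e} := by
  have hrel : ∀ f, M.OnCommonCircuit e f → f = e := by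
    rintro f ⟨o, ho, heo, hfo⟩
    by_contra hfe
    obtain ⟨b, hb, hbo⟩ := ho.exists_isCocircuit_inter_eq_pair heo hfo (Ne.symm hfe)
    exact hc b hb (hbo.symm ▸ (Or.inl rfl : e ∈ ({e, f} : Set α)) : e ∈ b ∩ o).1
  refine Subset.antisymm (fun f hf => ?_) (singleton_subset_iff.2 he)
  have h := hM.reflTransGen he hf
  induction h with
  | refl => rfl
  | tail hbc hcd ih =>
    rename_i x y
    have : x = e := ih (by obtain ⟨o, ho, hx, -⟩ := hcd; exact ho.subset_ground hx)
    exact hrel _ (this ▸ hcd)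

end Matroid

/-! ### Compact connected sets in Hausdorff spaces -/

section Topology

variable {X : Type*} [TopologicalSpace X]

/-- If the intersection split into two compact parts, disjoint open neighbourhoods of these would by
compactness contain, and hence disconnect, some member of the chain. -/
theorem isPreconnected_sInter_of_isChain [T2Space X] {c : Set (Set X)} (hne : c.Nonempty)
    (hc : IsChain (· ⊆ ·) c) (hcomp : ∀ s ∈ c, IsCompact s) (hconn : ∀ s ∈ c, IsPreconnected s) :
    IsPreconnected (⋂₀ c) := by
  obtain ⟨s₀, hs₀⟩ := hne
  have hclosed : IsClosed (⋂₀ c) := isClosed_sInter fun s hs => (hcomp s hs).isClosed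
  have hcpt : IsCompact (⋂₀ c) :=
    (hcomp s₀ hs₀).of_isClosed_subset hclosed (sInter_subset_of_mem hs₀)
  rw [isPreconnected_iff_subset_of_fully_disjoint_closed hclosed]
  intro u v hu hv huv hd
  obtain ⟨U, V, hU, hV, hUu, hVv, hUV⟩ := (SeparatedNhds.of_isCompact_isCompact
    (hcpt.inter_right hu) (hcpt.inter_right hv) (hd.mono inter_subset_right inter_subset_right))
  have hsub : ⋂ s : c, (s : Set X) ⊆ U ∪ V := by
    intro x hx
    have hx' : x ∈ ⋂₀ c := by rwa [sInter_eq_iInter]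
    rcases huv hx' with h | h
    · exact Or.inl (hUu ⟨hx', h⟩)
    · exact Or.inr (hVv ⟨hx', h⟩)
  have : Nonempty c := ⟨⟨s₀, hs₀⟩⟩
  have hdir : Directed (fun a b : Set X => a ⊇ b) fun s : c => (s : Set X) := by
    intro a b
    rcases hc.total a.2 b.2 with h | h
    · exact ⟨a, Subset.rfl, h⟩
    · exact ⟨b, h, Subset.rfl⟩
  obtain ⟨s, hs⟩ := exists_subset_nhds_of_isCompact hdir (fun s => hcomp s s.2)
    (fun x hx => (hU.union hV).mem_nhds (hsub hx))
  have hle : ⋂₀ c ⊆ (s : Set X) := sInter_subset_of_mem s.2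
  rcases isPreconnected_iff_subset_of_disjoint.1 (hconn s s.2) U V hU hV hs
    (by rw [hUV.inter_eq, inter_empty]) with h | h
  · refine Or.inl fun x hx => (huv hx).resolve_right fun hxv => ?_
    exact disjoint_left.1 hUV (h (hle hx)) (hVv ⟨hx, hxv⟩)
  · refine Or.inr fun x hx => (huv hx).resolve_left fun hxu => ?_
    exact disjoint_left.1 hUV (hUu ⟨hx, hxu⟩) (h (hle hx))

/-- A finite set of points outside the component of `x` in a compact set `R` is separated from `x`
by a partition of `R` into two closed sets. -/
theorem exists_closed_partition_of_notMem_connectedComponentIn [T2Space X] {R : Set X}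
    (hR : IsCompact R) {x : X} (hx : x ∈ R) {T : Set X} (hT : T.Finite)
    (hTx : ∀ y ∈ T, y ∉ connectedComponentIn R x) :
    ∃ A B : Set X, IsClosed A ∧ IsClosed B ∧ Disjoint A B ∧ A ∪ B = R ∧ x ∈ A ∧
      ∀ y ∈ T, y ∉ A := by
  have : CompactSpace R := isCompact_iff_compactSpace.1 hR
  have hZ : ∀ y : X, ∃ Z : Set R, IsClopen Z ∧ (⟨x, hx⟩ : R) ∈ Z ∧
      (y ∈ T → ∀ h : y ∈ R, (⟨y, h⟩ : R) ∉ Z) := by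
    intro y
    by_cases hy : y ∈ T ∧ y ∈ R
    · have h1 : (⟨y, hy.2⟩ : R) ∉ connectedComponent (⟨x, hx⟩ : R) := by
        intro h
        refine hTx y hy.1 ?_
        rw [connectedComponentIn_eq_image hx]
        exact ⟨_, h, rfl⟩
      -- Components equal quasi-components in a compact Hausdorff space, so some clopen set around
      -- `x` misses `y`.
      rw [connectedComponent_eq_iInter_isClopen, mem_iInter] at h1
      push Not at h1
      obtain ⟨Z, hZ⟩ := h1
      exact ⟨Z.1, Z.2.1, Z.2.2, fun _ _ => hZ⟩
    · exact ⟨univ, isClopen_univ, trivial, fun h h' => absurd ⟨h, h'⟩ hy⟩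
  choose Z hZ1 hZ2 hZ3 using hZ
  set W : Set R := ⋂ y ∈ T, Z y with hWdef
  have hW : IsClopen W := hT.isClopen_biInter fun y _ => hZ1 y
  refine ⟨Subtype.val '' W, Subtype.val '' Wᶜ,
    hR.isClosed.isClosedEmbedding_subtypeVal.isClosedMap _ hW.1,
    hR.isClosed.isClosedEmbedding_subtypeVal.isClosedMap _ hW.compl.1,
    ?_, ?_, ⟨⟨x, hx⟩, mem_iInter₂.2 fun y _ => hZ2 y, rfl⟩, ?_⟩
  · exact (disjoint_image_iff Subtype.val_injective).2 disjoint_compl_right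
  · rw [← image_union, union_compl_self, image_univ, Subtype.range_coe]
  · rintro y hy ⟨⟨z, hz⟩, hzW, rfl⟩
    exact hZ3 z hy hz (mem_iInter₂.1 hzW z hy)

theorem IsPreconnected.subset_left_of_closed {s A B : Set X} (hs : IsPreconnected s)
    (hA : IsClosed A) (hB : IsClosed B) (hAB : Disjoint A B) (hsub : s ⊆ A ∪ B) {x : X}
    (hx : x ∈ s) (hxA : x ∈ A) : s ⊆ A := by
  rcases isPreconnected_iff_subset_of_disjoint_closed.1 hs A B hA hB hsub
    (by rw [hAB.inter_eq, inter_empty]) with h | h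
  · exact h
  · exact absurd (h hx) (disjoint_left.1 hAB hxA)

theorem IsPreconnected.subset_left_of_open {s A B : Set X} (hs : IsPreconnected s)
    (hA : IsOpen A) (hB : IsOpen B) (hAB : Disjoint A B) (hsub : s ⊆ A ∪ B) {x : X}
    (hx : x ∈ s) (hxA : x ∈ A) : s ⊆ A := by
  rcases isPreconnected_iff_subset_of_disjoint.1 hs A B hA hB hsub
    (by rw [hAB.inter_eq, inter_empty]) with h | h
  · exact h
  · exact absurd (h hx) (disjoint_left.1 hAB hxA)

end Topology

/-! ### Compact connected subgraphs of graph-like spaces -/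

namespace GraphLikeSpace

open GraphLikePoint

variable {G : GraphLikeSpace.{u}}

/-- `P` contains all or none of the interior points of every edge. -/
def Saturated (P : Set G.Point) : Prop :=
  ∀ (e : G.E) (r r' : Ioo (0 : ℝ) 1), edgePt r e ∈ P → edgePt r' e ∈ P

/-- The edges with an interior point in `P`. -/
def edgesOf (P : Set G.Point) : Set G.E :=
  {e | ∃ r : Ioo (0 : ℝ) 1, edgePt r e ∈ P}

/-- A compact connected set of points that is the union of some vertices and edges. -/
structure IsContinuum (P : Set G.Point) : Prop where
  isCompact : IsCompact P
  isPreconnected : IsPreconnected P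
  saturated : Saturated P

/-- `u` and `v` lie in a compact connected subgraph included in `H`. -/
def Linked (H : Set G.Point) (u v : G.V) : Prop :=
  ∃ P : Set G.Point, P ⊆ H ∧ IsContinuum P ∧ vertex u ∈ P ∧ vertex v ∈ P

theorem Saturated.mem {P : Set G.Point} (h : Saturated P) {e : G.E} (he : e ∈ edgesOf P)
    (r : Ioo (0 : ℝ) 1) : edgePt r e ∈ P := by
  obtain ⟨r', hr'⟩ := he
  exact h e r' r hr'

theorem Saturated.sdiff_innerPoints {P : Set G.Point} (h : Saturated P) (F : Set G.E) :
    Saturated (P \ G.innerPoints F) := by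
  rintro e r r' ⟨h1, h2⟩
  refine ⟨h e r r' h1, ?_⟩
  rintro ⟨s, f, hf, hs⟩
  cases hs
  exact h2 ⟨r, e, hf, rfl⟩

theorem Saturated.union {P Q : Set G.Point} (h : Saturated P) (h' : Saturated Q) :
    Saturated (P ∪ Q) := fun e r r' hr => hr.imp (h e r r') (h' e r r')

@[simp] theorem edgePt_mem_innerPoints {F : Set G.E} {e : G.E} {r : Ioo (0 : ℝ) 1} :
    (edgePt r e : G.Point) ∈ G.innerPoints F ↔ e ∈ F := by
  constructor
  · rintro ⟨s, f, hf, hs⟩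
    cases hs
    exact hf
  · exact fun h => ⟨r, e, h, rfl⟩

@[simp] theorem vertex_notMem_innerPoints {F : Set G.E} {v : G.V} :
    (vertex v : G.Point) ∉ G.innerPoints F := by
  rintro ⟨s, f, hf, hs⟩
  cases hs

theorem isOpen_innerPoints (F : Set G.E) : IsOpen (G.innerPoints F) := by
  have : G.innerPoints F = ⋃ e ∈ F, (fun r : Ioo (0 : ℝ) 1 => (edgePt r e : G.Point)) '' univ := by
    ext p
    simp only [innerPoints, mem_iUnion, mem_image, mem_univ, true_and, exists_prop]
    constructor
    · rintro ⟨r, e, he, rfl⟩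
      exact ⟨e, he, r, rfl⟩
    · rintro ⟨e, he, r, rfl⟩
      exact ⟨r, e, he, rfl⟩
  rw [this]
  exact isOpen_biUnion fun e _ => G.isOpenMap_inner e _ isOpen_univ

/-- The closed edge `ι_e([0,1])`. -/
def closedEdge (G : GraphLikeSpace.{u}) (e : G.E) : Set G.Point :=
  range (G.edge e)

@[simp] theorem edge_zero (e : G.E) : G.edge e 0 = vertex (G.src e) := by
  simp [edge, edgeMap]

@[simp] theorem edge_one (e : G.E) : G.edge e 1 = vertex (G.tgt e) := by
  simp [edge, edgeMap]

theorem edge_coe (e : G.E) (r : Ioo (0 : ℝ) 1) :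
    G.edge e ⟨r, r.2.1.le, r.2.2.le⟩ = edgePt r e := by
  have h0 : (⟨r, r.2.1.le, r.2.2.le⟩ : unitInterval) ≠ 0 := by
    intro h
    exact r.2.1.ne' (congrArg Subtype.val h)
  have h1 : (⟨r, r.2.1.le, r.2.2.le⟩ : unitInterval) ≠ 1 := by
    intro h
    exact r.2.2.ne (congrArg Subtype.val h)
  simp [edge, edgeMap, h0, h1]

theorem mem_closedEdge {e : G.E} {p : G.Point} : p ∈ G.closedEdge e ↔
    p = vertex (G.src e) ∨ p = vertex (G.tgt e) ∨ ∃ r, p = edgePt r e := by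
  constructor
  · rintro ⟨x, rfl⟩
    by_cases h0 : x = 0
    · subst h0
      exact Or.inl (edge_zero e)
    by_cases h1 : x = 1
    · subst h1
      exact Or.inr (Or.inl (edge_one e))
    refine Or.inr (Or.inr ⟨⟨x, unitInterval.pos_iff_ne_zero.2 h0,
      unitInterval.lt_one_iff_ne_one.2 h1⟩, ?_⟩)
    simp only [edge, edgeMap, h0, h1, dite_false]
  · rintro (rfl | rfl | ⟨r, rfl⟩)
    exacts [⟨0, edge_zero e⟩, ⟨1, edge_one e⟩, ⟨_, edge_coe e r⟩]

theorem isCompact_closedEdge (e : G.E) : IsCompact (G.closedEdge e) :=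
  isCompact_range (G.continuous_edge e)

theorem isPreconnected_closedEdge (e : G.E) : IsPreconnected (G.closedEdge e) :=
  isPreconnected_range (G.continuous_edge e)

theorem src_mem_closedEdge (e : G.E) : (vertex (G.src e) : G.Point) ∈ G.closedEdge e :=
  mem_closedEdge.2 (Or.inl rfl)

theorem tgt_mem_closedEdge (e : G.E) : (vertex (G.tgt e) : G.Point) ∈ G.closedEdge e :=
  mem_closedEdge.2 (Or.inr (Or.inl rfl))

theorem edgePt_mem_closedEdge {e f : G.E} {r : Ioo (0 : ℝ) 1} :
    (edgePt r f : G.Point) ∈ G.closedEdge e ↔ f = e := by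
  rw [mem_closedEdge]
  constructor
  · rintro (h | h | ⟨s, h⟩)
    · cases h
    · cases h
    · cases h
      rfl
  · rintro rfl
    exact Or.inr (Or.inr ⟨r, rfl⟩)

theorem saturated_closedEdge (e : G.E) : Saturated (G.closedEdge e) := by
  intro f r r' h
  rw [edgePt_mem_closedEdge] at h ⊢
  exact h

theorem isContinuum_closedEdge (e : G.E) : IsContinuum (G.closedEdge e) :=
  ⟨isCompact_closedEdge e, isPreconnected_closedEdge e, saturated_closedEdge e⟩

theorem closedEdge_subset {P : Set G.Point} (hP : IsClosed P) (hs : Saturated P) {e : G.E}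
    (he : e ∈ edgesOf P) : G.closedEdge e ⊆ P := by
  have h : G.innerPoints {e} ⊆ P := by
    rintro p ⟨r, f, hf, rfl⟩
    rw [mem_singleton_iff.1 hf]
    exact hs.mem he r
  rintro p ⟨x, rfl⟩
  exact hP.closure_subset_iff.2 h (G.edge_mem_closure (mem_singleton e) x)

theorem isPreconnected_innerEdge (e : G.E) : IsPreconnected (G.innerPoints {e}) := by
  have h : G.innerPoints {e} = G.edge e '' (Ioo 0 1) := by
    ext p
    constructor
    · rintro ⟨r, f, hf, rfl⟩
      rw [mem_singleton_iff.1 hf]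
      exact ⟨⟨r, r.2.1.le, r.2.2.le⟩, ⟨r.2.1, r.2.2⟩, edge_coe e r⟩
    · rintro ⟨x, hx, rfl⟩
      exact ⟨⟨x, hx.1, hx.2⟩, e, rfl, (edge_coe e ⟨x, hx.1, hx.2⟩)⟩
  rw [h]
  refine IsPreconnected.image ?_ _ (G.continuous_edge e).continuousOn
  exact isPreconnected_Ioo

theorem Linked.symm {H : Set G.Point} {u v : G.V} (h : Linked H u v) : Linked H v u := by
  obtain ⟨P, hPH, hP, hu, hv⟩ := h
  exact ⟨P, hPH, hP, hv, hu⟩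

theorem Linked.mono {H H' : Set G.Point} {u v : G.V} (h : Linked H u v) (hH : H ⊆ H') :
    Linked H' u v := by
  obtain ⟨P, hPH, hP, hu, hv⟩ := h
  exact ⟨P, hPH.trans hH, hP, hu, hv⟩

theorem IsContinuum.union {P Q : Set G.Point} (hP : IsContinuum P) (hQ : IsContinuum Q)
    {x : G.Point} (hx : x ∈ P) (hx' : x ∈ Q) : IsContinuum (P ∪ Q) :=
  ⟨hP.isCompact.union hQ.isCompact, hP.isPreconnected.union x hx hx' hQ.isPreconnected,
    hP.saturated.union hQ.saturated⟩

theorem Linked.trans {H : Set G.Point} {u v w : G.V} (h : Linked H u v) (h' : Linked H v w) :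
    Linked H u w := by
  obtain ⟨P, hPH, hP, hu, hv⟩ := h
  obtain ⟨Q, hQH, hQ, hv', hw⟩ := h'
  exact ⟨P ∪ Q, union_subset hPH hQH, hP.union hQ hv hv', Or.inl hu, Or.inr hw⟩

theorem isContinuum_vertex (u : G.V) : IsContinuum ({vertex u} : Set G.Point) :=
  ⟨isCompact_singleton, isPreconnected_singleton, fun e r r' h => by cases h⟩

theorem Linked.refl {H : Set G.Point} {u : G.V} (h : vertex u ∈ H) : Linked H u u :=
  ⟨{vertex u}, singleton_subset_iff.2 h, isContinuum_vertex u, rfl, rfl⟩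

theorem IsContinuum.isCompact_sdiff {P : Set G.Point} (hP : IsContinuum P) (F : Set G.E) :
    IsCompact (P \ G.innerPoints F) :=
  hP.isCompact.diff (isOpen_innerPoints F)

section T2

variable [T2Space G.Point]

theorem IsContinuum.isClosed {P : Set G.Point} (hP : IsContinuum P) : IsClosed P :=
  hP.isCompact.isClosed

theorem isClosed_closedEdge (e : G.E) : IsClosed (G.closedEdge e) :=
  (isCompact_closedEdge e).isClosed

theorem IsContinuum.src_mem {P : Set G.Point} (hP : IsContinuum P) {e : G.E}
    (he : e ∈ edgesOf P) : vertex (G.src e) ∈ P :=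
  closedEdge_subset hP.isClosed hP.saturated he (src_mem_closedEdge e)

theorem IsContinuum.tgt_mem {P : Set G.Point} (hP : IsContinuum P) {e : G.E}
    (he : e ∈ edgesOf P) : vertex (G.tgt e) ∈ P :=
  closedEdge_subset hP.isClosed hP.saturated he (tgt_mem_closedEdge e)

/-- Components are unions of vertices and whole edges because the interior of each edge is
connected. -/
theorem isContinuum_connectedComponentIn {R : Set G.Point} (hR : IsCompact R) (hs : Saturated R)
    (x : G.Point) : IsContinuum (connectedComponentIn R x) := by
  by_cases hx : x ∈ R
  · refine ⟨?_, isPreconnected_connectedComponentIn, ?_⟩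
    · refine hR.of_isClosed_subset ?_ (connectedComponentIn_subset R x)
      rw [connectedComponentIn_eq_image hx]
      exact hR.isClosed.isClosedEmbedding_subtypeVal.isClosedMap _ isClosed_connectedComponent
    · intro e r r' hr
      have h1 : G.innerPoints {e} ⊆ R := by
        rintro p ⟨s, f, hf, rfl⟩
        rw [mem_singleton_iff.1 hf]
        exact hs e r s (connectedComponentIn_subset R x hr)
      rw [connectedComponentIn_eq hr]
      exact (isPreconnected_innerEdge e).subset_connectedComponentIn ⟨r, e, rfl, rfl⟩ h1
        ⟨r', e, rfl, rfl⟩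
  · rw [connectedComponentIn_eq_empty hx]
    exact ⟨isCompact_empty, isPreconnected_empty, fun _ _ _ h => h.elim⟩

/-- Boundary bumping: if finitely many edges are removed from a compact connected subgraph, then
the remaining component of each vertex contains an endvertex of a removed edge. -/
theorem IsContinuum.exists_end_mem_component {P : Set G.Point} (hP : IsContinuum P) {F : Set G.E}
    (hF : (F ∩ edgesOf P).Finite) (hne : (F ∩ edgesOf P).Nonempty) {v : G.V} (hv : vertex v ∈ P) :
    ∃ e ∈ F ∩ edgesOf P,
      vertex (G.src e) ∈ connectedComponentIn (P \ G.innerPoints F) (vertex v) ∨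
      vertex (G.tgt e) ∈ connectedComponentIn (P \ G.innerPoints F) (vertex v) := by
  by_contra hcon
  push Not at hcon
  have hvR : (vertex v : G.Point) ∈ P \ G.innerPoints F := ⟨hv, vertex_notMem_innerPoints⟩
  obtain ⟨A, B, hA, hB, hAB, hU, hvA, hT⟩ := exists_closed_partition_of_notMem_connectedComponentIn
    (hP.isCompact_sdiff F) hvR
    (T := (fun e => vertex (G.src e)) '' (F ∩ edgesOf P) ∪
      (fun e => vertex (G.tgt e)) '' (F ∩ edgesOf P))
    ((hF.image _).union (hF.image _)) (by
      rintro y (⟨e, he, rfl⟩ | ⟨e, he, rfl⟩)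
      exacts [(hcon e he).1, (hcon e he).2])
  -- No endvertex of a removed edge is in `A`, so the removed edges can be put back on the side of
  -- `B` without touching `A`. This would disconnect `P`.
  set B' := B ∪ ⋃ e ∈ F ∩ edgesOf P, G.closedEdge e with hB'
  have hB'c : IsClosed B' := hB.union (hF.isClosed_biUnion fun e _ => isClosed_closedEdge e)
  have hdis : Disjoint A B' := by
    rw [disjoint_left]
    rintro p hp (hpB | hpB)
    · exact disjoint_left.1 hAB hp hpB
    · obtain ⟨e, he, hpe⟩ := mem_iUnion₂.1 hpB
      rcases mem_closedEdge.1 hpe with rfl | rfl | ⟨r, rfl⟩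
      · exact hT _ (Or.inl ⟨e, he, rfl⟩) hp
      · exact hT _ (Or.inr ⟨e, he, rfl⟩) hp
      · exact (hU.subset (Or.inl hp)).2 (edgePt_mem_innerPoints.2 he.1)
  have hsub : P ⊆ A ∪ B' := by
    intro p hp
    by_cases hpF : p ∈ G.innerPoints F
    · obtain ⟨r, e, he, rfl⟩ := hpF
      exact Or.inr (Or.inr (mem_iUnion₂.2 ⟨e, ⟨he, r, hp⟩, edgePt_mem_closedEdge.2 rfl⟩))
    · rcases hU.superset ⟨hp, hpF⟩ with h | h
      · exact Or.inl h
      · exact Or.inr (Or.inl h)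
  have hPA := hP.isPreconnected.subset_left_of_closed hA hB'c hdis hsub hv hvA
  obtain ⟨e, he⟩ := hne
  exact hT _ (Or.inl ⟨e, he, rfl⟩) (hPA (hP.src_mem he.2))

/-- If removing an edge separates `u` from `v`, then what remains consists of two connected
pieces, each containing one endvertex of the edge. -/
theorem IsContinuum.exists_split {P : Set G.Point} (hP : IsContinuum P) {u v : G.V}
    (hu : vertex u ∈ P) (hv : vertex v ∈ P) {e : G.E} (he : e ∈ edgesOf P)
    (hsep : vertex v ∉ connectedComponentIn (P \ G.innerPoints {e}) (vertex u)) :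
    ∃ (A B : Set G.Point) (a b : G.V), IsContinuum A ∧ IsContinuum B ∧ Disjoint A B ∧
      A ∪ B = P \ G.innerPoints {e} ∧ vertex u ∈ A ∧ vertex v ∈ B ∧ vertex a ∈ A ∧ vertex b ∈ B ∧
      ((a = G.src e ∧ b = G.tgt e) ∨ (a = G.tgt e ∧ b = G.src e)) := by
  obtain ⟨A, B, hA, hB, hAB, hU, huA, hT⟩ := exists_closed_partition_of_notMem_connectedComponentIn
    (hP.isCompact_sdiff {e}) (x := vertex u) ⟨hu, vertex_notMem_innerPoints⟩
    (finite_singleton (vertex v)) (by rintro y rfl; exact hsep)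
  have hvB : vertex v ∈ B :=
    (hU.superset ⟨hv, vertex_notMem_innerPoints⟩ : vertex v ∈ A ∪ B).resolve_left (hT _ rfl)
  have hclE := closedEdge_subset hP.isClosed hP.saturated he
  -- A part containing neither end of `e` would already be split off from `P` before the removal of
  -- `e`.
  have key : ∀ A B : Set G.Point, IsClosed A → IsClosed B → Disjoint A B →
      A ∪ B = P \ G.innerPoints {e} → A.Nonempty →
      vertex (G.src e) ∈ A ∨ vertex (G.tgt e) ∈ A := by
    intro A B hA hB hAB hU hne
    by_contra hcon
    push Not at hcon
    obtain ⟨x, hx⟩ := hne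
    have hdis : Disjoint A (B ∪ G.closedEdge e) := by
      rw [disjoint_left]
      rintro p hp (hpB | hpB)
      · exact disjoint_left.1 hAB hp hpB
      · rcases mem_closedEdge.1 hpB with rfl | rfl | ⟨r, rfl⟩
        · exact hcon.1 hp
        · exact hcon.2 hp
        · exact (hU.subset (Or.inl hp)).2 (edgePt_mem_innerPoints.2 rfl)
    have hsub : P ⊆ A ∪ (B ∪ G.closedEdge e) := by
      intro p hp
      by_cases hpF : p ∈ G.innerPoints {e}
      · obtain ⟨r, f, hf, rfl⟩ := hpF
        exact Or.inr (Or.inr (edgePt_mem_closedEdge.2 hf))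
      · exact (hU.superset ⟨hp, hpF⟩).imp_right Or.inl
    have hPA := hP.isPreconnected.subset_left_of_closed hA (hB.union (isClosed_closedEdge e)) hdis
      hsub (hU.subset (Or.inl hx)).1 hx
    exact hcon.1 (hPA (hclE (src_mem_closedEdge e)))
  have hends : ∃ a b : G.V, vertex a ∈ A ∧ vertex b ∈ B ∧
      ((a = G.src e ∧ b = G.tgt e) ∨ (a = G.tgt e ∧ b = G.src e)) := by
    have h1 := key A B hA hB hAB hU ⟨_, huA⟩
    have h2 := key B A hB hA hAB.symm (by rw [union_comm, hU]) ⟨_, hvB⟩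
    rcases h1 with h1 | h1 <;> rcases h2 with h2 | h2
    · exact absurd h2 (disjoint_left.1 hAB h1)
    · exact ⟨_, _, h1, h2, Or.inl ⟨rfl, rfl⟩⟩
    · exact ⟨_, _, h1, h2, Or.inr ⟨rfl, rfl⟩⟩
    · exact absurd h2 (disjoint_left.1 hAB h1)
  obtain ⟨a, b, ha, hb, hab⟩ := hends
  have hR : IsClosed (P \ G.innerPoints {e}) := (hP.isCompact_sdiff {e}).isClosed
  -- The rest of `P` is attached to `A` only at `a`. Given a splitting of `A`, the part without `a`
  -- would thus be split off from all of `P`.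
  have hcont : ∀ (A B : Set G.Point) (a b : G.V), IsClosed A → IsClosed B → Disjoint A B →
      A ∪ B = P \ G.innerPoints {e} → vertex a ∈ A → vertex b ∈ B →
      ((a = G.src e ∧ b = G.tgt e) ∨ (a = G.tgt e ∧ b = G.src e)) → IsContinuum A := by
    intro A B a b hA hB hAB hU ha hb hab
    have hAP : A ⊆ P := fun x hx => (hU.subset (Or.inl hx)).1
    have hpre : IsPreconnected A := by
      rw [isPreconnected_iff_subset_of_fully_disjoint_closed hA]
      have main : ∀ x y : Set G.Point, IsClosed x → IsClosed y → A ⊆ x ∪ y → Disjoint x y →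
          vertex a ∈ x → A ⊆ x := by
        intro x y hx hy hxy hd hax
        have hbn : vertex b ∉ A ∩ y := fun h => disjoint_left.1 hAB h.1 hb
        have han : vertex a ∉ A ∩ y := fun h => disjoint_left.1 hd hax h.2
        have hdis : Disjoint (A ∩ x ∪ (B ∪ G.closedEdge e)) (A ∩ y) := by
          rw [disjoint_right]
          rintro p ⟨hpA, hpy⟩ (⟨-, hpx⟩ | hpB | hpE)
          · exact disjoint_left.1 hd hpx hpy
          · exact disjoint_left.1 hAB hpA hpB
          · rcases mem_closedEdge.1 hpE with rfl | rfl | ⟨r, rfl⟩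
            · rcases hab with ⟨h1, h2⟩ | ⟨h1, h2⟩
              · exact han (h1 ▸ ⟨hpA, hpy⟩)
              · exact hbn (h2 ▸ ⟨hpA, hpy⟩)
            · rcases hab with ⟨h1, h2⟩ | ⟨h1, h2⟩
              · exact hbn (h2 ▸ ⟨hpA, hpy⟩)
              · exact han (h1 ▸ ⟨hpA, hpy⟩)
            · exact (hU.subset (Or.inl hpA)).2 (edgePt_mem_innerPoints.2 rfl)
        have hsub : P ⊆ (A ∩ x ∪ (B ∪ G.closedEdge e)) ∪ (A ∩ y) := by
          intro p hp
          by_cases hpF : p ∈ G.innerPoints {e}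
          · obtain ⟨r, f, hf, rfl⟩ := hpF
            exact Or.inl (Or.inr (Or.inr (edgePt_mem_closedEdge.2 hf)))
          · rcases hU.superset ⟨hp, hpF⟩ with h | h
            · rcases hxy h with h' | h'
              · exact Or.inl (Or.inl ⟨h, h'⟩)
              · exact Or.inr ⟨h, h'⟩
            · exact Or.inl (Or.inr (Or.inl h))
        have hPA := hP.isPreconnected.subset_left_of_closed
          ((hA.inter hx).union (hB.union (isClosed_closedEdge e))) (hA.inter hy) hdis hsub
          (hAP ha) (Or.inl ⟨ha, hax⟩)
        intro p hp
        rcases hxy hp with h | h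
        · exact h
        · exact absurd ⟨hp, h⟩ (disjoint_left.1 hdis (hPA (hAP hp)))
      intro x y hx hy hxy hd
      rcases hxy ha with h | h
      · exact Or.inl (main x y hx hy hxy hd h)
      · exact Or.inr (main y x hy hx (by rwa [union_comm]) hd.symm h)
    refine ⟨hP.isCompact.of_isClosed_subset hA hAP, hpre, ?_⟩
    intro f r r' hr
    have hrP := hU.subset (Or.inl hr)
    have hfP : G.innerPoints {f} ⊆ A ∪ B := by
      rintro p ⟨s, g, hg, rfl⟩
      rw [mem_singleton_iff.1 hg, hU]
      exact hP.saturated.sdiff_innerPoints {e} f r s hrP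
    exact (isPreconnected_innerEdge f).subset_left_of_closed hA hB hAB hfP ⟨r, f, rfl, rfl⟩ hr
      ⟨r', f, rfl, rfl⟩
  exact ⟨A, B, a, b, hcont A B a b hA hB hAB hU ha hb hab,
    hcont B A b a hB hA hAB.symm (by rw [union_comm, hU]) hb ha
      (hab.symm.imp (fun h => ⟨h.2, h.1⟩) fun h => ⟨h.2, h.1⟩),
    hAB, hU, huA, hvB, ha, hb, hab⟩

end T2

end GraphLikeSpace

namespace GraphLikeSpace

open GraphLikePoint

variable {G : GraphLikeSpace.{u}}

/-! ### Pseudo-lines from minimal continua -/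

/-- `P` is a continuum containing `u` and `v` in which every edge separates `u` from `v`. -/
structure IsArcBetween (P : Set G.Point) (u v : G.V) : Prop where
  isContinuum : IsContinuum P
  left_mem : vertex u ∈ P
  right_mem : vertex v ∈ P
  edge_separates : ∀ e ∈ edgesOf P,
    vertex v ∉ connectedComponentIn (P \ G.innerPoints {e}) (vertex u)

theorem IsArcBetween.symm {P : Set G.Point} {u v : G.V} (h : IsArcBetween P u v) :
    IsArcBetween P v u := by
  refine ⟨h.isContinuum, h.right_mem, h.left_mem, fun e he hcon => h.edge_separates e he ?_⟩
  rw [← connectedComponentIn_eq hcon]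
  exact mem_connectedComponentIn ⟨h.right_mem, vertex_notMem_innerPoints⟩

/-- A pair of disjoint closed sets covering what remains of `P` after removing `F`, the first
containing `v` and the second containing `w`. -/
def ClosedSeparated (P : Set G.Point) (F : Set G.E) (v w : G.V) : Prop :=
  ∃ A B : Set G.Point, IsClosed A ∧ IsClosed B ∧ Disjoint A B ∧ P \ G.innerPoints F ⊆ A ∪ B ∧
    vertex v ∈ A ∧ vertex w ∈ B

theorem ClosedSeparated.notMem {P : Set G.Point} {F : Set G.E} {v w : G.V}
    (h : ClosedSeparated P F v w) {Z : Set G.Point} (hZ : IsPreconnected Z)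
    (hZP : Z ⊆ P \ G.innerPoints F) (hv : vertex v ∈ Z) : vertex w ∉ Z := by
  obtain ⟨A, B, hA, hB, hAB, hU, hv', hw⟩ := h
  intro hwZ
  have := hZ.subset_left_of_closed hA hB hAB (hZP.trans hU) hv hv'
  exact disjoint_left.1 hAB (this hwZ) hw

section T2

variable [T2Space G.Point]

/-- After removal of an edge, the component of `u` is a strictly smaller continuum; by minimality it
misses `v`. -/
theorem IsArcBetween.of_minimal {u v : G.V} {P : Set G.Point}
    (hP : Minimal (fun P : Set G.Point => IsContinuum P ∧ vertex u ∈ P ∧ vertex v ∈ P) P) :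
    IsArcBetween P u v := by
  refine ⟨hP.prop.1, hP.prop.2.1, hP.prop.2.2, fun e he hcon => ?_⟩
  have hsub := connectedComponentIn_subset (P \ G.innerPoints {e}) (vertex u)
  have h := hP.le_of_le ⟨isContinuum_connectedComponentIn (hP.prop.1.isCompact_sdiff {e})
    (hP.prop.1.saturated.sdiff_innerPoints {e}) (vertex u),
    mem_connectedComponentIn ⟨hP.prop.2.1, vertex_notMem_innerPoints⟩, hcon⟩
    (fun x hx => (hsub hx).1)
  obtain ⟨r, hr⟩ := he
  exact (hsub (h hr)).2 (edgePt_mem_innerPoints.2 rfl)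

/-- Zorn's lemma applies to the continua containing both vertices, since compactness, connectedness
and saturation survive intersections of chains. -/
theorem Linked.exists_isArcBetween {H : Set G.Point} {u v : G.V} (h : Linked H u v) :
    ∃ P ⊆ H, IsArcBetween P u v := by
  obtain ⟨P₀, hP₀H, hP₀, hu, hv⟩ := h
  obtain ⟨P, hPP, hP⟩ := zorn_superset_nonempty
    {P : Set G.Point | IsContinuum P ∧ vertex u ∈ P ∧ vertex v ∈ P} (by
      intro c hc hchain hne
      refine ⟨⋂₀ c, ⟨⟨?_, isPreconnected_sInter_of_isChain hne hchain
        (fun s hs => (hc hs).1.isCompact) (fun s hs => (hc hs).1.isPreconnected), ?_⟩, ?_, ?_⟩,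
        fun s hs => sInter_subset_of_mem hs⟩
      · obtain ⟨s, hs⟩ := hne
        exact (hc hs).1.isCompact.of_isClosed_subset
          (isClosed_sInter fun t ht => (hc ht).1.isClosed) (sInter_subset_of_mem hs)
      · exact fun e r r' hr s hs => (hc hs).1.saturated e r r' (hr s hs)
      · exact fun s hs => (hc hs).2.1
      · exact fun s hs => (hc hs).2.2) P₀ ⟨hP₀, hu, hv⟩
  exact ⟨P, hPP.trans hP₀H, IsArcBetween.of_minimal hP⟩

/-- One of the two pieces that remain after removing an edge from `P`, when the other piece
contains `v`, is again a continuum in which every edge separates the ends. -/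
theorem IsArcBetween.piece {P A B : Set G.Point} {u v a b : G.V} {f : G.E}
    (h : IsArcBetween P u v) (hA : IsContinuum A) (hB : IsContinuum B) (hAB : Disjoint A B)
    (hU : A ∪ B = P \ G.innerPoints {f}) (hf : f ∈ edgesOf P)
    (hu : vertex u ∈ A) (hv : vertex v ∈ B) (ha : vertex a ∈ A) (hb : vertex b ∈ B)
    (hab : (a = G.src f ∧ b = G.tgt f) ∨ (a = G.tgt f ∧ b = G.src f)) :
    IsArcBetween A u a := by
  refine ⟨hA, hu, ha, fun e he hcon => ?_⟩
  obtain ⟨r, hr⟩ := he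
  have hrP := hU.subset (Or.inl hr)
  refine h.edge_separates e ⟨r, hrP.1⟩ ?_
  have hef : f ≠ e := by
    rintro rfl
    exact hrP.2 (edgePt_mem_innerPoints.2 rfl)
  have haf : vertex a ∈ G.closedEdge f := by
    rcases hab with ⟨rfl, -⟩ | ⟨rfl, -⟩
    exacts [src_mem_closedEdge f, tgt_mem_closedEdge f]
  have hbf : vertex b ∈ G.closedEdge f := by
    rcases hab with ⟨-, rfl⟩ | ⟨-, rfl⟩
    exacts [tgt_mem_closedEdge f, src_mem_closedEdge f]
  -- If `u` and `a` were still connected in `A` without `e`, then going on along `f` into `B` would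
  -- connect `u` to `v` in `P` without `e`.
  have hconn : IsPreconnected (connectedComponentIn (A \ G.innerPoints {e}) (vertex u) ∪
      (G.closedEdge f ∪ B)) :=
    isPreconnected_connectedComponentIn.union _ hcon (Or.inl haf)
      ((isPreconnected_closedEdge f).union _ hbf hb hB.isPreconnected)
  refine hconn.subset_connectedComponentIn
    (Or.inl (mem_connectedComponentIn ⟨hu, vertex_notMem_innerPoints⟩)) ?_ (Or.inr (Or.inr hv))
  rintro p (hp | hp | hp)
  · have := connectedComponentIn_subset _ _ hp
    exact ⟨(hU.subset (Or.inl this.1)).1, this.2⟩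
  · refine ⟨closedEdge_subset h.isContinuum.isClosed h.isContinuum.saturated hf hp, ?_⟩
    rintro ⟨s, g, hg, rfl⟩
    rw [mem_singleton_iff.1 hg] at hp
    exact hef (edgePt_mem_closedEdge.1 hp).symm
  · refine ⟨(hU.subset (Or.inr hp)).1, ?_⟩
    rintro ⟨s, g, hg, rfl⟩
    rw [mem_singleton_iff.1 hg] at hp
    exact disjoint_left.1 hAB (hA.saturated e r s hr) hp

/-- The other piece together with the edge `f` meets `A` only in `a`, so it can be added to
whichever of the two closed parts contains `a`. -/
theorem ClosedSeparated.of_piece {P A B : Set G.Point} {a b v w : G.V} {e f : G.E}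
    (hA : IsContinuum A) (hB : IsContinuum B) (hAB : Disjoint A B)
    (hU : A ∪ B = P \ G.innerPoints {f}) (ha : vertex a ∈ A) (hb : vertex b ∈ B)
    (hab : (a = G.src f ∧ b = G.tgt f) ∨ (a = G.tgt f ∧ b = G.src f))
    (hv : vertex v ∈ A) (hw : vertex w ∈ A) (h : ClosedSeparated A {e} v w) :
    ClosedSeparated P {e} v w := by
  have main : ∀ x y : Set G.Point, IsClosed x → IsClosed y → Disjoint x y →
      A \ G.innerPoints {e} ⊆ x ∪ y → vertex a ∈ x →
      IsClosed (A ∩ x ∪ (B ∪ G.closedEdge f)) ∧ IsClosed (A ∩ y) ∧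
      Disjoint (A ∩ x ∪ (B ∪ G.closedEdge f)) (A ∩ y) ∧
      P \ G.innerPoints {e} ⊆ (A ∩ x ∪ (B ∪ G.closedEdge f)) ∪ A ∩ y := by
    intro x y hx hy hd hxy hax
    refine ⟨(hA.isClosed.inter hx).union (hB.isClosed.union (isClosed_closedEdge f)),
      hA.isClosed.inter hy, ?_, ?_⟩
    · have hbn : vertex b ∉ A ∩ y := fun h => disjoint_left.1 hAB h.1 hb
      have han : vertex a ∉ A ∩ y := fun h => disjoint_left.1 hd hax h.2
      rw [disjoint_right]
      rintro p ⟨hpA, hpy⟩ (⟨-, hpx⟩ | hpB | hpE)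
      · exact disjoint_left.1 hd hpx hpy
      · exact disjoint_left.1 hAB hpA hpB
      · rcases mem_closedEdge.1 hpE with rfl | rfl | ⟨r, rfl⟩
        · rcases hab with ⟨h1, h2⟩ | ⟨h1, h2⟩
          · exact han (h1 ▸ ⟨hpA, hpy⟩)
          · exact hbn (h2 ▸ ⟨hpA, hpy⟩)
        · rcases hab with ⟨h1, h2⟩ | ⟨h1, h2⟩
          · exact hbn (h2 ▸ ⟨hpA, hpy⟩)
          · exact han (h1 ▸ ⟨hpA, hpy⟩)
        · exact (hU.subset (Or.inl hpA)).2 (edgePt_mem_innerPoints.2 rfl)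
    · rintro p ⟨hpP, hpe⟩
      by_cases hpf : p ∈ G.innerPoints {f}
      · obtain ⟨r, g, hg, rfl⟩ := hpf
        exact Or.inl (Or.inr (Or.inr (edgePt_mem_closedEdge.2 hg)))
      · rcases hU.superset ⟨hpP, hpf⟩ with h | h
        · rcases hxy ⟨h, hpe⟩ with h' | h'
          · exact Or.inl (Or.inl ⟨h, h'⟩)
          · exact Or.inr ⟨h, h'⟩
        · exact Or.inl (Or.inr (Or.inl h))
  obtain ⟨x, y, hx, hy, hd, hxy, hvx, hwy⟩ := h
  rcases hxy ⟨ha, vertex_notMem_innerPoints⟩ with hax | hay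
  · obtain ⟨h1, h2, h3, h4⟩ := main x y hx hy hd hxy hax
    exact ⟨_, _, h1, h2, h3, h4, Or.inl ⟨hv, hvx⟩, ⟨hw, hwy⟩⟩
  · obtain ⟨h1, h2, h3, h4⟩ := main y x hy hx hd.symm (by rwa [union_comm]) hay
    exact ⟨_, _, h2, h1, h3.symm, by rwa [union_comm], ⟨hv, hvx⟩, Or.inl ⟨hw, hwy⟩⟩

/-- In an arc, vertices separated by finitely many edges are separated by one of them. -/
theorem IsArcBetween.exists_edge_closedSeparated {F : Set G.E} (hF : F.Finite) :
    ∀ {P : Set G.Point} {u v x y : G.V}, IsArcBetween P u v → vertex x ∈ P → vertex y ∈ P →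
      ClosedSeparated P F x y → ∃ e ∈ edgesOf P, ClosedSeparated P {e} x y := by
  induction F, hF using Set.Finite.induction_on with
  | empty =>
    intro P u v x y h hx hy hs
    exact absurd hy (hs.notMem h.isContinuum.isPreconnected (fun p hp => ⟨hp, fun ⟨_, _, h, _⟩ =>
      h.elim⟩) hx)
  | @insert f F' hfF hF' ih =>
    intro P u v x y h hx hy hs
    have hins : G.innerPoints (insert f F') = G.innerPoints {f} ∪ G.innerPoints F' := by
      ext p
      constructor
      · rintro ⟨r, g, rfl | hg, rfl⟩
        · exact Or.inl ⟨r, g, rfl, rfl⟩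
        · exact Or.inr ⟨r, g, hg, rfl⟩
      · rintro (⟨r, g, hg, rfl⟩ | ⟨r, g, hg, rfl⟩)
        · exact ⟨r, g, Or.inl hg, rfl⟩
        · exact ⟨r, g, Or.inr hg, rfl⟩
    by_cases hfP : f ∈ edgesOf P
    · obtain ⟨A, B, a, b, hA, hB, hAB, hU, huA, hvB, ha, hb, hab⟩ :=
        h.isContinuum.exists_split h.left_mem h.right_mem hfP (h.edge_separates f hfP)
      -- If `x` and `y` lie in different pieces of `P` without `f`, then `f` itself separates them.
      -- Otherwise their common piece is an arc without `f`, on which the smaller set `F'` already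
      -- separates them. The ends are kept general so that reversal of the arc covers the other
      -- piece.
      have hrec : ∀ {A B : Set G.Point} {a b u v : G.V}, IsArcBetween P u v → IsContinuum A →
          IsContinuum B → Disjoint A B → A ∪ B = P \ G.innerPoints {f} → vertex u ∈ A →
          vertex v ∈ B → vertex a ∈ A → vertex b ∈ B →
          ((a = G.src f ∧ b = G.tgt f) ∨ (a = G.tgt f ∧ b = G.src f)) →
          vertex x ∈ A → vertex y ∈ A → ∃ e ∈ edgesOf P, ClosedSeparated P {e} x y := by
        intro A B a b u v h hA hB hAB hU huA hvB ha hb hab hx hy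
        have hs' : ClosedSeparated A F' x y := by
          obtain ⟨C, D, hC, hD, hCD, hCDU, hxC, hyD⟩ := hs
          refine ⟨C, D, hC, hD, hCD, fun p hp => hCDU ?_, hxC, hyD⟩
          have := hU.subset (Or.inl hp.1)
          refine ⟨this.1, ?_⟩
          rw [hins]
          rintro (h' | h')
          · exact this.2 h'
          · exact hp.2 h'
        obtain ⟨e, ⟨r, he⟩, hes⟩ := ih (h.piece hA hB hAB hU hfP huA hvB ha hb hab) hx hy hs'
        exact ⟨e, ⟨r, (hU.subset (Or.inl he)).1⟩, hes.of_piece hA hB hAB hU ha hb hab hx hy⟩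
      have hxU : vertex x ∈ A ∪ B := hU.superset ⟨hx, vertex_notMem_innerPoints⟩
      have hyU : vertex y ∈ A ∪ B := hU.superset ⟨hy, vertex_notMem_innerPoints⟩
      rcases hxU with hxA | hxB <;> rcases hyU with hyA | hyB
      · exact hrec h hA hB hAB hU huA hvB ha hb hab hxA hyA
      · exact ⟨f, hfP, A, B, hA.isClosed, hB.isClosed, hAB, hU.superset, hxA, hyB⟩
      · exact ⟨f, hfP, B, A, hB.isClosed, hA.isClosed, hAB.symm,
          by rw [union_comm]; exact hU.superset, hxB, hyA⟩
      · exact hrec h.symm hB hA hAB.symm (by rw [union_comm]; exact hU) hvB huA hb ha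
          (hab.symm.imp (fun h => ⟨h.2, h.1⟩) fun h => ⟨h.2, h.1⟩) hxB hyB
    · refine ih h hx hy ?_
      obtain ⟨C, D, hC, hD, hCD, hCDU, hxC, hyD⟩ := hs
      refine ⟨C, D, hC, hD, hCD, fun p hp => hCDU ⟨hp.1, ?_⟩, hxC, hyD⟩
      rw [hins]
      rintro (⟨r, g, hg, rfl⟩ | h')
      · rw [mem_singleton_iff.1 hg] at hp
        exact hfP ⟨r, hp.1⟩
      · exact hp.2 h'

/-- The two disjoint open sets that separate `x` from `y` cover all vertices, so by compactness they
cover all of `P` except interior points of finitely many edges. -/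
theorem IsContinuum.exists_finite_closedSeparated {P : Set G.Point} (hP : IsContinuum P)
    {x y : G.V} (hx : vertex x ∈ P) (hy : vertex y ∈ P) (hxy : x ≠ y) :
    ∃ F : Set G.E, F.Finite ∧ ClosedSeparated P F x y := by
  obtain ⟨U, U', hU, hU', hd, hc, hxU, hyU⟩ := G.separated x y hxy
  obtain ⟨t, ht⟩ := hP.isCompact.elim_finite_subcover
    -- The index `none` stands for the open set around the vertices, and `some e` for the interior
    -- of the edge `e`.
    (fun o : Option G.E => o.elim (U ∪ U') fun e => G.innerPoints {e})
    (by rintro (_ | e); exacts [hU.union hU', isOpen_innerPoints {e}])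
    (by
      rintro (v | ⟨r, e⟩) hp
      · exact mem_iUnion.2 ⟨none, hc v⟩
      · exact mem_iUnion.2 ⟨some e, edgePt_mem_innerPoints.2 rfl⟩)
  refine ⟨{e | some e ∈ t}, ?_, (P \ G.innerPoints {e | some e ∈ t}) \ U',
    (P \ G.innerPoints {e | some e ∈ t}) \ U, ?_, ?_, ?_, ?_, ?_, ?_⟩
  · exact (t.finite_toSet.preimage (Option.some_injective _).injOn)
  · exact (hP.isCompact_sdiff _).isClosed.sdiff hU'
  · exact (hP.isCompact_sdiff _).isClosed.sdiff hU
  · have hcov : P \ G.innerPoints {e | some e ∈ t} ⊆ U ∪ U' := by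
      rintro p ⟨hp, hpF⟩
      obtain ⟨o, ho, hpo⟩ := mem_iUnion₂.1 (ht hp)
      rcases o with _ | e
      · exact hpo
      · obtain ⟨r, f, hf, rfl⟩ := hpo
        rw [mem_singleton_iff.1 hf] at hpF
        exact absurd (edgePt_mem_innerPoints.2 ho) hpF
    rw [disjoint_left]
    rintro p ⟨hp, h1⟩ ⟨-, h2⟩
    exact (hcov hp).elim h2 h1
  · intro p hp
    by_cases h : p ∈ U
    · exact Or.inl ⟨hp, disjoint_left.1 hd h⟩
    · exact Or.inr ⟨hp, h⟩
  · exact ⟨⟨hx, vertex_notMem_innerPoints⟩, disjoint_left.1 hd hxU⟩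
  · exact ⟨⟨hy, vertex_notMem_innerPoints⟩, disjoint_right.1 hd hyU⟩

end T2

/-! ### The subspace on a set of vertices and edges -/

/-- The inclusion of a subspace, as a function on points. -/
def subIncl (G : GraphLikeSpace.{u}) (V' : Set G.V) (E' : Set G.E)
    (h0 : ∀ e ∈ E', G.src e ∈ V') (h1 : ∀ e ∈ E', G.tgt e ∈ V') :
    (G.subspace V' E' h0 h1).Point → G.Point :=
  inclusion V' E'

theorem isInducing_subIncl {V' : Set G.V} {E' : Set G.E} (h0 : ∀ e ∈ E', G.src e ∈ V')
    (h1 : ∀ e ∈ E', G.tgt e ∈ V') : Topology.IsInducing (G.subIncl V' E' h0 h1) :=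
  ⟨rfl⟩

theorem inclusion_injective {V E : Type u} (V' : Set V) (E' : Set E) :
    Function.Injective (inclusion V' E') := by
  rintro (v | ⟨r, e⟩) (w | ⟨s, f⟩) h <;> simp only [inclusion] at h
  · rw [Subtype.ext (GraphLikePoint.vertex.inj h)]
  · cases h
  · cases h
  · obtain ⟨h1, h2⟩ := GraphLikePoint.edgePt.inj h
    rw [h1, Subtype.ext h2]

/-- The vertices in a set of points. -/
def verticesOf (P : Set G.Point) : Set G.V :=
  {v | vertex v ∈ P}

theorem range_inclusion_of_saturated {P : Set G.Point} (hP : Saturated P) :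
    range (inclusion (verticesOf P) (edgesOf P)) = P := by
  ext p
  constructor
  · rintro ⟨v | ⟨r, e⟩, rfl⟩
    · exact v.2
    · exact hP.mem e.2 r
  · intro hp
    rcases p with v | ⟨r, e⟩
    · exact ⟨vertex ⟨v, hp⟩, rfl⟩
    · exact ⟨edgePt r ⟨e, r, hp⟩, rfl⟩

/-- The inclusion of a subspace as a map of graph-like spaces. -/
def subspaceHom (G : GraphLikeSpace.{u}) (V' : Set G.V) (E' : Set G.E)
    (h0 : ∀ e ∈ E', G.src e ∈ V') (h1 : ∀ e ∈ E', G.tgt e ∈ V') :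
    Hom (G.subspace V' E' h0 h1) G where
  onV := fun v : V' => (v : G.V)
  onE := fun e : E' => Sum.inl ((e : G.E), true)
  continuous_inducedFun := by
    have h : (inducedFun (fun v : V' => (v : G.V)) (fun e : E' => Sum.inl ((e : G.E), true)) :
        GraphLikePoint V' E' → GraphLikePoint G.V G.E) = inclusion V' E' := by
      funext p
      rcases p with v | ⟨r, e⟩ <;> rfl
    have h' := (isInducing_subIncl h0 h1).continuous
    unfold subIncl at h'
    rw [← h] at h'
    exact h'

theorem subspaceHom_toFun (V' : Set G.V) (E' : Set G.E)
    (h0 : ∀ e ∈ E', G.src e ∈ V') (h1 : ∀ e ∈ E', G.tgt e ∈ V') :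
    (subspaceHom G V' E' h0 h1).toFun = G.subIncl V' E' h0 h1 := by
  funext p
  rcases p with v | ⟨r, e⟩ <;> rfl

/-- The pseudo-line is the subspace on the vertices and edges of `P`. Separation carries over
because the inclusion maps a component after deletion of an edge to a connected subset of `P`
without that edge. Two vertices are first separated by finitely many edges and then by a single one.
-/
theorem IsArcBetween.joinedByPseudoArcIn [T2Space G.Point] {P H : Set G.Point} {u v : G.V}
    (h : IsArcBetween P u v) (hPH : P ⊆ H) : G.JoinedByPseudoArcIn H u v := by
  have h0 : ∀ e ∈ edgesOf P, G.src e ∈ verticesOf P := fun e he => h.isContinuum.src_mem he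
  have h1 : ∀ e ∈ edgesOf P, G.tgt e ∈ verticesOf P := fun e he => h.isContinuum.tgt_mem he
  set L := G.subspace (verticesOf P) (edgesOf P) h0 h1 with hL
  have hind : Topology.IsInducing (G.subIncl (verticesOf P) (edgesOf P) h0 h1) :=
    isInducing_subIncl h0 h1
  have hran : range (G.subIncl (verticesOf P) (edgesOf P) h0 h1) = P :=
    range_inclusion_of_saturated h.isContinuum.saturated
  have himage : ∀ (e : L.E) (x : L.V), G.subIncl (verticesOf P) (edgesOf P) h0 h1 ''
      connectedComponentIn (L.removeEdges {e}) (vertex x) ⊆ P \ G.innerPoints {e.1} := by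
    rintro e x p ⟨q, hq, rfl⟩
    have hq' := connectedComponentIn_subset _ _ hq
    refine ⟨hran.subset ⟨q, rfl⟩, ?_⟩
    rintro ⟨r, f, hf, hfq⟩
    rcases q with w | ⟨s, g⟩
    · cases hfq
    · obtain ⟨hg1, hg2⟩ := GraphLikePoint.edgePt.inj hfq
      exact hq' (edgePt_mem_innerPoints.2 (Subtype.ext (hg2.trans hf)))
  have hpre : ∀ (e : L.E) (x : L.V), IsPreconnected (G.subIncl (verticesOf P) (edgesOf P) h0 h1 ''
      connectedComponentIn (L.removeEdges {e}) (vertex x)) := fun e x =>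
    isPreconnected_connectedComponentIn.image _ hind.continuous.continuousOn
  have hself : ∀ (e : L.E) (x : L.V), vertex x.1 ∈ G.subIncl (verticesOf P) (edgesOf P) h0 h1 ''
      connectedComponentIn (L.removeEdges {e}) (vertex x) := fun e x =>
    ⟨vertex x, mem_connectedComponentIn (fun hx => vertex_notMem_innerPoints hx), rfl⟩
  have hline : L.IsPseudoLine ⟨u, h.left_mem⟩ ⟨v, h.right_mem⟩ := by
    refine ⟨?_, ?_, ?_, ?_⟩
    · rw [← isCompact_univ_iff, hind.isCompact_iff, image_univ, hran]
      exact h.isContinuum.isCompact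
    · have : PreconnectedSpace L.Point := by
        refine ⟨?_⟩
        rw [← hind.isPreconnected_image, image_univ, hran]
        exact h.isContinuum.isPreconnected
      exact { toNonempty := ⟨vertex ⟨u, h.left_mem⟩⟩ }
    · intro e hcon
      refine h.edge_separates e.1 e.2 ?_
      exact (hpre e _).subset_connectedComponentIn (hself e _) (himage e _) ⟨_, hcon, rfl⟩
    · intro x y hxy
      obtain ⟨F, hF, hs⟩ := h.isContinuum.exists_finite_closedSeparated x.2 y.2
        (fun hh => hxy (Subtype.ext hh))
      obtain ⟨e, he, hes⟩ := h.exists_edge_closedSeparated hF x.2 y.2 hs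
      refine ⟨⟨e, he⟩, fun hcon => ?_⟩
      exact hes.notMem (hpre ⟨e, he⟩ x) (himage ⟨e, he⟩ x) (hself _ x) ⟨_, hcon, rfl⟩
  refine ⟨L, ⟨u, h.left_mem⟩, ⟨v, h.right_mem⟩, subspaceHom G _ _ h0 h1, hline, ?_, rfl, rfl, ?_⟩
  · rw [subspaceHom_toFun]
    exact inclusion_injective _ _
  · rw [subspaceHom_toFun]
    exact (hran.subset).trans hPH

theorem Linked.joinedByPseudoArcIn [T2Space G.Point] {H : Set G.Point} {u v : G.V}
    (h : Linked H u v) : G.JoinedByPseudoArcIn H u v := by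
  obtain ⟨P, hPH, hP⟩ := h.exists_isArcBetween
  exact hP.joinedByPseudoArcIn hPH

/-- No Hausdorff assumption is made here, which serves the degenerate case of a single vertex. -/
theorem joinedByPseudoArcIn_refl {H : Set G.Point} {u : G.V} (hu : vertex u ∈ H) :
    G.JoinedByPseudoArcIn H u u := by
  set L := G.subspace {u} ∅ (fun _ h => h.elim) (fun _ h => h.elim) with hL
  have huniq : ∀ p : L.Point, p = vertex ⟨u, rfl⟩ := by
    rintro (v | ⟨r, e⟩)
    · exact congrArg _ (Subtype.ext v.2)
    · exact e.2.elim
  have : Subsingleton L.Point := ⟨fun a b => (huniq a).trans (huniq b).symm⟩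
  refine ⟨L, ⟨u, rfl⟩, ⟨u, rfl⟩, subspaceHom G _ _ _ _, ⟨?_, ?_, ?_, ?_⟩, ?_, rfl, rfl, ?_⟩
  · exact Finite.compactSpace
  · have : PreconnectedSpace L.Point := ⟨subsingleton_univ.isPreconnected⟩
    exact { toNonempty := ⟨vertex ⟨u, rfl⟩⟩ }
  · exact fun e => e.2.elim
  · exact fun v w hvw => absurd (Subtype.ext (v.2.trans w.2.symm)) hvw
  · exact Function.injective_of_subsingleton _
  · rintro p ⟨q, rfl⟩
    rw [huniq q]
    exact hu

/-! ### Images of maps of graph-like spaces -/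

/-- A map of graph-like spaces collapses an edge to a vertex or maps it onto all interior points of
an edge. -/
theorem Hom.saturated_range {G' : GraphLikeSpace.{u}} (φ : Hom G G') (S : Set G.E) :
    Saturated (φ.toFun '' ((G.innerPoints S)ᶜ)) := by
  rintro e r r' ⟨p, hp, hpe⟩
  rcases p with v | ⟨s, f⟩
  · cases hpe
  · have hf : f ∉ S := fun h => hp (edgePt_mem_innerPoints.2 h)
    simp only [Hom.toFun, inducedFun] at hpe
    rcases hφ : φ.onE f with ⟨g, _ | _⟩ | v
    · simp only [hφ] at hpe
      obtain ⟨-, rfl⟩ := GraphLikePoint.edgePt.inj hpe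
      refine ⟨edgePt ⟨1 - (r' : ℝ), sub_pos.2 r'.2.2, sub_lt_self 1 r'.2.1⟩ f,
        fun h => hf (edgePt_mem_innerPoints.1 h), ?_⟩
      simp only [Hom.toFun, inducedFun, hφ]
      congr 1
      exact Subtype.ext (sub_sub_cancel _ _)
    · simp only [hφ] at hpe
      obtain ⟨-, rfl⟩ := GraphLikePoint.edgePt.inj hpe
      refine ⟨edgePt r' f, fun h => hf (edgePt_mem_innerPoints.1 h), ?_⟩
      simp only [Hom.toFun, inducedFun, hφ]
    · simp only [hφ] at hpe
      cases hpe

theorem Hom.isContinuum_range {G' : GraphLikeSpace.{u}} (φ : Hom G G')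
    (hc : CompactSpace G.Point) (hconn : ConnectedSpace G.Point) :
    IsContinuum (range φ.toFun) := by
  refine ⟨isCompact_range φ.continuous_inducedFun, isPreconnected_range φ.continuous_inducedFun, ?_⟩
  have h := φ.saturated_range ∅
  have he : (G.innerPoints ∅)ᶜ = univ := by
    rw [compl_univ_iff]
    ext p
    simp [innerPoints]
  rwa [he, image_univ] at h

theorem JoinedByPseudoArcIn.linked {H : Set G.Point} {u v : G.V}
    (h : G.JoinedByPseudoArcIn H u v) : Linked H u v := by
  obtain ⟨L, s, t, φ, hL, -, rfl, rfl, hH⟩ := h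
  exact ⟨range φ.toFun, hH, φ.isContinuum_range hL.compact hL.connected,
    ⟨vertex s, rfl⟩, ⟨vertex t, rfl⟩⟩

theorem Linked.image_subIncl {V' : Set G.V} {E' : Set G.E} {h0 : ∀ e ∈ E', G.src e ∈ V'}
    {h1 : ∀ e ∈ E', G.tgt e ∈ V'} {H : Set (G.subspace V' E' h0 h1).Point} {u v : V'}
    (h : Linked (G := G.subspace V' E' h0 h1) H u v) :
    Linked (G := G) (G.subIncl V' E' h0 h1 '' H) u.1 v.1 := by
  obtain ⟨P, hPH, hP, hu, hv⟩ := h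
  have hcont := (isInducing_subIncl h0 h1).continuous
  refine ⟨G.subIncl V' E' h0 h1 '' P, image_mono hPH, ⟨hP.isCompact.image hcont,
    hP.isPreconnected.image _ hcont.continuousOn, ?_⟩, ⟨_, hu, rfl⟩, ⟨_, hv, rfl⟩⟩
  rintro e r r' ⟨q, hq, hqe⟩
  rcases q with w | ⟨s, g⟩
  · cases hqe
  · obtain ⟨-, rfl⟩ := GraphLikePoint.edgePt.inj hqe
    exact ⟨edgePt r' g, hP.saturated g s r' hq, rfl⟩

/-- A continuum inside the subspace can be pulled back: it is the image of its preimage, and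
compactness and connectedness can be tested on images under an inducing map. -/
theorem Linked.preimage_subIncl {V' : Set G.V} {E' : Set G.E} {h0 : ∀ e ∈ E', G.src e ∈ V'}
    {h1 : ∀ e ∈ E', G.tgt e ∈ V'} {H : Set G.Point} {u v : V'}
    (h : Linked (G := G) H u.1 v.1) (hH : H ⊆ range (G.subIncl V' E' h0 h1)) :
    Linked (G := G.subspace V' E' h0 h1) (G.subIncl V' E' h0 h1 ⁻¹' H) u v := by
  obtain ⟨P, hPH, hP, hu, hv⟩ := h
  have hind := isInducing_subIncl h0 h1
  have him : G.subIncl V' E' h0 h1 '' (G.subIncl V' E' h0 h1 ⁻¹' P) = P :=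
    image_preimage_eq_of_subset (hPH.trans hH)
  refine ⟨G.subIncl V' E' h0 h1 ⁻¹' P, preimage_mono hPH, ⟨?_, ?_, ?_⟩, hu, hv⟩
  · have := hP.isCompact
    rw [← him] at this
    exact hind.isCompact_iff.2 this
  · have := hP.isPreconnected
    rw [← him] at this
    exact hind.isPreconnected_image.1 this
  · exact fun e r r' hr => hP.saturated e.1 r r' hr

end GraphLikeSpace

namespace Matroid.GraphFramework

open GraphLikePoint GraphLikeSpace

variable {α : Type u} {M : Matroid α} (Γ : M.GraphFramework)

/-! ### The topology of `G(M, Γ)` -/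

/-- The edges of `G(M, Γ)` that belong to `s`. -/
def edgeSet (s : Set α) : Set Γ.toGraphLikeSpace.E :=
  (Subtype.val ⁻¹' s : Set M.E)

/-- The interior points of the edges of `G(M, Γ)` that belong to `s`. -/
def inner (s : Set α) : Set Γ.toGraphLikeSpace.Point :=
  Γ.toGraphLikeSpace.innerPoints (Γ.edgeSet s)

variable {Γ}

@[simp] theorem edgePt_mem_inner {s : Set α} {e : M.E} {r : Ioo (0 : ℝ) 1} :
    (edgePt r e : Γ.toGraphLikeSpace.Point) ∈ Γ.inner s ↔ (e : α) ∈ s :=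
  edgePt_mem_innerPoints

@[simp] theorem vertex_notMem_inner {s : Set α} {v : Vert M} :
    (vertex v : Γ.toGraphLikeSpace.Point) ∉ Γ.inner s :=
  vertex_notMem_innerPoints

theorem isOpen_inner (s : Set α) : IsOpen (Γ.inner s) :=
  isOpen_innerPoints _

/-- The set `U_b^i(ε)` as a set of points of the graph-like space. -/
def nbhd (Γ : M.GraphFramework) (b : {b : Set α // M.IsCocircuit b}) (i : ℤˣ)
    (ε : M.E → Ioo (0 : ℝ) 1) : Set Γ.toGraphLikeSpace.Point :=
  Γ.sideSet b i ε

/-- The set `U_b^i(1/2)`. -/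
noncomputable def side (Γ : M.GraphFramework) (b : {b : Set α // M.IsCocircuit b}) (i : ℤˣ) :
    Set Γ.toGraphLikeSpace.Point :=
  Γ.nbhd b i fun _ => ⟨1 / 2, by norm_num, by norm_num⟩

theorem isOpen_nbhd (b : {b : Set α // M.IsCocircuit b}) (i : ℤˣ) (ε : M.E → Ioo (0 : ℝ) 1) :
    IsOpen (Γ.nbhd b i ε) :=
  TopologicalSpace.isOpen_generateFrom_of_mem (Or.inr ⟨b, i, ε, rfl⟩)

theorem isOpen_side (b : {b : Set α // M.IsCocircuit b}) (i : ℤˣ) : IsOpen (Γ.side b i) :=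
  isOpen_nbhd b i _

@[simp] theorem vertex_mem_side {b : {b : Set α // M.IsCocircuit b}} {i : ℤˣ} {v : Vert M} :
    (vertex v : Γ.toGraphLikeSpace.Point) ∈ Γ.side b i ↔ v b = i :=
  Iff.rfl

theorem edgePt_mem_nbhd {b : {b : Set α // M.IsCocircuit b}} {i : ℤˣ}
    {ε : M.E → Ioo (0 : ℝ) 1} {e : M.E} {r : Ioo (0 : ℝ) 1} :
    (edgePt r e : Γ.toGraphLikeSpace.Point) ∈ Γ.nbhd b i ε ↔
      ((e : α) ∉ b.1 ∧ Γ.σ b.1 e = i) ∨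
        ((e : α) ∈ b.1 ∧ Γ.d b.1 e = i ∧ 1 - (ε e : ℝ) < (r : ℝ)) ∨
        ((e : α) ∈ b.1 ∧ Γ.d b.1 e = -i ∧ (r : ℝ) < (ε e : ℝ)) :=
  Iff.rfl

theorem edgePt_mem_nbhd_of_notMem {b : {b : Set α // M.IsCocircuit b}} {i : ℤˣ}
    {ε : M.E → Ioo (0 : ℝ) 1} {e : M.E} {r : Ioo (0 : ℝ) 1} (he : (e : α) ∉ b.1) :
    (edgePt r e : Γ.toGraphLikeSpace.Point) ∈ Γ.nbhd b i ε ↔ Γ.σ b.1 e = i := by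
  rw [edgePt_mem_nbhd]
  tauto

theorem edgePt_mem_side_of_notMem {b : {b : Set α // M.IsCocircuit b}} {i : ℤˣ} {e : M.E}
    {r : Ioo (0 : ℝ) 1} (he : (e : α) ∉ b.1) :
    (edgePt r e : Γ.toGraphLikeSpace.Point) ∈ Γ.side b i ↔ Γ.σ b.1 e = i :=
  edgePt_mem_nbhd_of_notMem he

theorem units_eq_neg_of_ne {i j : ℤˣ} (h : i ≠ j) : j = -i := by
  revert i j
  decide

theorem units_ne_neg (i : ℤˣ) : i ≠ -i := by
  revert i
  decide

theorem disjoint_side (b : {b : Set α // M.IsCocircuit b}) (i : ℤˣ) :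
    Disjoint (Γ.side b i) (Γ.side b (-i)) :=
  Γ.disjoint_sideSet_half b i

/-- Vertices and edges outside `b` each carry a definite sign at `b`. Together with `disjoint_side`
this makes the two sides an open partition of everything outside `b`. -/
theorem compl_inner_subset (b : {b : Set α // M.IsCocircuit b}) (i : ℤˣ) :
    (Γ.inner b.1)ᶜ ⊆ Γ.side b i ∪ Γ.side b (-i) := by
  rintro (v | ⟨r, e⟩) hp
  · by_cases h : i = (v : Vert M) b
    · exact Or.inl h.symm
    · exact Or.inr (units_eq_neg_of_ne h)
  · have he : (e : M.E).1 ∉ b.1 := fun h => hp (edgePt_mem_inner.2 h)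
    by_cases h : i = Γ.σ b.1 (e : M.E).1
    · exact Or.inl ((edgePt_mem_side_of_notMem he).2 h.symm)
    · exact Or.inr ((edgePt_mem_side_of_notMem he).2 (units_eq_neg_of_ne h))

theorem nbhd_mono {b : {b : Set α // M.IsCocircuit b}} {i : ℤˣ} {ε ε' : M.E → Ioo (0 : ℝ) 1}
    (h : ∀ e, ε e ≤ ε' e) : Γ.nbhd b i ε ⊆ Γ.nbhd b i ε' := by
  rintro (v | ⟨r, e⟩) hp
  · exact hp
  · have h' : ((ε e : Ioo (0 : ℝ) 1) : ℝ) ≤ ε' e := h e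
    refine edgePt_mem_nbhd.2 ((edgePt_mem_nbhd.1 hp).imp id (Or.imp ?_ ?_))
    · rintro ⟨h1, h2, h3⟩
      exact ⟨h1, h2, by linarith⟩
    · rintro ⟨h1, h2, h3⟩
      exact ⟨h1, h2, by linarith⟩

/-- The basic neighbourhoods of vertices. -/
theorem exists_nbhd_subset {U : Set Γ.toGraphLikeSpace.Point} (hU : IsOpen U) {x : Vert M}
    (hx : vertex x ∈ U) :
    ∃ (B : Finset {b : Set α // M.IsCocircuit b})
      (ε : {b : Set α // M.IsCocircuit b} → M.E → Ioo (0 : ℝ) 1),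
      (⋂ b ∈ B, Γ.nbhd b (x b) (ε b)) ⊆ U := by
  classical
  have hU' : TopologicalSpace.GenerateOpen
    {S | (∃ (W : Set (Ioo (0 : ℝ) 1)) (e : M.E), IsOpen W ∧ S = (fun r => edgePt r e) '' W) ∨
      ∃ b i ε, S = Γ.sideSet b i ε} U := hU
  clear hU
  induction hU' with
  | basic S hS =>
    rcases hS with ⟨W, e, hW, rfl⟩ | ⟨b, i, ε, rfl⟩
    · obtain ⟨r, -, hr⟩ := hx
      cases hr
    · refine ⟨{b}, fun _ => ε, ?_⟩
      have hi : x b = i := hx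
      intro p hp
      have := mem_iInter₂.1 hp b (Finset.mem_singleton_self b)
      rwa [hi] at this
  | univ => exact ⟨∅, fun _ _ => ⟨1 / 2, by norm_num, by norm_num⟩, subset_univ _⟩
  | inter S T hS hT ihS ihT =>
    obtain ⟨B₁, ε₁, h₁⟩ := ihS hx.1
    obtain ⟨B₂, ε₂, h₂⟩ := ihT hx.2
    -- A cocircuit may occur in both families, with different bounds; the pointwise minimum serves
    -- both.
    refine ⟨B₁ ∪ B₂, fun b e => min (ε₁ b e) (ε₂ b e), fun p hp => ⟨h₁ ?_, h₂ ?_⟩⟩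
    · exact mem_iInter₂.2 fun b hb => nbhd_mono (fun e => min_le_left _ _)
        (mem_iInter₂.1 hp b (Finset.mem_union_left _ hb))
    · exact mem_iInter₂.2 fun b hb => nbhd_mono (fun e => min_le_right _ _)
        (mem_iInter₂.1 hp b (Finset.mem_union_right _ hb))
  | sUnion 𝒮 h𝒮 ih =>
    obtain ⟨S, hS, hxS⟩ := hx
    obtain ⟨B, ε, h⟩ := ih S hS hxS
    exact ⟨B, ε, h.trans (subset_sUnion_of_mem hS)⟩

theorem le_nhds_vertex {f : Filter Γ.toGraphLikeSpace.Point} {x : Vert M}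
    (h : ∀ b ε, Γ.nbhd b (x b) ε ∈ f) : f ≤ nhds (X := Γ.toGraphLikeSpace.Point) (vertex x) := by
  intro U hU
  obtain ⟨V, hVU, hV, hxV⟩ := mem_nhds_iff.1 hU
  obtain ⟨B, ε, hB⟩ := exists_nbhd_subset hV hxV
  refine Filter.mem_of_superset ?_ (hB.trans hVU)
  exact (Filter.biInter_finset_mem B).2 fun b _ => h b (ε b)

/-- The critical pair is a vertex and an interior point of an edge `e`: a cocircuit through `e`
gives neighbourhoods of the vertex that meet `e` only near one end. Without such a cocircuit, each
set `U_b^i(ε)` contains all or none of the interior of `e`. -/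
theorem t2Space (hE : ∀ e : M.E, ∃ b, M.IsCocircuit b ∧ (e : α) ∈ b) :
    T2Space Γ.toGraphLikeSpace.Point := by
  have hop : ∀ (e : M.E) (W : Set (Ioo (0 : ℝ) 1)), IsOpen W →
      IsOpen ((fun r => (edgePt r e : Γ.toGraphLikeSpace.Point)) '' W) := fun e W hW =>
    Γ.toGraphLikeSpace.isOpenMap_inner e W hW
  have hve : ∀ (v : Vert M) (r : Ioo (0 : ℝ) 1) (e : M.E),
      ∃ U V : Set Γ.toGraphLikeSpace.Point, IsOpen U ∧ IsOpen V ∧ vertex v ∈ U ∧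
        edgePt r e ∈ V ∧ Disjoint U V := by
    intro v r e
    obtain ⟨b, hb, heb⟩ := hE e
    have hr0 := r.2.1
    have hr1 := r.2.2
    -- Half the distance from `r` to the nearer end leaves room on both sides.
    set δ : ℝ := min (r : ℝ) (1 - r) / 2 with hδ
    have hδ0 : 0 < δ := by
      have : 0 < min (r : ℝ) (1 - r) := lt_min hr0 (by linarith)
      linarith
    have hδr : δ < r := by
      have : min (r : ℝ) (1 - r) ≤ r := min_le_left _ _
      linarith
    have hδr' : δ < 1 - r := by
      have : min (r : ℝ) (1 - r) ≤ 1 - r := min_le_right _ _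
      linarith
    refine ⟨Γ.nbhd ⟨b, hb⟩ (v ⟨b, hb⟩) fun _ => ⟨δ, hδ0, by linarith⟩,
      (fun r => edgePt r e) '' {t : Ioo (0 : ℝ) 1 | δ < (t : ℝ) ∧ (t : ℝ) < 1 - δ},
      isOpen_nbhd _ _ _, hop e _ ?_, rfl, ⟨r, ⟨hδr, by linarith⟩, rfl⟩, ?_⟩
    · exact (isOpen_lt continuous_const continuous_subtype_val).inter
        (isOpen_lt continuous_subtype_val continuous_const)
    · rw [disjoint_right]
      rintro _ ⟨t, ⟨ht1, ht2⟩, rfl⟩ hp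
      rcases edgePt_mem_nbhd.1 hp with h | ⟨-, -, h⟩ | ⟨-, -, h⟩
      · exact h.1 heb
      · have h' : 1 - δ < (t : ℝ) := h
        linarith
      · have h' : (t : ℝ) < δ := h
        linarith
  refine ⟨?_⟩
  rintro (v | ⟨r, e⟩) (w | ⟨s, f⟩) hne
  · obtain ⟨U, V, hU, hV, hd, -, hv, hw⟩ :=
      Γ.toGraphLikeSpace.separated v w (fun h => hne (congrArg vertex h))
    exact ⟨U, V, hU, hV, hv, hw, hd⟩
  · exact hve v s f
  · obtain ⟨U, V, hU, hV, h1, h2, hd⟩ := hve w r e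
    exact ⟨V, U, hV, hU, h2, h1, hd.symm⟩
  · by_cases hef : e = f
    · subst hef
      have hrs : r ≠ s := fun h => hne (by rw [h])
      obtain ⟨U, V, hU, hV, hr, hs, hd⟩ := t2_separation hrs
      refine ⟨_, _, hop e U hU, hop e V hV, ⟨r, hr, rfl⟩, ⟨s, hs, rfl⟩, ?_⟩
      refine (disjoint_image_iff ?_).2 hd
      intro a b hab
      exact (GraphLikePoint.edgePt.inj hab).1
    · refine ⟨_, _, hop e univ isOpen_univ, hop f univ isOpen_univ, ⟨r, trivial, rfl⟩,
        ⟨s, trivial, rfl⟩, ?_⟩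
      rw [disjoint_left]
      rintro _ ⟨a, -, rfl⟩ ⟨b, -, hb⟩
      exact hef (GraphLikePoint.edgePt.inj hb).2.symm

/-- A connected set that contains no interior point of `b` lies on one side of `b`. -/
theorem subset_side {Z : Set Γ.toGraphLikeSpace.Point} (hZ : IsPreconnected Z)
    {b : {b : Set α // M.IsCocircuit b}} (hb : Disjoint Z (Γ.inner b.1)) {v : Vert M}
    (hv : vertex v ∈ Z) : Z ⊆ Γ.side b (v b) :=
  hZ.subset_left_of_open (isOpen_side b _) (isOpen_side b _) (disjoint_side b _)
    (fun _ hp => compl_inner_subset b (v b) (disjoint_left.1 hb hp)) hv rfl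

/-- The sign at `b` is an invariant of linkedness avoiding `b`. All separation arguments with
cocircuits below use it in this form or through `subset_side`. -/
theorem Linked.apply_eq {b : {b : Set α // M.IsCocircuit b}} {H : Set Γ.toGraphLikeSpace.Point}
    {v w : Vert M} (h : Linked H v w) (hb : Disjoint H (Γ.inner b.1)) : v b = w b := by
  obtain ⟨P, hPH, hP, hv, hw⟩ := h
  exact (subset_side hP.isPreconnected (hb.mono_left hPH) hv hw).symm

/-- The inequalities that define the sides are strict, so with bound `1/2` the midpoint of an edge
of `b` is left out on both sides. -/
theorem edgePt_half_notMem_side {b : {b : Set α // M.IsCocircuit b}} {i : ℤˣ} {e : M.E}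
    (he : (e : α) ∈ b.1) :
    (edgePt ⟨1 / 2, by norm_num, by norm_num⟩ e : Γ.toGraphLikeSpace.Point) ∉ Γ.side b i := by
  intro h
  rcases edgePt_mem_nbhd.1 h with h | ⟨-, -, h⟩ | ⟨-, -, h⟩
  · exact h.1 he
  · norm_num at h
  · norm_num at h

/-- Cover the continuum by the two sides of `b` and the interiors of single edges. The midpoint of
an edge of `b` is covered only by the interior of that edge, so a finite subcover bounds their
number. -/
theorem finite_inter_cocircuit {P : Set Γ.toGraphLikeSpace.Point} (hP : IsContinuum P)
    (b : {b : Set α // M.IsCocircuit b}) : (Γ.edgeSet b.1 ∩ edgesOf P).Finite := by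
  obtain ⟨t, ht⟩ := hP.isCompact.elim_finite_subcover
    (fun o : Option Γ.toGraphLikeSpace.E => o.elim (Γ.side b 1 ∪ Γ.side b (-1))
      fun e => Γ.toGraphLikeSpace.innerPoints {e})
    (by rintro (_ | e); exacts [(isOpen_side b _).union (isOpen_side b _), isOpen_innerPoints {e}])
    (by
      rintro (v | ⟨r, e⟩) -
      · exact mem_iUnion.2 ⟨none, compl_inner_subset b 1 (vertex_notMem_inner (s := b.1))⟩
      · exact mem_iUnion.2 ⟨some e, edgePt_mem_innerPoints.2 rfl⟩)
  refine (t.finite_toSet.preimage (Option.some_injective _).injOn).subset ?_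
  rintro e ⟨he, heP⟩
  obtain ⟨o, ho, hpo⟩ := mem_iUnion₂.1
    (ht (hP.saturated.mem heP ⟨1 / 2, by norm_num, by norm_num⟩))
  rcases o with _ | f
  · rcases hpo with h | h <;> exact absurd h (edgePt_half_notMem_side he)
  · obtain ⟨r, g, hg, hrg⟩ := hpo
    obtain ⟨-, hgf⟩ := GraphLikePoint.edgePt.inj hrg
    rw [mem_singleton_iff] at hg
    rw [hgf, hg]
    exact ho

/-- An ultrafilter on `P` either lives on one closed edge, which is compact, or avoids every
cocircuit, as each has only finitely many edges in `P`. In the latter case it chooses a side of each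
cocircuit. Since every system of choices is a vertex of `G(M, Γ)`, it converges to that vertex. -/
theorem isCompact_of_finite_inter {P : Set Γ.toGraphLikeSpace.Point} (hP : IsClosed P)
    (hs : Saturated P)
    (hfin : ∀ b : {b : Set α // M.IsCocircuit b}, (Γ.edgeSet b.1 ∩ edgesOf P).Finite) :
    IsCompact P := by
  classical
  rw [isCompact_iff_ultrafilter_le_nhds]
  intro f hf
  have hfP : P ∈ f := Filter.le_principal_iff.1 hf
  by_cases hcase : ∃ e ∈ edgesOf P, Γ.toGraphLikeSpace.closedEdge e ∈ f
  · obtain ⟨e, he, hef⟩ := hcase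
    obtain ⟨x, hx, hfx⟩ := isCompact_iff_ultrafilter_le_nhds.1 (isCompact_closedEdge e) f
      (Filter.le_principal_iff.2 hef)
    exact ⟨x, closedEdge_subset hP hs he hx, hfx⟩
  · push Not at hcase
    have hout : ∀ b : {b : Set α // M.IsCocircuit b}, (Γ.inner b.1)ᶜ ∈ f := by
      intro b
      have h1 : (⋃ e ∈ Γ.edgeSet b.1 ∩ edgesOf P, Γ.toGraphLikeSpace.closedEdge e) ∉ f := by
        rw [Ultrafilter.finite_biUnion_mem_iff (hfin b)]
        rintro ⟨e, he, h⟩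
        exact hcase e he.2 h
      have h2 := Filter.inter_mem hfP (Ultrafilter.compl_mem_iff_notMem.2 h1)
      refine Filter.mem_of_superset h2 ?_
      rintro p ⟨hp, hp'⟩ ⟨r, e, he, rfl⟩
      exact hp' (mem_iUnion₂.2 ⟨e, ⟨he, r, hp⟩, edgePt_mem_closedEdge.2 rfl⟩)
    set v : Vert M := fun b => if Γ.side b 1 ∈ f then 1 else -1 with hv
    have hvside : ∀ b, Γ.side b (v b) ∈ f := by
      intro b
      by_cases h : Γ.side b 1 ∈ f
      · simp [hv, h]
      · have h1 := Filter.mem_of_superset (hout b) (compl_inner_subset b 1)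
        have h2 := (Ultrafilter.union_mem_iff.1 h1).resolve_left h
        simpa [hv, h] using h2
    have hle : (f : Filter Γ.toGraphLikeSpace.Point) ≤
        nhds (X := Γ.toGraphLikeSpace.Point) (vertex v) := by
      refine le_nhds_vertex fun b ε => Filter.mem_of_superset
        (Filter.inter_mem (hout b) (hvside b)) ?_
      rintro (w | ⟨r, e⟩) ⟨hp, hp'⟩
      · exact hp'
      · have he : (e : M.E).1 ∉ b.1 := fun h => hp (edgePt_mem_inner.2 h)
        exact (edgePt_mem_nbhd_of_notMem he).2 ((edgePt_mem_side_of_notMem he).1 hp')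
    exact ⟨vertex v, isClosed_iff_ultrafilter.1 hP _ f hle hfP, hle⟩

end Matroid.GraphFramework

/-! ### Finite subsets of cyclic orders -/

namespace IsCyclicOrderOn

variable {α : Type u} {X : Set α} {R : α → α → α → Prop}

theorem ne (hR : IsCyclicOrderOn X R) {a b c : α} (h : R a b c) : a ≠ b ∧ b ≠ c ∧ a ≠ c := by
  have key : ∀ x y, ¬ R x x y := fun x y hxy =>
    hR.asymm _ _ _ hxy (hR.cyclic _ _ _ (hR.cyclic _ _ _ hxy))
  refine ⟨?_, ?_, ?_⟩ <;> rintro rfl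
  · exact key _ _ h
  · exact key _ _ (hR.cyclic _ _ _ h)
  · exact key _ _ (hR.cyclic _ _ _ (hR.cyclic _ _ _ h))

/-- Walking clockwise from `p` to its successor `q` in `s` through the points of a larger finite
set `s'`. -/
theorem clockwise_induction (hR : IsCyclicOrderOn X R) {s s' : Set α} (hss : s ⊆ s')
    (hfin : s'.Finite) (hX : s' ⊆ X) {p q : α} (hpq : ClockwiseAdjacent R s p q)
    {C D : α → Prop} (hp : D p) (hstep : ∀ r r', ClockwiseAdjacent R s' r r' → D r → C r')
    (hcross : ∀ r ∈ s', r ∉ s → C r → D r) : C q := by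
  have hps := hss hpq.1
  have hlt : ∀ {a b : α}, a ∈ s' → R p a b →
      {g ∈ s' | R p g a}.ncard < {g ∈ s' | R p g b}.ncard := by
    intro a b ha hab
    refine ncard_lt_ncard ?_ (hfin.subset (sep_subset _ _))
    refine ⟨fun h hh => ⟨hh.1, ?_⟩, fun hsub => ?_⟩
    · exact hR.trans _ _ _ _ hh.2 hab
    · exact (hR.ne (hsub ⟨ha, hab⟩ : a ∈ {g ∈ s' | R p g a}).2).2.1 rfl
  -- Strong induction on the number of points of `s'` strictly between `p` and `r`.
  have main : ∀ n : ℕ, ∀ r ∈ s', (r = q ∨ R p r q) → {g ∈ s' | R p g r}.ncard = n → C r := by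
    intro n
    induction n using Nat.strong_induction_on with
    | _ n ih =>
      intro r hr hrq hn
      have hpr : p ≠ r := by
        rcases hrq with rfl | h
        · exact hpq.2.2.1
        · exact (hR.ne h).1
      by_cases hemp : {g ∈ s' | R p g r} = ∅
      · refine hstep p r ⟨hps, hr, hpr, fun g hg hgp hgr => ?_⟩ hp
        rcases hR.total p (hX hps) r (hX hr) g (hX hg) hpr (Ne.symm hgr) (Ne.symm hgp) with h | h
        · exact h
        · exact absurd ⟨hg, hR.cyclic _ _ _ (hR.cyclic _ _ _ h)⟩ (hemp ▸ notMem_empty g)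
      -- The point between `p` and `r` with the most points of `s'` before it is the predecessor of
      -- `r`.
      · obtain ⟨r', ⟨hr', hpr'⟩, hmax⟩ := Set.exists_max_image {g ∈ s' | R p g r}
          (fun g => {h ∈ s' | R p h g}.ncard) (hfin.subset (sep_subset _ _))
          (nonempty_iff_ne_empty.2 hemp)
        have hne := hR.ne hpr'
        have hadj : ClockwiseAdjacent R s' r' r := by
          refine ⟨hr', hr, hne.2.1, fun g hg hgr' hgr => ?_⟩
          by_cases hgp : g = p
          · exact hgp ▸ hR.cyclic _ _ _ hpr'
          rcases hR.total r' (hX hr') r (hX hr) g (hX hg) hne.2.1 (Ne.symm hgr) (Ne.symm hgr')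
            with h | h
          · exact h
          · exfalso
            have h1 : R r' g r := hR.cyclic _ _ _ (hR.cyclic _ _ _ h)
            have h2 : R r' r p := hR.cyclic _ _ _ hpr'
            have h3 : R p r' g := hR.cyclic _ _ _ (hR.cyclic _ _ _ (hR.trans _ _ _ _ h1 h2))
            have h4 : R p g r := hR.cyclic _ _ _ (hR.trans _ _ _ _ (hR.cyclic _ _ _ h2)
              (hR.cyclic _ _ _ (hR.cyclic _ _ _ h1)))
            exact absurd (hmax g ⟨hg, h4⟩) (not_le.2 (hlt hr' h3))
        have hr'q : R p r' q := by
          rcases hrq with rfl | h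
          · exact hpr'
          · exact hR.trans _ _ _ _ hpr' h
        -- No point of `s` lies strictly between the consecutive points `p` and `q`.
        have hr's : r' ∉ s := by
          intro h
          have h1 := hpq.2.2.2 r' h hne.1.symm (hR.ne hr'q).2.1
          exact hR.asymm _ _ _ hr'q (hR.cyclic _ _ _ h1)
        refine hstep r' r hadj (hcross r' hr' hr's ?_)
        exact ih _ (hn ▸ hlt hr' hpr') r' hr' (Or.inr hr'q) rfl
  exact main _ q (hss hpq.2.1) (Or.inl rfl) rfl

/-- Every element of a finite set has a clockwise predecessor. -/
theorem exists_pred (hR : IsCyclicOrderOn X R) {s : Set α} (hfin : s.Finite) (hX : s ⊆ X) {q : α}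
    (hq : q ∈ s) (hne : ∃ p ∈ s, p ≠ q) : ∃ p, ClockwiseAdjacent R s p q := by
  obtain ⟨p₀, hp₀, hp₀q⟩ := hne
  by_contra hcon
  push Not at hcon
  have : ClockwiseAdjacent R {p₀, q} p₀ q → False := by
    intro hadj
    -- If nothing precedes `q`, then no step of the walk from `p₀` to `q` ends in `q`; the predicate
    -- "different from `q`" is carried all the way to `q`.
    refine hR.clockwise_induction (C := fun x => x ≠ q) (D := fun _ => True)
      (insert_subset_iff.2 ⟨hp₀, singleton_subset_iff.2 hq⟩) hfin hX hadj trivial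
      (fun r r' h _ hr' => hcon r (hr' ▸ h)) (fun _ _ _ _ => trivial) rfl
  refine this ⟨Or.inl rfl, Or.inr rfl, hp₀q, ?_⟩
  rintro g (rfl | hg) h1 h2
  · exact absurd rfl h1
  · exact absurd hg h2

end IsCyclicOrderOn

namespace GraphLikeSpace

open GraphLikePoint

variable {G : GraphLikeSpace.{u}}

theorem edgePt_mem_closure_innerPoints {F : Set G.E} {e : G.E} {r : Ioo (0 : ℝ) 1} :
    (edgePt r e : G.Point) ∈ closure (G.innerPoints F) ↔ e ∈ F := by
  constructor
  · intro h
    obtain ⟨p, ⟨s, f, hf, hp⟩, s', g, hg, hp'⟩ :=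
      mem_closure_iff.1 h (G.innerPoints {e}) (isOpen_innerPoints _) ⟨r, e, rfl, rfl⟩
    have := (GraphLikePoint.edgePt.inj (hp.symm.trans hp')).2
    rw [← (mem_singleton_iff.1 hf), this]
    exact hg
  · exact fun h => subset_closure ⟨r, e, h, rfl⟩

theorem saturated_closure_innerPoints (F : Set G.E) : Saturated (closure (G.innerPoints F)) :=
  fun _ _ _ h => edgePt_mem_closure_innerPoints.2 (edgePt_mem_closure_innerPoints.1 h)

theorem edgesOf_closure_innerPoints (F : Set G.E) : edgesOf (closure (G.innerPoints F)) = F := by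
  ext e
  exact ⟨fun ⟨_, hr⟩ => edgePt_mem_closure_innerPoints.1 hr,
    fun h => ⟨⟨1 / 2, by norm_num, by norm_num⟩, edgePt_mem_closure_innerPoints.2 h⟩⟩

end GraphLikeSpace

namespace Matroid.GraphFramework

open GraphLikePoint GraphLikeSpace

variable {α : Type u} {M : Matroid α} {Γ : M.GraphFramework}

/-! ### The standard subspace of a circuit -/

open scoped Classical in
/-- The endvertex at which the edge `e` of the circuit `o` ends when `o` is traversed clockwise. -/
noncomputable def headV (Γ : M.GraphFramework) (o : Set α) (e : α) : Vert M :=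
  fun b => if e ∈ b.1 then Γ.c o e * Γ.d b.1 e else Γ.σ b.1 e

open scoped Classical in
/-- The endvertex at which the edge `e` of the circuit `o` starts when `o` is traversed
clockwise. -/
noncomputable def tailV (Γ : M.GraphFramework) (o : Set α) (e : α) : Vert M :=
  fun b => if e ∈ b.1 then -(Γ.c o e * Γ.d b.1 e) else Γ.σ b.1 e

theorem headV_tailV (o : Set α) (e : M.E) :
    (Γ.headV o e = Γ.srcV e ∧ Γ.tailV o e = Γ.tgtV e) ∨
      (Γ.headV o e = Γ.tgtV e ∧ Γ.tailV o e = Γ.srcV e) := by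
  rcases Int.units_eq_one_or (Γ.c o e) with h | h
  · right
    constructor <;> funext b <;> simp [headV, tailV, srcV, tgtV, h]
  · left
    constructor <;> funext b <;> simp [headV, tailV, srcV, tgtV, h]

/-- The four adjacency axioms of a graph framework are the four cases of this single statement,
according to which of `p` and `q` lie in `b`. -/
theorem headV_eq_tailV {o s : Set α} (ho : M.IsCircuit o) (hfin : s.Finite) (hso : s ⊆ o) {p q : α}
    (hpq : ClockwiseAdjacent (Γ.toSigning.cyc Γ.σ o) s p q) {b : {b : Set α // M.IsCocircuit b}}
    (hb : b.1 ∩ o ⊆ s) : Γ.headV o p b = Γ.tailV o q b := by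
  unfold headV tailV
  split_ifs with h1 h2 h2
  · exact Γ.adjacent_mem_mem o b.1 s p q ho b.2 hfin hb hso hpq h1 h2
  · exact Γ.adjacent_mem_not o b.1 s p q ho b.2 hfin hb hso hpq h1 h2
  · rw [Γ.adjacent_not_mem o b.1 s p q ho b.2 hfin hb hso hpq h1 h2, neg_neg]
  · exact Γ.adjacent_not_not o b.1 s p q ho b.2 hfin hb hso hpq h1 h2

/-- The closure in `G(M, Γ)` of the interior points of the edges in `o`. -/
def circ (Γ : M.GraphFramework) (o : Set α) : Set Γ.toGraphLikeSpace.Point :=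
  _root_.closure (Γ.inner o)

theorem saturated_circ (o : Set α) : Saturated (Γ.circ o) :=
  saturated_closure_innerPoints _

theorem edgesOf_circ (o : Set α) : edgesOf (Γ.circ o) = Γ.edgeSet o :=
  edgesOf_closure_innerPoints _

theorem edgePt_mem_circ {o : Set α} {e : M.E} {r : Ioo (0 : ℝ) 1} :
    (edgePt r e : Γ.toGraphLikeSpace.Point) ∈ Γ.circ o ↔ (e : α) ∈ o :=
  edgePt_mem_closure_innerPoints

theorem closedEdge_subset_circ {o : Set α} {e : M.E} (he : (e : α) ∈ o) :
    Γ.toGraphLikeSpace.closedEdge e ⊆ Γ.circ o :=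
  closedEdge_subset isClosed_closure (saturated_circ o) ((edgesOf_circ o).symm ▸ he)

theorem finite_edgeSet {s : Set α} (hs : s.Finite) : (Γ.edgeSet s).Finite :=
  hs.preimage Subtype.val_injective.injOn

/-- Tameness supplies the finite intersections with cocircuits. -/
theorem isCompact_circ {o : Set α} (ho : M.IsCircuit o) : IsCompact (Γ.circ o) := by
  refine isCompact_of_finite_inter isClosed_closure (saturated_circ o) fun b => ?_
  rw [edgesOf_circ]
  exact (finite_edgeSet (Γ.tame o b.1 ho b.2)).subset fun e he => ⟨he.2, he.1⟩

theorem vertex_headV_mem {o : Set α} {e : M.E} :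
    vertex (Γ.headV o e) ∈ Γ.toGraphLikeSpace.closedEdge e := by
  rcases headV_tailV (Γ := Γ) o e with ⟨h, -⟩ | ⟨h, -⟩ <;> rw [h]
  exacts [src_mem_closedEdge (G := Γ.toGraphLikeSpace) e,
    tgt_mem_closedEdge (G := Γ.toGraphLikeSpace) e]

theorem vertex_tailV_mem {o : Set α} {e : M.E} :
    vertex (Γ.tailV o e) ∈ Γ.toGraphLikeSpace.closedEdge e := by
  rcases headV_tailV (Γ := Γ) o e with ⟨-, h⟩ | ⟨-, h⟩ <;> rw [h]
  exacts [tgt_mem_closedEdge (G := Γ.toGraphLikeSpace) e,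
    src_mem_closedEdge (G := Γ.toGraphLikeSpace) e]

/-- The part of a compact set in which a vertex lies is determined by finitely many cocircuits. -/
theorem exists_finset_cocircuits {K A B : Set Γ.toGraphLikeSpace.Point} (hK : IsCompact K)
    (hA : IsClosed A) (hB : IsClosed B) (hAB : Disjoint A B) (hU : K ⊆ A ∪ B) :
    ∃ 𝓑 : Set {b : Set α // M.IsCocircuit b}, 𝓑.Finite ∧ ∀ v w : Vert M, vertex v ∈ K →
      vertex w ∈ K → (∀ b ∈ 𝓑, v b = w b) → vertex v ∈ A → vertex w ∈ A := by
  have hN : ∀ x : Vert M, ∃ (F : Finset {b : Set α // M.IsCocircuit b})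
      (ε : {b : Set α // M.IsCocircuit b} → M.E → Ioo (0 : ℝ) 1),
      (⋂ b ∈ F, Γ.nbhd b (x b) (ε b)) ⊆ Aᶜ ∨ (⋂ b ∈ F, Γ.nbhd b (x b) (ε b)) ⊆ Bᶜ := by
    intro x
    by_cases hx : vertex x ∈ A
    · obtain ⟨F, ε, h⟩ := exists_nbhd_subset hB.isOpen_compl (x := x) (disjoint_left.1 hAB hx)
      exact ⟨F, ε, Or.inr h⟩
    · obtain ⟨F, ε, h⟩ := exists_nbhd_subset hA.isOpen_compl (x := x) hx
      exact ⟨F, ε, Or.inl h⟩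
  choose F ε hF using hN
  -- The vertices of `K` form a compact set, so finitely many of the chosen neighbourhoods cover
  -- them, and these involve only finitely many cocircuits.
  obtain ⟨t, ht⟩ := (hK.diff (isOpen_innerPoints univ)).elim_finite_subcover
    (fun x : Vert M => ⋂ b ∈ F x, Γ.nbhd b (x b) (ε x b))
    (fun x => isOpen_biInter_finset fun b _ => isOpen_nbhd b _ _)
    (by
      rintro (v | ⟨r, e⟩) hp
      · exact mem_iUnion.2 ⟨v, mem_iInter₂.2 fun b _ => rfl⟩
      · exact absurd ((edgePt_mem_innerPoints (F := univ)).2 trivial) hp.2)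
  refine ⟨⋃ x ∈ t, F x, t.finite_toSet.biUnion fun x _ => (F x).finite_toSet, ?_⟩
  intro v w hv hw hvw hvA
  obtain ⟨x, hx, hvx⟩ := mem_iUnion₂.1 (ht ⟨hv, vertex_notMem_innerPoints⟩)
  have hwx : vertex w ∈ ⋂ b ∈ F x, Γ.nbhd b (x b) (ε x b) := by
    refine mem_iInter₂.2 fun b hb => ?_
    exact (hvw b (mem_iUnion₂.2 ⟨x, hx, hb⟩)).symm.trans (mem_iInter₂.1 hvx b hb)
  rcases hF x with h | h
  · exact absurd hvA (h hvx)
  · exact (hU hw).resolve_right (h hwx)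

/-- If `p` and `q` are clockwise adjacent in a finite subset `s` of a circuit `o`, then the head of
`p` and the tail of `q` are not separated by removing `s`. -/
theorem tailV_mem_of_headV_mem {o s : Set α} (ho : M.IsCircuit o) (hfin : s.Finite) (hso : s ⊆ o)
    {p q : α} (hpq : ClockwiseAdjacent (Γ.toSigning.cyc Γ.σ o) s p q)
    {A B : Set Γ.toGraphLikeSpace.Point} (hA : IsClosed A) (hB : IsClosed B) (hAB : Disjoint A B)
    (hU : Γ.circ o \ Γ.inner s ⊆ A ∪ B) (hp : vertex (Γ.headV o p) ∈ A) :
    vertex (Γ.tailV o q) ∈ A := by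
  obtain ⟨𝓑, h𝓑, hdet⟩ := exists_finset_cocircuits ((isCompact_circ ho).diff (isOpen_inner s))
    hA hB hAB hU
  have hE := ho.subset_ground
  have hhead : ∀ r ∈ o, vertex (Γ.headV o r) ∈ Γ.circ o \ Γ.inner s := fun r hr =>
    ⟨closedEdge_subset_circ (e := ⟨r, hE hr⟩) hr (vertex_headV_mem (e := ⟨r, hE hr⟩)),
      vertex_notMem_inner⟩
  have htail : ∀ r ∈ o, vertex (Γ.tailV o r) ∈ Γ.circ o \ Γ.inner s := fun r hr =>
    ⟨closedEdge_subset_circ (e := ⟨r, hE hr⟩) hr (vertex_tailV_mem (e := ⟨r, hE hr⟩)),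
      vertex_notMem_inner⟩
  -- Adding to `s` all elements of `o` in the deciding cocircuits makes the head and the tail at
  -- consecutive elements agree on all of `𝓑`, hence lie in the same part.
  have hs'fin : (s ∪ ⋃ b ∈ 𝓑, b.1 ∩ o).Finite :=
    hfin.union (h𝓑.biUnion fun b _ => (Γ.tame o b.1 ho b.2).subset fun e he => ⟨he.2, he.1⟩)
  have hs'o : s ∪ ⋃ b ∈ 𝓑, b.1 ∩ o ⊆ o :=
    union_subset hso (iUnion₂_subset fun b _ => inter_subset_right)
  refine (Γ.isCyclicOrder o ho).clockwise_induction
    (C := fun r => vertex (Γ.tailV o r) ∈ A) (D := fun r => vertex (Γ.headV o r) ∈ A)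
    (subset_union_left (t := ⋃ b ∈ 𝓑, b.1 ∩ o)) hs'fin hs'o hpq hp ?_ ?_
  · intro r r' hrr' hr
    refine hdet _ _ (hhead r (hs'o hrr'.1)) (htail r' (hs'o hrr'.2.1)) (fun b hb => ?_) hr
    exact headV_eq_tailV ho hs'fin hs'o hrr'
      (subset_union_of_subset_right (subset_biUnion_of_mem (u := fun b => b.1 ∩ o) hb) _)
  · intro r hr hrs hrA
    -- An added edge outside `s` has not been removed; it is a connected subset of `A ∪ B` and so
    -- leads from its tail to its head within `A`.
    have hsub : Γ.toGraphLikeSpace.closedEdge ⟨r, hE (hs'o hr)⟩ ⊆ A ∪ B := by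
      refine Subset.trans (fun x hx => ?_) hU
      refine ⟨closedEdge_subset_circ (e := ⟨r, hE (hs'o hr)⟩) (hs'o hr) hx, ?_⟩
      rintro ⟨t, e, he, rfl⟩
      have : e = (⟨r, hE (hs'o hr)⟩ : M.E) := edgePt_mem_closedEdge.1 hx
      subst this
      exact hrs he
    exact (isPreconnected_closedEdge _).subset_left_of_closed hA hB hAB hsub
      (vertex_tailV_mem (e := ⟨r, hE (hs'o hr)⟩)) hrA (vertex_headV_mem (e := ⟨r, hE (hs'o hr)⟩))

end Matroid.GraphFramework

/-! ### Closures of circuits are pseudo-circles -/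

namespace Matroid.GraphFramework

open GraphLikePoint GraphLikeSpace

variable {α : Type u} {M : Matroid α} {Γ : M.GraphFramework}

theorem inner_singleton (e : M.E) : Γ.inner {(e : α)} = Γ.toGraphLikeSpace.innerPoints {e} := by
  unfold inner
  congr 1
  ext f
  exact Subtype.ext_iff.symm

theorem clockwiseAdjacent_pair {R : α → α → α → Prop} {e f : α} (hef : e ≠ f) :
    ClockwiseAdjacent R {e, f} e f := by
  refine ⟨Or.inl rfl, Or.inr rfl, hef, ?_⟩
  rintro g (rfl | hg) h1 h2
  exacts [absurd rfl h1, absurd hg h2]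

theorem headV_ne_tailV {o : Set α} {e : α} {b : {b : Set α // M.IsCocircuit b}} (he : e ∈ b.1) :
    Γ.headV o e b ≠ Γ.tailV o e b := by
  simp only [headV, tailV, he, if_true]
  exact units_ne_neg _

theorem srcV_ne_tgtV {e : M.E} {b : {b : Set α // M.IsCocircuit b}} (he : (e : α) ∈ b.1) :
    Γ.srcV e b ≠ Γ.tgtV e b := by
  simp only [srcV, tgtV, he, if_true]
  exact (units_ne_neg _).symm

theorem srcV_eq_tgtV {e : M.E} {b : {b : Set α // M.IsCocircuit b}} (he : (e : α) ∉ b.1) :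
    Γ.srcV e b = Γ.tgtV e b := by
  simp only [srcV, tgtV, he, if_false]

theorem disjoint_circ_sdiff {o s b : Set α} (h : b ∩ o ⊆ s) :
    Disjoint (Γ.circ o \ Γ.inner s) (Γ.inner b) := by
  rw [disjoint_right]
  rintro _ ⟨r, e, he, rfl⟩ ⟨h1, h2⟩
  exact h2 (edgePt_mem_inner.2 (h ⟨he, edgePt_mem_circ.1 h1⟩))

/-- The orthogonality sum over `c ∩ o` has just the terms of `p` and `q`. As both are `±1` and the
sum is zero, they are opposite. -/
theorem headV_ne_headV {o c : Set α} (ho : M.IsCircuit o) (hc : M.IsCocircuit c) {p q : α}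
    (hpq : p ≠ q) (hco : c ∩ o = {p, q}) : Γ.headV o p ⟨c, hc⟩ ≠ Γ.headV o q ⟨c, hc⟩ := by
  classical
  have hsum := Γ.sum_eq_zero o c ho hc
  have hset : (Γ.tame o c ho hc).toFinset = {p, q} := by
    ext x
    rw [Finite.mem_toFinset, inter_comm, hco]
    simp
  rw [hset, Finset.sum_pair hpq] at hsum
  have hp : p ∈ c := (hco.superset (Or.inl rfl)).1
  have hq : q ∈ c := (hco.superset (Or.inr rfl)).1
  simp only [headV, hp, hq, if_true]
  intro heq
  have heq' : (Γ.c o p : ℤ) * Γ.d c p = (Γ.c o q : ℤ) * Γ.d c q := by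
    exact_mod_cast congrArg Units.val heq
  rw [heq'] at hsum
  rcases Int.units_eq_one_or (Γ.c o q) with h | h <;>
    rcases Int.units_eq_one_or (Γ.d c q) with h' | h' <;> rw [h, h'] at hsum <;> norm_num at hsum

section T2

variable [T2Space Γ.toGraphLikeSpace.Point]

/-- From the head of `e` one reaches the tail of any other edge `f` of `o`, crosses `f`, and goes on
to the tail of `e`: any two elements are adjacent in the two-element set they form. So the part
containing the head of `e` contains everything. -/
theorem isPreconnected_circ_sdiff {o : Set α} (ho : M.IsCircuit o) {e : M.E} (he : (e : α) ∈ o) :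
    IsPreconnected (Γ.circ o \ Γ.inner {(e : α)}) := by
  have hE := ho.subset_ground
  have hKc := ((isCompact_circ (Γ := Γ) ho).diff (isOpen_inner {(e : α)})).isClosed
  rw [isPreconnected_iff_subset_of_fully_disjoint_closed hKc]
  have main : ∀ A B : Set Γ.toGraphLikeSpace.Point, IsClosed A → IsClosed B →
      Γ.circ o \ Γ.inner {(e : α)} ⊆ A ∪ B → Disjoint A B → vertex (Γ.headV o e) ∈ A →
      Γ.circ o \ Γ.inner {(e : α)} ⊆ A := by
    intro A B hA hB hU hAB hhead
    have hf : ∀ f : M.E, (f : α) ∈ o → f ≠ e → Γ.toGraphLikeSpace.closedEdge f ⊆ A ∧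
        vertex (Γ.tailV o e) ∈ A := by
      intro f hfo hfe
      have hne : (e : α) ≠ f := fun h => hfe (Subtype.ext h.symm)
      have hso : ({(e : α), (f : α)} : Set α) ⊆ o :=
        insert_subset_iff.2 ⟨he, singleton_subset_iff.2 hfo⟩
      have hU' : Γ.circ o \ Γ.inner {(e : α), (f : α)} ⊆ A ∪ B := by
        refine Subset.trans (fun p hp => ?_) hU
        refine ⟨hp.1, ?_⟩
        rintro ⟨r, g, hg, rfl⟩
        exact hp.2 (edgePt_mem_inner.2 (Or.inl hg))
      have h1 := tailV_mem_of_headV_mem ho (toFinite _) hso (clockwiseAdjacent_pair hne)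
        hA hB hAB hU' hhead
      have hsub : Γ.toGraphLikeSpace.closedEdge f ⊆ A ∪ B := by
        refine Subset.trans (fun p hp => ?_) hU
        refine ⟨closedEdge_subset_circ hfo hp, ?_⟩
        rintro ⟨r, g, hg, rfl⟩
        have hgf : g = f := edgePt_mem_closedEdge.1 hp
        subst hgf
        exact hne (mem_singleton_iff.1 hg).symm
      have h2 := (isPreconnected_closedEdge f).subset_left_of_closed hA hB hAB hsub
        (vertex_tailV_mem (o := o)) h1
      refine ⟨h2, ?_⟩
      refine tailV_mem_of_headV_mem ho (toFinite {(f : α), (e : α)}) (by rwa [pair_comm])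
        (clockwiseAdjacent_pair hne.symm) hA hB hAB (by rwa [pair_comm])
        (h2 (vertex_headV_mem (o := o)))
    have htail : vertex (Γ.tailV o e) ∈ A := by
      by_cases h : ∃ f ∈ o, f ≠ e
      · obtain ⟨f, hfo, hfe⟩ := h
        exact (hf ⟨f, hE hfo⟩ hfo (fun h => hfe (congrArg Subtype.val h))).2
      · push Not at h
        -- If `o` consists of `e` alone, no cocircuit contains `e`, so its head and tail have the
        -- same signs.
        have : Γ.tailV o e = Γ.headV o e := by
          funext b
          have heb : (e : α) ∉ b.1 := by
            intro heb
            refine ho.inter_isCocircuit_ne_singleton b.2 (e := (e : α)) (Subset.antisymm ?_ ?_)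
            · exact fun f hf => h f hf.1
            · rintro f rfl
              exact ⟨he, heb⟩
          simp only [headV, tailV, heb, if_false]
        rwa [this]
    have hends : vertex (Γ.srcV e) ∈ A ∧ vertex (Γ.tgtV e) ∈ A := by
      rcases headV_tailV (Γ := Γ) o e with ⟨h1, h2⟩ | ⟨h1, h2⟩ <;> rw [h1] at hhead <;>
        rw [h2] at htail
      exacts [⟨hhead, htail⟩, ⟨htail, hhead⟩]
    have hcl : Γ.circ o ⊆ A ∪ Γ.toGraphLikeSpace.closedEdge e := by
      refine closure_minimal ?_ (hA.union (isClosed_closedEdge (G := Γ.toGraphLikeSpace) e))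
      rintro _ ⟨r, f, hfo, rfl⟩
      by_cases hfe : f = e
      · exact Or.inr (edgePt_mem_closedEdge.2 hfe)
      · exact Or.inl ((hf f hfo hfe).1 (edgePt_mem_closedEdge.2 rfl))
    rintro p ⟨hp, hpe⟩
    rcases hcl hp with h | h
    · exact h
    · rcases mem_closedEdge.1 h with rfl | rfl | ⟨r, rfl⟩
      · exact hends.1
      · exact hends.2
      · exact absurd ((edgePt_mem_inner (s := {(e : α)})).2 rfl) hpe
  intro A B hA hB hU hAB
  have hhead : vertex (Γ.headV o e) ∈ Γ.circ o \ Γ.inner {(e : α)} :=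
    ⟨closedEdge_subset_circ he vertex_headV_mem, vertex_notMem_inner⟩
  rcases hU hhead with h | h
  · exact Or.inl (main A B hA hB hU hAB h)
  · exact Or.inr (main B A hB hA (by rwa [union_comm]) hAB.symm h)

theorem isContinuum_circ_sdiff {o : Set α} (ho : M.IsCircuit o) {e : M.E} (he : (e : α) ∈ o) :
    IsContinuum (Γ.circ o \ Γ.inner {(e : α)}) :=
  ⟨(isCompact_circ ho).diff (isOpen_inner _), isPreconnected_circ_sdiff ho he,
    (saturated_circ o).sdiff_innerPoints _⟩

theorem isContinuum_circ {o : Set α} (ho : M.IsCircuit o) : IsContinuum (Γ.circ o) := by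
  refine ⟨isCompact_circ ho, ?_, saturated_circ o⟩
  obtain ⟨e, he⟩ := ho.nonempty
  set e' : M.E := ⟨e, ho.subset_ground he⟩ with he'
  have h1 : vertex (Γ.headV o e) ∈ Γ.circ o \ Γ.inner {(e' : α)} :=
    ⟨closedEdge_subset_circ (e := e') he (vertex_headV_mem (e := e')), vertex_notMem_inner⟩
  have h2 : Γ.circ o = Γ.circ o \ Γ.inner {(e' : α)} ∪ Γ.toGraphLikeSpace.closedEdge e' := by
    refine Subset.antisymm (fun p hp => ?_) (union_subset sdiff_subset
      (closedEdge_subset_circ (e := e') he))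
    by_cases hpe : p ∈ Γ.inner {(e' : α)}
    · obtain ⟨r, f, hf, rfl⟩ := hpe
      exact Or.inr (edgePt_mem_closedEdge.2 (Subtype.ext hf))
    · exact Or.inl ⟨hp, hpe⟩
  rw [h2]
  exact (isPreconnected_circ_sdiff ho he).union _ h1 (vertex_headV_mem (e := e'))
    (isPreconnected_closedEdge (G := Γ.toGraphLikeSpace) e')

/-- The component of a vertex of a circuit `o` after removing a cocircuit `b` contains the head of
some edge of `b`. -/
theorem exists_headV_mem_component {o : Set α} (ho : M.IsCircuit o)
    {b : {b : Set α // M.IsCocircuit b}} (hne : (b.1 ∩ o).Nonempty) {v : Vert M}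
    (hv : vertex v ∈ Γ.circ o) :
    ∃ p ∈ b.1 ∩ o, vertex (Γ.headV o p) ∈
      connectedComponentIn (Γ.circ o \ Γ.inner b.1) (vertex v) := by
  have hcont := isContinuum_circ (Γ := Γ) ho
  have hE := ho.subset_ground
  have hnon : (Γ.edgeSet b.1 ∩ edgesOf (Γ.circ o)).Nonempty := by
    obtain ⟨e, heb, heo⟩ := hne
    rw [edgesOf_circ]
    exact ⟨⟨e, hE heo⟩, heb, heo⟩
  obtain ⟨e, ⟨heb, heo⟩, hend⟩ := hcont.exists_end_mem_component (finite_inter_cocircuit hcont b)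
    hnon hv
  rw [edgesOf_circ] at heo
  have hend' : vertex (Γ.headV o (e : M.E).1) ∈
      connectedComponentIn (Γ.circ o \ Γ.inner b.1) (vertex v) ∨
      vertex (Γ.tailV o (e : M.E).1) ∈
      connectedComponentIn (Γ.circ o \ Γ.inner b.1) (vertex v) := by
    rcases headV_tailV (Γ := Γ) o e with ⟨h1, h2⟩ | ⟨h1, h2⟩ <;> rw [h1, h2]
    exacts [hend, hend.symm]
  rcases hend' with hh | ht
  · exact ⟨_, ⟨heb, heo⟩, hh⟩
  have hfin : (b.1 ∩ o).Finite := (Γ.tame o b.1 ho b.2).subset fun e he => ⟨he.2, he.1⟩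
  have hother : ∃ p ∈ b.1 ∩ o, p ≠ (e : M.E).1 := by
    by_contra hcon
    push Not at hcon
    refine ho.inter_isCocircuit_ne_singleton b.2 (e := (e : M.E).1) (Subset.antisymm ?_ ?_)
    · exact fun f hf => hcon f ⟨hf.2, hf.1⟩
    · rintro f rfl
      exact ⟨heo, heb⟩
  -- Boundary bumping has found only the tail of `e`. The head of the clockwise predecessor of `e`
  -- in `b ∩ o` cannot be separated from it.
  obtain ⟨p, hadj⟩ := (Γ.isCyclicOrder o ho).exists_pred hfin inter_subset_right
    (show (e : M.E).1 ∈ b.1 ∩ o from ⟨heb, heo⟩) hother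
  refine ⟨p, hadj.1, ?_⟩
  by_contra hcon
  obtain ⟨A, B, hA, hB, hAB, hU, hvA, hT⟩ := exists_closed_partition_of_notMem_connectedComponentIn
    ((isCompact_circ (Γ := Γ) ho).diff (isOpen_inner b.1)) (x := vertex v)
    ⟨hv, vertex_notMem_inner⟩ (finite_singleton (vertex (Γ.headV o p)))
    (by rintro y rfl; exact hcon)
  have hpU : vertex (Γ.headV o p) ∈ A ∪ B := hU.superset
    ⟨closedEdge_subset_circ (e := ⟨p, hE hadj.1.2⟩) hadj.1.2
      (vertex_headV_mem (e := ⟨p, hE hadj.1.2⟩)), vertex_notMem_inner⟩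
  have hpB := hpU.resolve_left (hT _ rfl)
  have heB := tailV_mem_of_headV_mem ho hfin inter_subset_right hadj hB hA hAB.symm (by
    rw [union_comm, hU]
    rintro q ⟨hq, hq'⟩
    refine ⟨hq, ?_⟩
    rintro ⟨r, f, hf, rfl⟩
    exact hq' (edgePt_mem_inner.2 ⟨hf, edgePt_mem_circ.1 hq⟩)) hpB
  have hvR : vertex v ∈ Γ.circ o \ Γ.inner b.1 := ⟨hv, vertex_notMem_inner⟩
  have hsub : connectedComponentIn (Γ.circ o \ Γ.inner b.1) (vertex v) ⊆ A ∪ B := by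
    rw [hU]
    exact connectedComponentIn_subset _ _
  have hcA := isPreconnected_connectedComponentIn.subset_left_of_closed hA hB hAB hsub
    (mem_connectedComponentIn hvR) hvA
  exact disjoint_left.1 hAB (hcA ht) heB

/-- The standard subspace of a circuit is a pseudo-circle. -/
theorem isPseudoCircle_subspace {o : Set α} (ho : M.IsCircuit o)
    (h0 : ∀ e ∈ Γ.edgeSet o, Γ.toGraphLikeSpace.src e ∈
      Γ.toGraphLikeSpace.closureVertices (Γ.edgeSet o))
    (h1 : ∀ e ∈ Γ.edgeSet o, Γ.toGraphLikeSpace.tgt e ∈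
      Γ.toGraphLikeSpace.closureVertices (Γ.edgeSet o)) :
    (Γ.toGraphLikeSpace.subspace (Γ.toGraphLikeSpace.closureVertices (Γ.edgeSet o))
      (Γ.edgeSet o) h0 h1).IsPseudoCircle := by
  set C := Γ.toGraphLikeSpace.subspace (Γ.toGraphLikeSpace.closureVertices (Γ.edgeSet o))
    (Γ.edgeSet o) h0 h1 with hC
  set j : C.Point → Γ.toGraphLikeSpace.Point := Γ.toGraphLikeSpace.subIncl _ _ h0 h1 with hj
  have hind : Topology.IsInducing j := isInducing_subIncl h0 h1
  have hran : range j = Γ.circ o := by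
    ext p
    constructor
    · rintro ⟨v | ⟨r, e⟩, rfl⟩
      · exact v.2
      · exact edgePt_mem_circ.2 e.2
    · intro hp
      rcases p with v | ⟨r, e⟩
      · exact ⟨vertex ⟨v, hp⟩, rfl⟩
      · exact ⟨edgePt r ⟨e, edgePt_mem_circ.1 hp⟩, rfl⟩
  have himage : ∀ s : Set C.E, j '' C.removeEdges s =
      Γ.circ o \ Γ.toGraphLikeSpace.innerPoints (Subtype.val '' s) := by
    intro s
    ext p
    constructor
    · rintro ⟨q, hq, rfl⟩
      refine ⟨hran.subset ⟨q, rfl⟩, ?_⟩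
      rintro ⟨r, f, ⟨f', hf', rfl⟩, hfq⟩
      rcases q with w | ⟨t, g⟩
      · cases hfq
      · obtain ⟨-, hg⟩ := GraphLikePoint.edgePt.inj hfq
        have : g = f' := Subtype.ext hg
        subst this
        exact hq (edgePt_mem_innerPoints.2 hf')
    · rintro ⟨hp, hps⟩
      obtain ⟨q, rfl⟩ := hran.superset hp
      refine ⟨q, ?_, rfl⟩
      rintro ⟨r, f, hf, rfl⟩
      exact hps ⟨r, f.1, ⟨f, hf, rfl⟩, rfl⟩
  have hpair : ∀ e f : C.E, Γ.toGraphLikeSpace.innerPoints (Subtype.val '' ({e, f} : Set C.E)) =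
      Γ.inner {(e.1 : M.E).1, (f.1 : M.E).1} := by
    intro e f
    have himg : (Subtype.val '' ({e, f} : Set C.E) : Set Γ.toGraphLikeSpace.E) = {e.1, f.1} :=
      image_pair _ _ _
    rw [himg]
    unfold inner
    congr 1
    ext g
    exact or_congr Subtype.ext_iff Subtype.ext_iff
  refine ⟨?_, ?_, ?_, ?_, ?_, ?_⟩
  · rw [← isCompact_univ_iff, hind.isCompact_iff, image_univ, hran]
    exact isCompact_circ ho
  · have : PreconnectedSpace C.Point := by
      refine ⟨?_⟩
      rw [← hind.isPreconnected_image, image_univ, hran]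
      exact (isContinuum_circ ho).isPreconnected
    obtain ⟨e, he⟩ := ho.nonempty
    exact { toNonempty := ⟨edgePt ⟨1 / 2, by norm_num, by norm_num⟩
      ⟨⟨e, ho.subset_ground he⟩, he⟩⟩ }
  · obtain ⟨e, he⟩ := ho.nonempty
    exact ⟨⟨⟨e, ho.subset_ground he⟩, he⟩⟩
  · intro e
    refine ⟨⟨vertex (C.src e), vertex_notMem_innerPoints⟩, ?_⟩
    have himg : (Subtype.val '' ({e} : Set C.E) : Set Γ.toGraphLikeSpace.E) = {e.1} :=
      image_singleton
    rw [← hind.isPreconnected_image, himage, himg]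
    have h := isPreconnected_circ_sdiff (Γ := Γ) ho (e := e.1) e.2
    rwa [show Γ.inner {(e.1 : M.E).1} = Γ.toGraphLikeSpace.innerPoints {e.1} from
      inner_singleton _] at h
  · intro e f hef hcon
    have hpre := hind.isPreconnected_image.2 hcon.isPreconnected
    rw [himage, hpair] at hpre
    have hne : (e.1 : M.E).1 ≠ (f.1 : M.E).1 := fun h =>
      hef (Subtype.ext (Subtype.ext h))
    -- With both edges of this cocircuit gone, a connected remainder would lie on one side of it,
    -- yet it contains both ends of `e`.
    obtain ⟨b, hb, hbo⟩ := ho.exists_isCocircuit_inter_eq_pair e.2 f.2 hne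
    have heb : (e.1 : M.E).1 ∈ b := (hbo.superset (Or.inl rfl)).1
    have hsub := subset_side (b := ⟨b, hb⟩) hpre (disjoint_circ_sdiff hbo.subset)
      (v := Γ.headV o (e.1 : M.E).1)
      ⟨closedEdge_subset_circ e.2 vertex_headV_mem, vertex_notMem_inner⟩
    have ht := hsub (show vertex (Γ.tailV o (e.1 : M.E).1) ∈ _ from
      ⟨closedEdge_subset_circ e.2 vertex_tailV_mem, vertex_notMem_inner⟩)
    exact headV_ne_tailV (b := ⟨b, hb⟩) heb (vertex_mem_side.1 ht).symm
  · intro v w hvw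
    obtain ⟨b, hb⟩ : ∃ b, (v.1 : Vert M) b ≠ (w.1 : Vert M) b :=
      Function.ne_iff.1 fun h => hvw (Subtype.ext h)
    have hvc : vertex v.1 ∈ Γ.circ o := v.2
    have hwc : vertex w.1 ∈ Γ.circ o := w.2
    -- A cocircuit that misses `o` has the entire circuit on one side.
    have hne : (b.1 ∩ o).Nonempty := by
      by_contra hemp
      rw [not_nonempty_iff_eq_empty] at hemp
      refine hb (Linked.apply_eq (b := b) (H := Γ.circ o) ⟨Γ.circ o, Subset.rfl,
        isContinuum_circ ho, hvc, hwc⟩ ?_)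
      rw [disjoint_right]
      rintro _ ⟨r, e, he, rfl⟩ h
      exact (hemp.subset ⟨he, edgePt_mem_circ.1 h⟩ : _ ∈ (∅ : Set α))
    have hQ := fun z => isContinuum_connectedComponentIn
      ((isCompact_circ (Γ := Γ) ho).diff (isOpen_inner b.1))
      ((saturated_circ o).sdiff_innerPoints _) z
    obtain ⟨p, hp, hpv⟩ := exists_headV_mem_component ho hne hvc
    obtain ⟨q, hq, hqw⟩ := exists_headV_mem_component ho hne hwc
    have hlinkv : Linked (Γ.circ o \ Γ.inner b.1) (v.1 : Vert M) (Γ.headV o p) :=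
      ⟨_, connectedComponentIn_subset _ _, hQ _,
        mem_connectedComponentIn ⟨hvc, vertex_notMem_inner⟩, hpv⟩
    have hlinkw : Linked (Γ.circ o \ Γ.inner b.1) (w.1 : Vert M) (Γ.headV o q) :=
      ⟨_, connectedComponentIn_subset _ _, hQ _,
        mem_connectedComponentIn ⟨hwc, vertex_notMem_inner⟩, hqw⟩
    have hvb := Linked.apply_eq hlinkv disjoint_sdiff_left
    have hwb := Linked.apply_eq hlinkw disjoint_sdiff_left
    have hpq : p ≠ q := by
      rintro rfl
      exact hb (hvb.trans hwb.symm)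
    -- The vertices `v` and `w` are linked to the heads of `p` and `q` without using `b`, hence
    -- without using `c`, which meets `o` only in elements of `b`. By `headV_ne_headV` they differ
    -- at `c`, so deleting just `p` and `q` separates them.
    obtain ⟨c, hc, hco⟩ := ho.exists_isCocircuit_inter_eq_pair hp.2 hq.2 hpq
    have hdis : Disjoint (Γ.circ o \ Γ.inner b.1) (Γ.inner c) := by
      refine disjoint_circ_sdiff (hco.subset.trans ?_)
      exact insert_subset_iff.2 ⟨hp.1, singleton_subset_iff.2 hq.1⟩
    have hvc' := Linked.apply_eq (b := ⟨c, hc⟩) hlinkv hdis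
    have hwc' := Linked.apply_eq (b := ⟨c, hc⟩) hlinkw hdis
    set e : C.E := ⟨(⟨p, ho.subset_ground hp.2⟩ : M.E), hp.2⟩ with he
    set f : C.E := ⟨(⟨q, ho.subset_ground hq.2⟩ : M.E), hq.2⟩ with hf
    refine ⟨e, f, fun h => hpq (congrArg (fun x : C.E => (x.1 : M.E).1) h), fun hcon => ?_⟩
    have hZ : IsPreconnected (j '' connectedComponentIn (C.removeEdges {e, f}) (vertex v)) :=
      isPreconnected_connectedComponentIn.image _ hind.continuous.continuousOn
    have hZs : j '' connectedComponentIn (C.removeEdges {e, f}) (vertex v) ⊆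
        Γ.circ o \ Γ.inner {p, q} := by
      refine (image_mono (connectedComponentIn_subset _ _)).trans ?_
      rw [himage, hpair]
    have hvZ : vertex (v.1 : Vert M) ∈
        j '' connectedComponentIn (C.removeEdges {e, f}) (vertex v) :=
      ⟨vertex v, mem_connectedComponentIn vertex_notMem_innerPoints, rfl⟩
    have hside := subset_side (b := ⟨c, hc⟩) hZ
      ((disjoint_circ_sdiff hco.subset).mono_left hZs) hvZ
    have hwv : (w.1 : Vert M) ⟨c, hc⟩ = (v.1 : Vert M) ⟨c, hc⟩ := hside ⟨vertex w, hcon, rfl⟩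
    exact headV_ne_headV ho hc hpq hco (hvc'.symm.trans (hwv.symm.trans hwc'))

/-- Paths along circuits thus stay inside the hat space, even at vertices that lie on no edge. -/
theorem mem_hatVertices_of_mem_circ {o : Set α} (ho : M.IsCircuit o) {v : Vert M}
    (hv : vertex v ∈ Γ.circ o) : v ∈ Γ.toGraphLikeSpace.hatVertices := by
  have h0 : ∀ e ∈ Γ.edgeSet o, Γ.toGraphLikeSpace.src e ∈
      Γ.toGraphLikeSpace.closureVertices (Γ.edgeSet o) := fun e he =>
    closedEdge_subset_circ he (src_mem_closedEdge (G := Γ.toGraphLikeSpace) e)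
  have h1 : ∀ e ∈ Γ.edgeSet o, Γ.toGraphLikeSpace.tgt e ∈
      Γ.toGraphLikeSpace.closureVertices (Γ.edgeSet o) := fun e he =>
    closedEdge_subset_circ he (tgt_mem_closedEdge (G := Γ.toGraphLikeSpace) e)
  refine Or.inr ⟨_, subspaceHom _ _ _ h0 h1, isPseudoCircle_subspace ho h0 h1, ?_, ?_⟩
  · rw [subspaceHom_toFun]
    exact inclusion_injective _ _
  · exact ⟨vertex ⟨v, hv⟩, rfl⟩

end T2

end Matroid.GraphFramework

/-! ### Images of pseudo-circles -/

namespace GraphLikeSpace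

open GraphLikePoint

variable {G G' : GraphLikeSpace.{u}}

/-- The edge of the domain mapped onto a given edge by an injective map of graph-like spaces. -/
theorem Hom.exists_edge_of_mem (φ : Hom G G') (hφ : Function.Injective φ.toFun) {e : G'.E}
    (he : e ∈ edgesOf (range φ.toFun)) :
    ∃ f : G.E, ∀ p, φ.toFun p ∈ G'.innerPoints {e} ↔ p ∈ G.innerPoints {f} := by
  have hto : ∀ (f : G.E) (r : Ioo (0 : ℝ) 1), φ.toFun (edgePt r f) ∈ G'.innerPoints {e} →
      ∀ r', φ.toFun (edgePt r' f) ∈ G'.innerPoints {e} := by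
    intro f r h r'
    simp only [Hom.toFun, inducedFun] at h ⊢
    rcases hf : φ.onE f with ⟨g, _ | _⟩ | v <;> simp only [hf] at h ⊢
    · exact edgePt_mem_innerPoints.2 (edgePt_mem_innerPoints.1 h)
    · exact edgePt_mem_innerPoints.2 (edgePt_mem_innerPoints.1 h)
    · exact absurd h vertex_notMem_innerPoints
  have honto : ∀ (f : G.E) (r : Ioo (0 : ℝ) 1), φ.toFun (edgePt r f) ∈ G'.innerPoints {e} →
      ∀ s : Ioo (0 : ℝ) 1, ∃ r', φ.toFun (edgePt r' f) = edgePt s e := by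
    intro f r h s
    simp only [Hom.toFun, inducedFun] at h ⊢
    rcases hf : φ.onE f with ⟨g, _ | _⟩ | v <;> simp only [hf] at h ⊢
    · have hg : g ∈ ({e} : Set G'.E) := edgePt_mem_innerPoints.1 h
      rw [mem_singleton_iff] at hg
      subst hg
      refine ⟨⟨1 - (s : ℝ), sub_pos.2 s.2.2, sub_lt_self 1 s.2.1⟩, ?_⟩
      congr 1
      exact Subtype.ext (sub_sub_cancel _ _)
    · have hg : g ∈ ({e} : Set G'.E) := edgePt_mem_innerPoints.1 h
      rw [mem_singleton_iff] at hg
      subst hg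
      exact ⟨s, rfl⟩
    · exact absurd h vertex_notMem_innerPoints
  obtain ⟨r, p, hp⟩ := he
  rcases p with v | ⟨s, f⟩
  · cases hp
  have hf : φ.toFun (edgePt s f) ∈ G'.innerPoints {e} := by
    rw [hp]
    exact edgePt_mem_innerPoints.2 rfl
  refine ⟨f, ?_⟩
  rintro (w | ⟨t, g⟩)
  · constructor
    · rintro ⟨t, g, hg, h⟩
      cases h
    · exact fun h => absurd h vertex_notMem_innerPoints
  · constructor
    · intro h
      obtain ⟨t', ht'⟩ := honto g t h r
      have := hφ (ht'.trans hp.symm)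
      rw [(GraphLikePoint.edgePt.inj this).2]
      exact edgePt_mem_innerPoints.2 rfl
    · intro h
      have hgf : g ∈ ({f} : Set G.E) := edgePt_mem_innerPoints.1 h
      rw [mem_singleton_iff] at hgf
      subst hgf
      exact hto g s hf t

/-- The properties of the image of a pseudo-circle. -/
theorem IsPseudoCircle.image [T2Space G'.Point] (hG : G.IsPseudoCircle) (φ : Hom G G')
    (hφ : Function.Injective φ.toFun) :
    IsContinuum (range φ.toFun) ∧ (edgesOf (range φ.toFun)).Nonempty ∧
      (∀ e ∈ edgesOf (range φ.toFun), IsPreconnected (range φ.toFun \ G'.innerPoints {e})) ∧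
      ∀ e ∈ edgesOf (range φ.toFun), ∀ f ∈ edgesOf (range φ.toFun), e ≠ f →
        ¬ IsPreconnected (range φ.toFun \ G'.innerPoints {e, f}) := by
  have := hG.compact
  have hcont : Continuous φ.toFun := φ.continuous_inducedFun
  have hind := (hcont.isClosedEmbedding hφ).isInducing
  have hP := φ.isContinuum_range hG.compact hG.connected
  refine ⟨hP, ?_, ?_, ?_⟩
  · obtain ⟨f⟩ := hG.nonempty_edges
    by_contra hcon
    have h : ∀ r, ∃ v, φ.toFun (edgePt r f) = vertex v := by
      intro r
      rcases hr : φ.toFun (edgePt r f) with v | ⟨s, e⟩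
      · exact ⟨v, rfl⟩
      · exact absurd ⟨e, s, _, hr⟩ hcon
    -- An edge without edge points in its image is collapsed to one vertex; any two of its points
    -- then contradict injectivity.
    have h1 : φ.toFun (edgePt ⟨1 / 2, by norm_num, by norm_num⟩ f) =
        φ.toFun (edgePt ⟨1 / 3, by norm_num, by norm_num⟩ f) := by
      obtain ⟨v, hv⟩ := h ⟨1 / 2, by norm_num, by norm_num⟩
      simp only [Hom.toFun, inducedFun] at hv ⊢
      rcases hf : φ.onE f with ⟨g, _ | _⟩ | v <;> simp only [hf] at hv ⊢ <;> cases hv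
    have h2 := (GraphLikePoint.edgePt.inj (hφ h1)).1
    have h3 := congrArg Subtype.val h2
    norm_num at h3
  · intro e he
    obtain ⟨f, hf⟩ := φ.exists_edge_of_mem hφ he
    have himg : φ.toFun '' G.removeEdges {f} = range φ.toFun \ G'.innerPoints {e} := by
      ext p
      constructor
      · rintro ⟨q, hq, rfl⟩
        exact ⟨⟨q, rfl⟩, fun h => hq ((hf q).1 h)⟩
      · rintro ⟨⟨q, rfl⟩, hq⟩
        exact ⟨q, fun h => hq ((hf q).2 h), rfl⟩
    rw [← himg, hind.isPreconnected_image]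
    exact (hG.remove_one f).isPreconnected
  · intro e he e' he' hne hcon
    obtain ⟨f, hf⟩ := φ.exists_edge_of_mem hφ he
    obtain ⟨f', hf'⟩ := φ.exists_edge_of_mem hφ he'
    have hins : ∀ (H : GraphLikeSpace.{u}) (a b : H.E) (p : H.Point),
        p ∈ H.innerPoints {a, b} ↔ p ∈ H.innerPoints {a} ∨ p ∈ H.innerPoints {b} := by
      rintro H a b (v | ⟨r, c⟩)
      · simp
      · simp
    have hff' : f ≠ f' := by
      rintro rfl
      obtain ⟨r, q, hq⟩ := he
      have h1 : φ.toFun q ∈ G'.innerPoints {e'} := (hf' q).2 ((hf q).1 (by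
        rw [hq]
        exact edgePt_mem_innerPoints.2 rfl))
      rw [hq] at h1
      exact hne (edgePt_mem_innerPoints (F := {e'}).1 h1)
    have himg : φ.toFun '' G.removeEdges {f, f'} = range φ.toFun \ G'.innerPoints {e, e'} := by
      ext p
      constructor
      · rintro ⟨q, hq, rfl⟩
        refine ⟨⟨q, rfl⟩, fun h => hq ?_⟩
        exact (hins G f f' q).2 (((hins G' e e' _).1 h).imp (hf q).1 (hf' q).1)
      · rintro ⟨⟨q, rfl⟩, hq⟩
        refine ⟨q, fun h => hq ?_, rfl⟩
        exact (hins G' e e' _).2 (((hins G f f' q).1 h).imp (hf q).2 (hf' q).2)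
    rw [← himg, hind.isPreconnected_image] at hcon
    exact hG.remove_two f f' hff' ⟨⟨vertex (G.src f), vertex_notMem_innerPoints⟩, hcon⟩

end GraphLikeSpace

/-! ### Pseudo-circles lie in closures of circuits -/

namespace Matroid.GraphFramework

open GraphLikePoint GraphLikeSpace

variable {α : Type u} {M : Matroid α} {Γ : M.GraphFramework}

theorem circ_subset {o : Set α} {P : Set Γ.toGraphLikeSpace.Point} (hP : IsClosed P)
    (hs : Saturated P) (ho : Γ.edgeSet o ⊆ edgesOf P) : Γ.circ o ⊆ P := by
  refine closure_minimal ?_ hP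
  rintro _ ⟨r, e, he, rfl⟩
  exact hs.mem (ho he) r

section T2

variable [T2Space Γ.toGraphLikeSpace.Point]

/-- The edge set of a pseudo-circle is a circuit. -/
theorem exists_isCircuit_edgesOf_eq {P : Set Γ.toGraphLikeSpace.Point} (hP : IsContinuum P)
    (hne : (edgesOf P).Nonempty)
    (h1 : ∀ e ∈ edgesOf P, IsPreconnected (P \ Γ.toGraphLikeSpace.innerPoints {e}))
    (h2 : ∀ e ∈ edgesOf P, ∀ f ∈ edgesOf P, e ≠ f →
      ¬ IsPreconnected (P \ Γ.toGraphLikeSpace.innerPoints {e, f})) :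
    ∃ o, M.IsCircuit o ∧ edgesOf P = Γ.edgeSet o := by
  obtain ⟨e, he⟩ := hne
  -- The circuit-or-cocircuit alternative is applied to `e` and the remaining edges of `P`.
  set Y : Set α := (Subtype.val '' (show Set M.E from edgesOf P)) \ {(e : M.E).1} with hY
  have hYE : Y ⊆ M.E := by
    rintro _ ⟨⟨f, -, rfl⟩, -⟩
    exact f.2
  rcases exists_isCircuit_or_isCocircuit (e : M.E).2 hYE (fun h => h.2 rfl) with
    ⟨o, ho, heo, hoY⟩ | ⟨c, hc, hec, hcY⟩
  · have hoP : Γ.edgeSet o ⊆ edgesOf P := by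
      intro f hf
      rcases hoY hf with h | ⟨⟨g, hg, hgf⟩, -⟩
      · have : f = e := Subtype.ext h
        exact this ▸ he
      · have : g = f := Subtype.ext hgf
        exact this ▸ hg
    refine ⟨o, ho, Subset.antisymm ?_ hoP⟩
    intro f hf
    by_contra hfo
    have hef : e ≠ f := by
      rintro rfl
      exact hfo heo
    -- The circuit still connects the ends of `e` once `e` is deleted. Hence deleting `e` from the
    -- connected set `P` without `f` does not disconnect it, against the condition on pairs of
    -- edges.
    set R := P \ Γ.toGraphLikeSpace.innerPoints {e, f} with hR
    have hRc : IsClosed R := (hP.isCompact_sdiff _).isClosed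
    have hKR : Γ.circ o \ Γ.inner {(e : M.E).1} ⊆ R := by
      rintro p ⟨hp, hpe⟩
      refine ⟨circ_subset hP.isClosed hP.saturated hoP hp, ?_⟩
      rintro ⟨r, g, hg | hg, rfl⟩
      · subst hg
        exact hpe (edgePt_mem_inner.2 rfl)
      · rw [mem_singleton_iff] at hg
        subst hg
        exact hfo (edgePt_mem_circ.1 hp)
    have hends : ∀ p ∈ Γ.toGraphLikeSpace.closedEdge e, p ∉ Γ.toGraphLikeSpace.innerPoints {e} →
        p ∈ Γ.circ o \ Γ.inner {(e : M.E).1} := by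
      intro p hp hpe
      have h := closedEdge_subset_circ (Γ := Γ) heo hp
      rcases mem_closedEdge.1 hp with rfl | rfl | ⟨r, rfl⟩
      · exact ⟨h, vertex_notMem_inner⟩
      · exact ⟨h, vertex_notMem_inner⟩
      · exact absurd ((edgePt_mem_innerPoints (F := {e})).2 rfl) hpe
    have hK := isPreconnected_circ_sdiff (Γ := Γ) ho (e := e) heo
    have main : ∀ A B : Set Γ.toGraphLikeSpace.Point, IsClosed A → IsClosed B → R ⊆ A ∪ B →
        Disjoint A B → Γ.circ o \ Γ.inner {(e : M.E).1} ⊆ A → R ⊆ A := by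
      intro A B hA hB hU hAB hKA
      have hdis : Disjoint (A ∪ Γ.toGraphLikeSpace.closedEdge e) (R ∩ B) := by
        rw [disjoint_right]
        rintro p ⟨hpR, hpB⟩ (hpA | hpe)
        · exact disjoint_left.1 hAB hpA hpB
        · refine disjoint_left.1 hAB (hKA (hends p hpe fun h => hpR.2 ?_)) hpB
          obtain ⟨r, g, hg, rfl⟩ := h
          exact ⟨r, g, Or.inl hg, rfl⟩
      have hsub : P \ Γ.toGraphLikeSpace.innerPoints {f} ⊆
          (A ∪ Γ.toGraphLikeSpace.closedEdge e) ∪ (R ∩ B) := by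
        rintro p ⟨hp, hpf⟩
        by_cases hpe : p ∈ Γ.toGraphLikeSpace.innerPoints {e}
        · obtain ⟨r, g, hg, rfl⟩ := hpe
          exact Or.inl (Or.inr (edgePt_mem_closedEdge.2 hg))
        · have hpR : p ∈ R := by
            refine ⟨hp, ?_⟩
            rintro ⟨r, g, hg | hg, rfl⟩
            · exact hpe ⟨r, g, hg, rfl⟩
            · exact hpf ⟨r, g, hg, rfl⟩
          rcases hU hpR with h | h
          · exact Or.inl (Or.inl h)
          · exact Or.inr ⟨hpR, h⟩
      have hall := (h1 f hf).subset_left_of_closed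
        (hA.union (isClosed_closedEdge (G := Γ.toGraphLikeSpace) e)) (hRc.inter hB) hdis hsub
        (x := vertex (Γ.toGraphLikeSpace.src e)) ⟨hP.src_mem he, vertex_notMem_innerPoints⟩
        (Or.inr (src_mem_closedEdge e))
      intro p hp
      refine (hU hp).resolve_right fun hpB => ?_
      refine disjoint_left.1 hdis (hall ⟨hp.1, fun h => hp.2 ?_⟩) ⟨hp, hpB⟩
      obtain ⟨r, g, hg, rfl⟩ := h
      exact ⟨r, g, Or.inr hg, rfl⟩
    refine h2 e he f hf hef ((isPreconnected_iff_subset_of_fully_disjoint_closed hRc).2 ?_)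
    intro A B hA hB hU hAB
    have hsrc := hends _ (src_mem_closedEdge e) vertex_notMem_innerPoints
    rcases hU (hKR hsrc) with h | h
    · exact Or.inl (main A B hA hB hU hAB
        (hK.subset_left_of_closed hA hB hAB (hKR.trans hU) hsrc h))
    · rw [union_comm] at hU
      exact Or.inr (main B A hB hA hU hAB.symm
        (hK.subset_left_of_closed hB hA hAB.symm (hKR.trans hU) hsrc h))
  · exfalso
    -- The only edge of `P` in `c` is `e`, so the connected set `P` without `e` lies on one side of
    -- `c`; but the ends of `e` lie on different sides.
    have hdis : Disjoint (P \ Γ.toGraphLikeSpace.innerPoints {e}) (Γ.inner c) := by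
      rw [disjoint_right]
      rintro _ ⟨r, f, hf, rfl⟩ ⟨h3, h4⟩
      refine disjoint_left.1 hcY hf ⟨⟨f, ⟨r, h3⟩, rfl⟩, fun h => h4 ?_⟩
      exact edgePt_mem_innerPoints.2 (Subtype.ext h)
    have hside := subset_side (b := ⟨c, hc⟩) (h1 e he) hdis (v := Γ.srcV e)
      ⟨hP.src_mem he, vertex_notMem_innerPoints⟩
    have ht : vertex (Γ.tgtV e) ∈ Γ.side ⟨c, hc⟩ (Γ.srcV e ⟨c, hc⟩) :=
      hside ⟨hP.tgt_mem he, vertex_notMem_innerPoints⟩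
    exact srcV_ne_tgtV (Γ := Γ) (b := ⟨c, hc⟩) hec (vertex_mem_side.1 ht).symm

/-- If `v` is outside the closed circuit, compactness yields finitely many cocircuits that
distinguish `v` from every vertex of the circuit. The vertices of `P` agreeing with `v` on all of
these could then be split off from the rest of `P`. -/
theorem vertex_mem_circ_of_edgesOf_eq {P : Set Γ.toGraphLikeSpace.Point} (hP : IsContinuum P)
    {o : Set α} (ho : M.IsCircuit o) (hPo : edgesOf P = Γ.edgeSet o) {v : Vert M}
    (hv : vertex v ∈ P) : vertex v ∈ Γ.circ o := by
  by_contra hvo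
  obtain ⟨t, ht⟩ := ((isCompact_circ (Γ := Γ) ho).diff (isOpen_inner o)).elim_finite_subcover
    (fun b => Γ.side b (-(v b))) (fun b => isOpen_side b _) (by
      rintro (w | ⟨r, e⟩) ⟨hp, hpo⟩
      · have hwv : v ≠ w := by
          rintro rfl
          exact hvo hp
        obtain ⟨b, hb⟩ := Function.ne_iff.1 hwv
        exact mem_iUnion.2 ⟨b, units_eq_neg_of_ne hb⟩
      · exact absurd (edgePt_mem_inner.2 (edgePt_mem_circ.1 hp)) hpo)
  have hedge : ∀ (r : Ioo (0 : ℝ) 1) (e : M.E),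
      (edgePt r e : Γ.toGraphLikeSpace.Point) ∈ P → (e : α) ∈ o := by
    intro r e h
    exact hPo.subset (show e ∈ edgesOf P from ⟨r, h⟩)
  set U : Set Γ.toGraphLikeSpace.Point := (⋂ b ∈ t, Γ.side b (v b)) ∩ (Γ.circ o)ᶜ with hU
  set V : Set Γ.toGraphLikeSpace.Point := (⋃ b ∈ t, Γ.side b (-(v b))) ∪ Γ.inner o with hV
  have hUo : IsOpen U := (isOpen_biInter_finset fun b _ => isOpen_side b _).inter
    isClosed_closure.isOpen_compl
  have hVo : IsOpen V := (isOpen_biUnion fun b _ => isOpen_side b _).union (isOpen_inner o)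
  have hcov : P ⊆ U ∪ V := by
    rintro (w | ⟨r, e⟩) hp
    · by_cases hw : ∀ b ∈ t, (w : Vert M) b = v b
      · refine Or.inl ⟨mem_iInter₂.2 hw, fun hwo => ?_⟩
        obtain ⟨b, hb, hwb⟩ := mem_iUnion₂.1 (ht ⟨hwo, vertex_notMem_inner⟩)
        exact units_ne_neg _ ((hw b hb).symm.trans (vertex_mem_side.1 hwb))
      · push Not at hw
        obtain ⟨b, hb, hwb⟩ := hw
        exact Or.inr (Or.inl (mem_iUnion₂.2 ⟨b, hb, units_eq_neg_of_ne (Ne.symm hwb)⟩))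
    · exact Or.inr (Or.inr (edgePt_mem_inner.2 (hedge r e hp)))
  have hdis : P ∩ (U ∩ V) = ∅ := by
    rw [eq_empty_iff_forall_notMem]
    rintro (w | ⟨r, e⟩) ⟨hp, ⟨hpU, hpo⟩, hpV⟩
    · rcases hpV with hpV | hpV
      · obtain ⟨b, hb, hwb⟩ := mem_iUnion₂.1 hpV
        exact disjoint_left.1 (disjoint_side b (v b)) (mem_iInter₂.1 hpU b hb) hwb
      · exact vertex_notMem_inner hpV
    · exact hpo (edgePt_mem_circ.2 (hedge r e hp))
  obtain ⟨e, he⟩ := ho.nonempty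
  set e' : M.E := ⟨e, ho.subset_ground he⟩ with he'
  have hsrcP : vertex (Γ.srcV e') ∈ P := hP.src_mem (hPo.superset he)
  have hsrco : vertex (Γ.srcV e') ∈ Γ.circ o :=
    closedEdge_subset_circ (e := e') he (src_mem_closedEdge (G := Γ.toGraphLikeSpace) e')
  rcases isPreconnected_iff_subset_of_disjoint.1 hP.isPreconnected U V hUo hVo hcov hdis with h | h
  · exact (h hsrcP).2 hsrco
  · have hvU : vertex v ∈ U := ⟨mem_iInter₂.2 fun b _ => rfl, hvo⟩
    exact (hdis.subset ⟨hv, hvU, h hv⟩ : vertex v ∈ (∅ : Set Γ.toGraphLikeSpace.Point))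

/-- A vertex is on a pseudo-circle if and only if it is in the closure of a circuit. -/
theorem exists_isCircuit_of_liesOnPseudoCircle {v : Vert M}
    (hv : Γ.toGraphLikeSpace.LiesOnPseudoCircle v) : ∃ o, M.IsCircuit o ∧ vertex v ∈ Γ.circ o := by
  obtain ⟨C, φ, hC, hφ, hvφ⟩ := hv
  obtain ⟨hP, hne, h1, h2⟩ := hC.image φ hφ
  obtain ⟨o, ho, hPo⟩ := exists_isCircuit_edgesOf_eq hP hne h1 h2
  exact ⟨o, ho, vertex_mem_circ_of_edgesOf_eq hP ho hPo hvφ⟩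

end T2

end Matroid.GraphFramework

namespace Matroid.GraphFramework

open GraphLikePoint GraphLikeSpace

variable {α : Type u} {M : Matroid α} {Γ : M.GraphFramework}

/-! ### Cutting a linked subgraph along a cocircuit -/

/-- `H` is a subgraph of `Ĝ(M, Γ)` containing all vertices of `Ĝ(M, Γ)` in the closure of its
edges. -/
structure IsClosedSubgraph (Γ : M.GraphFramework) (H : Set Γ.toGraphLikeSpace.Point) : Prop where
  saturated : Saturated H
  src_mem : ∀ e ∈ edgesOf H, vertex (Γ.srcV e) ∈ H
  tgt_mem : ∀ e ∈ edgesOf H, vertex (Γ.tgtV e) ∈ H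
  closed : ∀ v ∈ Γ.toGraphLikeSpace.hatVertices,
    vertex v ∈ _root_.closure (Γ.toGraphLikeSpace.innerPoints (edgesOf H)) → vertex v ∈ H

/-- Any two vertices of `H` are linked in `H`. -/
def IsLinked (H : Set Γ.toGraphLikeSpace.Point) : Prop :=
  ∀ u v : Vert M, vertex u ∈ H → vertex v ∈ H → Linked H u v

/-- The part of `H` on the side of the vertex `x` with respect to all cocircuits in `B`. -/
def cut (H : Set Γ.toGraphLikeSpace.Point) (x : Vert M)
    (B : Finset {b : Set α // M.IsCocircuit b}) : Set Γ.toGraphLikeSpace.Point :=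
  H ∩ ⋂ b ∈ B, Γ.side b (x b) \ Γ.inner b.1

theorem vertex_mem_cut {H : Set Γ.toGraphLikeSpace.Point} {x v : Vert M}
    {B : Finset {b : Set α // M.IsCocircuit b}} :
    vertex v ∈ cut H x B ↔ vertex v ∈ H ∧ ∀ b ∈ B, v b = x b := by
  constructor
  · exact fun h => ⟨h.1, fun b hb => (mem_iInter₂.1 h.2 b hb).1⟩
  · exact fun h => ⟨h.1, mem_iInter₂.2 fun b hb => ⟨h.2 b hb, vertex_notMem_inner⟩⟩

theorem edgePt_mem_cut {H : Set Γ.toGraphLikeSpace.Point} {x : Vert M}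
    {B : Finset {b : Set α // M.IsCocircuit b}} {r : Ioo (0 : ℝ) 1} {e : M.E} :
    edgePt r e ∈ cut H x B ↔
      edgePt r e ∈ H ∧ ∀ b ∈ B, (e : α) ∉ b.1 ∧ Γ.σ b.1 e = x b := by
  constructor
  · refine fun h => ⟨h.1, fun b hb => ?_⟩
    have h' := mem_iInter₂.1 h.2 b hb
    have he : (e : α) ∉ b.1 := fun he => h'.2 (edgePt_mem_inner.2 he)
    exact ⟨he, (edgePt_mem_side_of_notMem he).1 h'.1⟩
  · exact fun h => ⟨h.1, mem_iInter₂.2 fun b hb =>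
      ⟨(edgePt_mem_side_of_notMem (h.2 b hb).1).2 (h.2 b hb).2,
        fun he => (h.2 b hb).1 (edgePt_mem_inner.1 he)⟩⟩

theorem srcV_apply_of_notMem {e : M.E} {b : {b : Set α // M.IsCocircuit b}} (he : (e : α) ∉ b.1) :
    Γ.srcV e b = Γ.σ b.1 e := by
  simp only [srcV, he, if_false]

theorem tgtV_apply_of_notMem {e : M.E} {b : {b : Set α // M.IsCocircuit b}} (he : (e : α) ∉ b.1) :
    Γ.tgtV e b = Γ.σ b.1 e := by
  simp only [tgtV, he, if_false]

/-- Closedness is inherited because the sides are open: near a vertex `v`, the edges of the cut have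
the sign of `v` at each cocircuit of `B`. This allows cutting to be iterated. -/
theorem IsClosedSubgraph.cut {H : Set Γ.toGraphLikeSpace.Point} (hH : Γ.IsClosedSubgraph H)
    (x : Vert M) (B : Finset {b : Set α // M.IsCocircuit b}) : Γ.IsClosedSubgraph (cut H x B) where
  saturated e r r' h := by
    have h' := edgePt_mem_cut.1 h
    exact edgePt_mem_cut.2 ⟨hH.saturated e r r' h'.1, h'.2⟩
  src_mem e he := by
    obtain ⟨r, hr⟩ := he
    have h' := edgePt_mem_cut.1 hr
    exact vertex_mem_cut.2 ⟨hH.src_mem e ⟨r, h'.1⟩, fun b hb =>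
      (srcV_apply_of_notMem (h'.2 b hb).1).trans (h'.2 b hb).2⟩
  tgt_mem e he := by
    obtain ⟨r, hr⟩ := he
    have h' := edgePt_mem_cut.1 hr
    exact vertex_mem_cut.2 ⟨hH.tgt_mem e ⟨r, h'.1⟩, fun b hb =>
      (tgtV_apply_of_notMem (h'.2 b hb).1).trans (h'.2 b hb).2⟩
  closed v hv hvc := by
    refine vertex_mem_cut.2 ⟨hH.closed v hv (_root_.closure_mono ?_ hvc), fun b hb => ?_⟩
    · rintro _ ⟨r, e, ⟨s, hs⟩, rfl⟩
      exact ⟨r, e, ⟨s, hs.1⟩, rfl⟩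
    · obtain ⟨p, hp, r, e, ⟨s, hs⟩, rfl⟩ := mem_closure_iff.1 hvc (Γ.side b ((v : Vert M) b))
        (isOpen_side b _) rfl
      have h' := (edgePt_mem_cut.1 hs).2 b hb
      exact ((edgePt_mem_side_of_notMem h'.1).1 hp).symm.trans h'.2

theorem cut_cut [DecidableEq {b : Set α // M.IsCocircuit b}] (H : Set Γ.toGraphLikeSpace.Point)
    (x : Vert M) (B B' : Finset {b : Set α // M.IsCocircuit b}) :
    cut (cut H x B) x B' = cut H x (B ∪ B') := by
  unfold cut
  rw [inter_assoc]
  congr 1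
  ext p
  simp only [mem_inter_iff, mem_iInter, Finset.mem_union]
  exact ⟨fun h b hb => hb.elim (h.1 b) (h.2 b), fun h => ⟨fun b hb => h b (Or.inl hb),
    fun b hb => h b (Or.inr hb)⟩⟩

/-- `z` and `z'` are the two endvertices of the edge `f`. -/
def Ends (Γ : M.GraphFramework) (f : M.E) (z z' : Vert M) : Prop :=
  (z = Γ.srcV f ∧ z' = Γ.tgtV f) ∨ (z = Γ.tgtV f ∧ z' = Γ.srcV f)

theorem Ends.symm {f : M.E} {z z' : Vert M} (h : Γ.Ends f z z') : Γ.Ends f z' z := by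
  rcases h with ⟨h1, h2⟩ | ⟨h1, h2⟩
  exacts [Or.inr ⟨h2, h1⟩, Or.inl ⟨h2, h1⟩]

theorem Ends.apply_ne {f : M.E} {z z' : Vert M} (h : Γ.Ends f z z')
    {b : {b : Set α // M.IsCocircuit b}} (hf : (f : α) ∈ b.1) : z b ≠ z' b := by
  rcases h with ⟨rfl, rfl⟩ | ⟨rfl, rfl⟩
  · exact srcV_ne_tgtV hf
  · exact (srcV_ne_tgtV hf).symm

theorem Ends.apply_eq {f : M.E} {z z' : Vert M} (h : Γ.Ends f z z')
    {b : {b : Set α // M.IsCocircuit b}} (hf : (f : α) ∉ b.1) : z b = z' b := by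
  rcases h with ⟨rfl, rfl⟩ | ⟨rfl, rfl⟩
  · exact srcV_eq_tgtV hf
  · exact (srcV_eq_tgtV hf).symm

theorem Ends.eq_of_apply_eq {f : M.E} {u u' z z' : Vert M} (hu : Γ.Ends f u u')
    (hz : Γ.Ends f z z') {b : {b : Set α // M.IsCocircuit b}} (hf : (f : α) ∈ b.1)
    (huz : u b = z b) : u = z := by
  have h := srcV_ne_tgtV (Γ := Γ) hf
  rcases hu with ⟨rfl, -⟩ | ⟨rfl, -⟩ <;> rcases hz with ⟨rfl, -⟩ | ⟨rfl, -⟩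
  · rfl
  · exact absurd huz h
  · exact absurd huz.symm h
  · rfl

theorem Ends.mem_closedEdge {f : M.E} {z z' : Vert M} (h : Γ.Ends f z z') :
    vertex z ∈ Γ.toGraphLikeSpace.closedEdge f := by
  rcases h with ⟨rfl, -⟩ | ⟨rfl, -⟩
  exacts [src_mem_closedEdge (G := Γ.toGraphLikeSpace) f,
    tgt_mem_closedEdge (G := Γ.toGraphLikeSpace) f]

theorem Linked.on_side {b : {b : Set α // M.IsCocircuit b}} {H : Set Γ.toGraphLikeSpace.Point}
    {v w : Vert M} (h : Linked H v w) (hb : Disjoint H (Γ.inner b.1)) :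
    Linked (H ∩ Γ.side b (v b)) v w := by
  obtain ⟨P, hPH, hP, hv, hw⟩ := h
  exact ⟨P, subset_inter hPH (subset_side hP.isPreconnected (hb.mono_left hPH) hv), hP, hv, hw⟩

section T2

variable [T2Space Γ.toGraphLikeSpace.Point]

/-- The component of a vertex of a continuum after removing a cocircuit links the vertex to an
endvertex of an edge of the cocircuit. -/
theorem exists_linked_end {P : Set Γ.toGraphLikeSpace.Point} (hP : IsContinuum P)
    {b : {b : Set α // M.IsCocircuit b}} {v w : Vert M} (hv : vertex v ∈ P) (hw : vertex w ∈ P)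
    (hne : ¬ Linked (P \ Γ.inner b.1) v w) :
    ∃ (f : M.E) (z z' : Vert M), (f : α) ∈ b.1 ∧ f ∈ edgesOf P ∧
      Linked (P \ Γ.inner b.1) v z ∧
      Γ.Ends f z z' := by
  have hnon : (Γ.edgeSet b.1 ∩ edgesOf P).Nonempty := by
    by_contra hemp
    rw [not_nonempty_iff_eq_empty] at hemp
    refine hne ⟨P, fun p hp => ⟨hp, ?_⟩, hP, hv, hw⟩
    rintro ⟨r, e, he, rfl⟩
    exact (hemp.subset ⟨he, r, hp⟩ : e ∈ (∅ : Set Γ.toGraphLikeSpace.E))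
  obtain ⟨f, ⟨hfb, hfP⟩, hend⟩ := hP.exists_end_mem_component (finite_inter_cocircuit hP b) hnon hv
  have hlink : ∀ z : Vert M, vertex z ∈ connectedComponentIn (P \ Γ.inner b.1) (vertex v) →
      Linked (P \ Γ.inner b.1) v z := fun z hz =>
    ⟨_, connectedComponentIn_subset _ _, isContinuum_connectedComponentIn (hP.isCompact_sdiff _)
      (hP.saturated.sdiff_innerPoints _) _,
      mem_connectedComponentIn ⟨hv, vertex_notMem_inner⟩, hz⟩
  rcases hend with h | h
  · exact ⟨f, Γ.srcV f, Γ.tgtV f, hfb, hfP, hlink _ h, Or.inl ⟨rfl, rfl⟩⟩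
  · exact ⟨f, Γ.tgtV f, Γ.srcV f, hfb, hfP, hlink _ h, Or.inr ⟨rfl, rfl⟩⟩

theorem units_eq_of_ne_of_ne {i j k : ℤˣ} (h : i ≠ k) (h' : j ≠ k) : i = j := by
  revert i j k
  decide

/-- Endvertices of edges of a cocircuit on the same side are linked on that side. -/
theorem linked_of_ends {b : {b : Set α // M.IsCocircuit b}} {f g : M.E} {u u' z z' : Vert M}
    (hf : (f : α) ∈ b.1) (hg : (g : α) ∈ b.1)
    (hu : Γ.Ends f u u') (hz : Γ.Ends g z z') (huz : u b = z b) :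
    Linked (G := Γ.toGraphLikeSpace) (Γ.side b (u b) \ Γ.inner b.1) u z := by
  by_cases hfg : f = g
  · subst hfg
    rw [← hu.eq_of_apply_eq hz hf huz]
    exact Linked.refl ⟨rfl, vertex_notMem_inner⟩
  -- Follow a circuit through `f` and `g` that meets `b` nowhere else. Starting at `u` and without
  -- `f`, the first edge of `b` to be reached is `g`, at its end on the side of `u`.
  obtain ⟨o, ho, hob⟩ := b.2.exists_isCircuit_inter_eq_pair hf hg
    (fun h => hfg (Subtype.ext h))
  have hfo : (f : α) ∈ o := (hob.superset (Or.inl rfl)).1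
  have hgo : (g : α) ∈ o := (hob.superset (Or.inr rfl)).1
  have hmem : ∀ {e : M.E} {y y' : Vert M}, (e : α) ∈ o → Γ.Ends e y y' →
      vertex y ∈ Γ.circ o \ Γ.inner {(f : α)} := fun heo hy =>
    ⟨closedEdge_subset_circ heo hy.mem_closedEdge, vertex_notMem_inner⟩
  have hP := isContinuum_circ_sdiff (Γ := Γ) ho hfo
  have hnl : ¬ Linked ((Γ.circ o \ Γ.inner {(f : α)}) \ Γ.inner b.1) u z' := by
    intro h
    exact hz.apply_ne hg (huz.symm.trans (Linked.apply_eq h disjoint_sdiff_left))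
  obtain ⟨g', y, y', hg'b, ⟨r, hg'⟩, hlink, hy⟩ :=
    exists_linked_end hP (hmem hfo hu) (hmem hgo hz.symm) hnl
  have hg'g : g' = g := by
    have hg'o : (g' : α) ∈ o := edgePt_mem_circ.1 hg'.1
    rcases hob.subset ⟨hg'o, hg'b⟩ with h | h
    · exact absurd ((edgePt_mem_inner (s := {(f : α)})).2 h) hg'.2
    · exact Subtype.ext h
  subst hg'g
  have huy := Linked.apply_eq hlink disjoint_sdiff_left
  rw [← hy.eq_of_apply_eq hz hg (huy.symm.trans huz)]
  exact (Linked.on_side hlink disjoint_sdiff_left).mono fun p hp => ⟨hp.2, hp.1.2⟩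

/-- Cutting a linked subgraph along a cocircuit: the part linked to `x` is described by one further
cocircuit. -/
theorem IsLinked.exists_cut {H : Set Γ.toGraphLikeSpace.Point} (hH : Γ.IsClosedSubgraph H)
    (hlink : IsLinked H) {x : Vert M} (hx : vertex x ∈ H)
    (b : {b : Set α // M.IsCocircuit b}) :
    ∃ c : {b : Set α // M.IsCocircuit b}, ∀ B : Finset {b : Set α // M.IsCocircuit b},
      (∀ b', b' ∈ B ↔ b' = b ∨ b' = c) → IsLinked (cut H x B) := by
  set C : Set (Vert M) := {v | Linked (H \ Γ.inner b.1) x v} with hC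
  have hCb : ∀ {v}, v ∈ C → v b = x b := fun hv =>
    (Linked.apply_eq hv disjoint_sdiff_left).symm
  have hCP : ∀ {v w}, v ∈ C → Linked (H \ Γ.inner b.1) v w → w ∈ C := fun hv hw =>
    Linked.trans hv hw
  have hmemC : ∀ {P : Set Γ.toGraphLikeSpace.Point} {v w : Vert M}, P ⊆ H \ Γ.inner b.1 →
      IsContinuum P → vertex v ∈ P → vertex w ∈ P → v ∈ C → w ∈ C := fun hPH hP hv hw hvC =>
    hCP hvC ⟨_, hPH, hP, hv, hw⟩
  -- If `C` already contains every vertex of `H` on the side of `x`, no second cocircuit is needed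
  -- and `c = b` will do.
  by_cases hcase : ∀ v : Vert M, vertex v ∈ H → v b = x b → v ∈ C
  · refine ⟨b, fun B hB u v hu hv => ?_⟩
    have hbB : b ∈ B := (hB b).2 (Or.inl rfl)
    rw [vertex_mem_cut] at hu hv
    have huC := hcase u hu.1 (hu.2 b hbB)
    have hvC := hcase v hv.1 (hv.2 b hbB)
    have h := Linked.on_side (Linked.trans (Linked.symm huC) hvC) disjoint_sdiff_left
    refine h.mono fun p hp => ⟨hp.1.1, mem_iInter₂.2 fun b' hb' => ?_⟩
    have : b' = b := ((hB b').1 hb').elim id id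
    subst this
    rw [← hCb huC]
    exact ⟨hp.2, hp.1.2⟩
  push Not at hcase
  obtain ⟨y, hyH, hyb, hyC⟩ := hcase
  -- an edge of `b` leaving `C`
  obtain ⟨f, u, w, hfb, hfH, huC, hends⟩ : ∃ (f : M.E) (u w : Vert M), (f : α) ∈ b.1 ∧
      f ∈ edgesOf H ∧ u ∈ C ∧ Γ.Ends f u w := by
    obtain ⟨P, hPH, hP, hxP, hyP⟩ := hlink x y hx hyH
    obtain ⟨f, z, z', hfb, ⟨r, hr⟩, hz, hends⟩ := exists_linked_end hP hxP hyP
      (fun h => hyC (h.mono (sdiff_subset_sdiff_left hPH)))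
    exact ⟨f, z, z', hfb, ⟨r, hPH hr⟩, hz.mono (sdiff_subset_sdiff_left hPH), hends⟩
  have hwb : w b ≠ x b := fun h => hends.apply_ne hfb ((hCb huC).trans h.symm)
  -- These are the edges that `c` must avoid: edges of `H` outside `b` starting in `C`, edges of `H`
  -- with no end in `C`, and edges strictly on the far side of `b`. The edge `f` is none of them.
  set Y : Set M.E := {e | (e ∈ edgesOf H ∧ (e : α) ∉ b.1 ∧ Γ.srcV e ∈ C) ∨
    (e ∈ edgesOf H ∧ Γ.srcV e ∉ C ∧ Γ.tgtV e ∉ C) ∨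
    ((e : α) ∉ b.1 ∧ Γ.σ b.1 e ≠ x b)} with hY
  have hfY : f ∉ Y := by
    rintro (h | h | h)
    · exact h.2.1 hfb
    · rcases hends with ⟨h1, -⟩ | ⟨h1, -⟩
      · exact h.2.1 (h1 ▸ huC)
      · exact h.2.2 (h1 ▸ huC)
    · exact h.1 hfb
  have hYends : ∀ {g : M.E} {z z' : Vert M}, g ∈ Y → (g : α) ∈ b.1 → Γ.Ends g z z' → z ∉ C := by
    rintro g z z' (h | h | h) hgb hg
    · exact absurd hgb h.2.1
    · rcases hg with ⟨rfl, -⟩ | ⟨rfl, -⟩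
      exacts [h.2.1, h.2.2]
    · exact absurd hgb h.1
  have hYE : Subtype.val '' Y ⊆ M.E := by
    rintro _ ⟨e, -, rfl⟩
    exact e.2
  rcases exists_isCircuit_or_isCocircuit f.2 hYE (by
    rintro ⟨e, he, hef⟩
    exact hfY (Subtype.ext hef ▸ he)) with ⟨o, ho, hfo, hoY⟩ | ⟨c, hc, hfc, hcY⟩
  · exfalso
    have hoY' : ∀ e : M.E, (e : α) ∈ o → e = f ∨ e ∈ Y := by
      intro e he
      rcases hoY he with h | ⟨e', he', h⟩
      · exact Or.inl (Subtype.ext h)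
      · exact Or.inr (Subtype.ext h ▸ he')
    have hoH : ∀ e : M.E, ∀ r : Ioo (0 : ℝ) 1, (e : α) ∈ o →
        (edgePt r e : Γ.toGraphLikeSpace.Point) ∈ Γ.side b (x b) → e ∈ edgesOf H := by
      intro e r he hside
      rcases hoY' e he with rfl | h | h | h
      · exact hfH
      · exact h.1
      · exact h.1
      · exact absurd ((edgePt_mem_side_of_notMem h.1).1 hside) h.2
    -- Edges of the circuit outside `H` are on the far side of `b`. The limit vertices on the near
    -- side belong to `H` because they lie in the hat space and `H` is closed.
    have hcH : Γ.circ o ∩ Γ.side b (x b) ⊆ H := by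
      rintro (v | ⟨r, e⟩) ⟨hp, hside⟩
      · refine hH.closed v (mem_hatVertices_of_mem_circ ho hp) ?_
        rw [mem_closure_iff]
        intro N hN hvN
        obtain ⟨p, ⟨hpN, hps⟩, r, e, he, rfl⟩ := mem_closure_iff.1 hp (N ∩ Γ.side b (x b))
          (hN.inter (isOpen_side b _)) ⟨hvN, hside⟩
        exact ⟨_, hpN, r, e, hoH e r he hps, rfl⟩
      · exact hH.saturated.mem (hoH e r (edgePt_mem_circ.1 hp) hside) r
    have hP := isContinuum_circ_sdiff (Γ := Γ) ho hfo
    have hmem : ∀ {z z' : Vert M}, Γ.Ends f z z' → vertex z ∈ Γ.circ o \ Γ.inner {(f : α)} :=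
      fun hz => ⟨closedEdge_subset_circ hfo hz.mem_closedEdge, vertex_notMem_inner⟩
    -- Following the circuit from `u` away from `f`, one stays in `C` until the first edge `g` of
    -- `b`. But `g` is then an edge of `Y` in `b`, and those have no end in `C`.
    obtain ⟨g, z, z', hgb, ⟨r, hg⟩, hz, hgends⟩ := exists_linked_end hP (hmem hends)
      (hmem hends.symm) (fun h => hends.apply_ne hfb (Linked.apply_eq h disjoint_sdiff_left))
    have hzC : z ∈ C := by
      refine hCP huC ((Linked.on_side hz disjoint_sdiff_left).mono ?_)
      rintro p ⟨⟨⟨hpo, -⟩, hpb⟩, hps⟩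
      rw [hCb huC] at hps
      exact ⟨hcH ⟨hpo, hps⟩, hpb⟩
    rcases hoY' g (edgePt_mem_circ.1 hg.1) with rfl | hgY
    · exact hg.2 (edgePt_mem_inner.2 rfl)
    · exact hYends hgY hgb hgends hzC
  · have hcY' : ∀ e : M.E, e ∈ Y → (e : α) ∉ c := fun e he hec =>
      disjoint_left.1 hcY hec ⟨e, he, rfl⟩
    set c' : {b : Set α // M.IsCocircuit b} := ⟨c, hc⟩ with hc'
    have hdisC : ∀ {P : Set Γ.toGraphLikeSpace.Point} {v : Vert M}, P ⊆ H \ Γ.inner b.1 →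
        IsContinuum P → vertex v ∈ P → v ∈ C → Disjoint P (Γ.inner c) := by
      intro P v hPH hP hv hvC
      rw [disjoint_right]
      rintro _ ⟨r, e, he, rfl⟩ hp
      refine hcY' e (Or.inl ⟨⟨r, (hPH hp).1⟩, fun h => (hPH hp).2 (edgePt_mem_inner.2 h), ?_⟩) he
      exact hmemC hPH hP hv (hP.src_mem ⟨r, hp⟩) hvC
    have hCc : ∀ {v}, v ∈ C → v c' = x c' := by
      rintro v ⟨P, hPH, hP, hxP, hvP⟩
      have hxC : x ∈ C := ⟨_, hPH, hP, hxP, hxP⟩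
      exact (subset_side (b := c') hP.isPreconnected (hdisC hPH hP hxP hxC) hxP hvP)
    -- From such a vertex `v`, avoid `C` up to an end `z` of some edge `g` of `b`, cross `g` to
    -- `z'`, and go on along the far side of `b` to the outer end `w` of `f`. No edge of `c` is
    -- used, so `v` and `w` agree at `c`, whereas `f ∈ c` separates `w` from `u ∈ C`.
    have hCc' : ∀ {v : Vert M}, vertex v ∈ H → v ∉ C → v b = x b → v c' ≠ x c' := by
      intro v hvH hvC hvb
      obtain ⟨P, hPH, hP, hvP, hxP⟩ := hlink v x hvH hx
      obtain ⟨g, z, z', hgb, ⟨r, hg⟩, hz, hgends⟩ := exists_linked_end hP hvP hxP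
        (fun h => hvC (Linked.symm (h.mono (sdiff_subset_sdiff_left hPH))))
      have hz' := hz.mono (sdiff_subset_sdiff_left hPH)
      have hzC : z ∉ C := fun h => hvC (hCP h (Linked.symm hz'))
      have hzb : z b = x b := (Linked.apply_eq hz disjoint_sdiff_left).symm.trans hvb
      have hz'b : z' b ≠ x b := fun h => hgends.apply_ne hgb (hzb.trans h.symm)
      have hz'C : z' ∉ C := fun h => hz'b (hCb h)
      have hgY : g ∈ Y := by
        refine Or.inr (Or.inl ⟨⟨r, hPH hg⟩, ?_⟩)
        rcases hgends with ⟨h1, h2⟩ | ⟨h1, h2⟩ <;> rw [← h1, ← h2]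
        exacts [⟨hzC, hz'C⟩, ⟨hz'C, hzC⟩]
      have hvz : v c' = z c' := by
        obtain ⟨Q, hQH, hQ, hvQ, hzQ⟩ := hz'
        refine (subset_side (b := c') hQ.isPreconnected ?_ hvQ hzQ).symm
        rw [disjoint_right]
        rintro _ ⟨s, e, he, rfl⟩ hp
        refine hcY' e (Or.inr (Or.inl ⟨⟨s, (hQH hp).1⟩, fun h => hvC ?_, fun h => hvC ?_⟩)) he
        · exact hmemC hQH hQ (hQ.src_mem ⟨s, hp⟩) hvQ h
        · exact hmemC hQH hQ (hQ.tgt_mem ⟨s, hp⟩) hvQ h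
      have hzz' : z c' = z' c' := hgends.apply_eq (hcY' g hgY)
      have hz'w : z' c' = w c' := by
        have h := linked_of_ends hgb hfb hgends.symm hends.symm (units_eq_of_ne_of_ne hz'b hwb)
        refine Linked.apply_eq h ?_
        rw [disjoint_right]
        rintro _ ⟨s, e, he, rfl⟩ ⟨hps, hpb⟩
        have heb : (e : M.E).1 ∉ b.1 := fun h => hpb (edgePt_mem_inner.2 h)
        refine hcY' e (Or.inr (Or.inr ⟨heb, ?_⟩)) he
        rw [(edgePt_mem_side_of_notMem heb).1 hps]
        exact hz'b
      rw [hvz, hzz', hz'w, ← hCc huC]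
      exact (hends.apply_ne (b := c') hfc).symm
    refine ⟨c', fun B hB v v' hv hv' => ?_⟩
    have hbB : b ∈ B := (hB b).2 (Or.inl rfl)
    have hcB : c' ∈ B := (hB c').2 (Or.inr rfl)
    have hall : ∀ {v : Vert M}, vertex v ∈ cut H x B → v ∈ C := by
      intro v hv
      rw [vertex_mem_cut] at hv
      by_contra hvC
      exact hCc' hv.1 hvC (hv.2 b hbB) (hv.2 c' hcB)
    obtain ⟨P, hPH, hP, hvP, hv'P⟩ := Linked.trans (Linked.symm (hall hv)) (hall hv')
    have hPc := hdisC hPH hP hvP (hall hv)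
    refine ⟨P, fun p hp => ⟨(hPH hp).1, mem_iInter₂.2 fun b' hb' => ?_⟩, hP, hvP, hv'P⟩
    rcases (hB b').1 hb' with rfl | rfl
    · rw [← hCb (hall hv)]
      exact ⟨subset_side hP.isPreconnected (disjoint_sdiff_left.mono_left hPH) hvP hp, (hPH hp).2⟩
    · rw [← hCc (hall hv)]
      exact ⟨subset_side (b := c') hP.isPreconnected hPc hvP hp, disjoint_left.1 hPc hp⟩

/-- Each new cocircuit is applied to the cut obtained so far, which is again a linked closed
subgraph. The companion cocircuit depends on that cut, and nothing has to be rechecked for earlier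
ones. -/
theorem IsLinked.exists_isLinked_cut {H : Set Γ.toGraphLikeSpace.Point}
    (hH : Γ.IsClosedSubgraph H) (hlink : IsLinked H) {x : Vert M} (hx : vertex x ∈ H)
    (B₀ : Finset {b : Set α // M.IsCocircuit b}) :
    ∃ B : Finset {b : Set α // M.IsCocircuit b}, B₀ ⊆ B ∧ IsLinked (cut H x B) := by
  classical
  induction B₀ using Finset.induction_on with
  | empty =>
    refine ⟨∅, Subset.rfl, ?_⟩
    have : cut H x ∅ = H := by simp [GraphFramework.cut]
    rwa [this]
  | insert b B₀ hb ih =>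
    obtain ⟨B, hB, hBl⟩ := ih
    have hxB : vertex x ∈ cut H x B := vertex_mem_cut.2 ⟨hx, fun _ _ => rfl⟩
    obtain ⟨c, hc⟩ := hBl.exists_cut (hH.cut x B) hxB b
    refine ⟨B ∪ {b, c}, ?_, ?_⟩
    · intro b' hb'
      rcases Finset.mem_insert.1 hb' with rfl | h
      · simp
      · exact Finset.mem_union_left _ (hB h)
    · rw [← cut_cut]
      exact hc _ fun b' => by simp

end T2

end Matroid.GraphFramework

namespace GraphLikeSpace

open GraphLikePoint

/-! ### Arcs along an edge -/

/-- The two ends of an edge may coincide, so injectivity is available only after one of them is left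
out; this suffices for an arc towards the other. -/
theorem edge_injOn_compl_zero (G : GraphLikeSpace.{u}) (e : G.E) : InjOn (G.edge e) {0}ᶜ := by
  intro x (hx : x ≠ 0) y (hy : y ≠ 0) hxy
  by_cases hx1 : x = 1 <;> by_cases hy1 : y = 1
  · rw [hx1, hy1]
  all_goals
    simp only [edge, edgeMap, hx, hy, hx1, hy1, one_ne_zero, dite_true, dite_false,
      GraphLikePoint.edgePt.injEq, and_true, reduceCtorEq] at hxy
  exact Subtype.ext (congrArg (fun z : Ioo (0 : ℝ) 1 => (z : ℝ)) hxy)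

theorem edge_injOn_compl_one (G : GraphLikeSpace.{u}) (e : G.E) : InjOn (G.edge e) {1}ᶜ := by
  intro x (hx : x ≠ 1) y (hy : y ≠ 1) hxy
  by_cases hx0 : x = 0 <;> by_cases hy0 : y = 0
  · rw [hx0, hy0]
  all_goals
    simp only [edge, edgeMap, hx, hy, hx0, hy0, dite_true, dite_false,
      GraphLikePoint.edgePt.injEq, and_true, reduceCtorEq] at hxy
  exact Subtype.ext (congrArg (fun z : Ioo (0 : ℝ) 1 => (z : ℝ)) hxy)

theorem exists_arc_tgt (G : GraphLikeSpace.{u}) {S : Set G.Point} (e : G.E) (r : Ioo (0 : ℝ) 1)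
    (h : ∀ s : Ioo (0 : ℝ) 1, r ≤ s → edgePt s e ∈ S) (h1 : vertex (G.tgt e) ∈ S) :
    ∃ γ : unitInterval → G.Point, Continuous γ ∧ Function.Injective γ ∧
      γ 0 = edgePt r e ∧ γ 1 = vertex (G.tgt e) ∧ range γ ⊆ S ∩ range (G.edge e) := by
  have hr0 := r.2.1
  have hr1 := r.2.2
  have hle : ∀ t : unitInterval, (r : ℝ) ≤ r + t * (1 - r) := fun t => by
    have := mul_nonneg t.2.1 (sub_nonneg.2 hr1.le)
    linarith
  have hmem : ∀ t : unitInterval, (r : ℝ) + t * (1 - r) ∈ Icc (0 : ℝ) 1 := fun t => by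
    have := mul_nonneg (sub_nonneg.2 t.2.2) (sub_nonneg.2 hr1.le)
    exact ⟨hr0.le.trans (hle t), by linarith⟩
  refine ⟨fun t => G.edge e ⟨r + t * (1 - r), hmem t⟩,
    (G.continuous_edge e).comp (by fun_prop), ?_, ?_, ?_, ?_⟩
  · intro t t' htt
    have h := G.edge_injOn_compl_zero e
      (fun h0 => (hr0.trans_le (hle t)).ne' (congrArg Subtype.val h0))
      (fun h0 => (hr0.trans_le (hle t')).ne' (congrArg Subtype.val h0)) htt
    have h' := mul_right_cancel₀ (sub_pos.2 hr1).ne' (add_left_cancel (congrArg Subtype.val h))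
    exact Subtype.ext h'
  · rw [← edge_coe]
    simp
  · rw [← edge_one]
    simp
  · rintro _ ⟨t, rfl⟩
    refine ⟨?_, _, rfl⟩
    rcases (hmem t).2.lt_or_eq with hlt | heq
    · have := h ⟨r + t * (1 - r), hr0.trans_le (hle t), hlt⟩ (hle t)
      rwa [← edge_coe] at this
    · rw [← edge_one] at h1
      have : (⟨r + t * (1 - r), hmem t⟩ : unitInterval) = 1 := Subtype.ext heq
      simpa only [this] using h1

theorem exists_arc_src (G : GraphLikeSpace.{u}) {S : Set G.Point} (e : G.E) (r : Ioo (0 : ℝ) 1)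
    (h : ∀ s : Ioo (0 : ℝ) 1, s ≤ r → edgePt s e ∈ S) (h0 : vertex (G.src e) ∈ S) :
    ∃ γ : unitInterval → G.Point, Continuous γ ∧ Function.Injective γ ∧
      γ 0 = edgePt r e ∧ γ 1 = vertex (G.src e) ∧ range γ ⊆ S ∩ range (G.edge e) := by
  have hr0 := r.2.1
  have hr1 := r.2.2
  have hle : ∀ t : unitInterval, (1 - t) * (r : ℝ) ≤ r := fun t => by
    have := mul_nonneg t.2.1 hr0.le
    linarith
  have hmem : ∀ t : unitInterval, (1 - t) * (r : ℝ) ∈ Icc (0 : ℝ) 1 := fun t =>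
    ⟨mul_nonneg (sub_nonneg.2 t.2.2) hr0.le, (hle t).trans hr1.le⟩
  refine ⟨fun t => G.edge e ⟨(1 - t) * r, hmem t⟩,
    (G.continuous_edge e).comp (by fun_prop), ?_, ?_, ?_, ?_⟩
  · intro t t' htt
    have h := G.edge_injOn_compl_one e
      (fun h0 => ((hle t).trans_lt hr1).ne (congrArg Subtype.val h0))
      (fun h0 => ((hle t').trans_lt hr1).ne (congrArg Subtype.val h0)) htt
    have h' := mul_right_cancel₀ hr0.ne' (congrArg Subtype.val h)
    exact Subtype.ext (sub_right_injective h')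
  · rw [← edge_coe]
    simp
  · rw [← edge_zero]
    simp
  · rintro _ ⟨t, rfl⟩
    refine ⟨?_, _, rfl⟩
    rcases (hmem t).1.lt_or_eq with hlt | heq
    · have := h ⟨(1 - t) * r, hlt, (hle t).trans_lt hr1⟩ (hle t)
      rwa [← edge_coe] at this
    · rw [← edge_zero] at h0
      have : (⟨(1 - t) * r, hmem t⟩ : unitInterval) = 0 := Subtype.ext heq.symm
      simpa only [this] using h0

end GraphLikeSpace

namespace Matroid.GraphFramework

open GraphLikePoint GraphLikeSpace

variable {α : Type u} {M : Matroid α} {Γ : M.GraphFramework}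

/-! ### Local pseudo-arc connectedness -/

/-- A space embedded in `G(M, Γ)` is locally pseudo-arc connected if its cuts along arbitrarily
large finite sets of cocircuits have vertices joined by pseudo-arcs. -/
theorem locallyPseudoArcConnected_of_cut (K : GraphLikeSpace.{u})
    {j : K.Point → Γ.toGraphLikeSpace.Point} (hj : Topology.IsInducing j)
    {jV : K.V → Vert M} {jE : K.E → M.E} (hV : ∀ v, j (vertex v) = vertex (jV v))
    (hE : ∀ r e, j (edgePt r e) = edgePt r (jE e))
    (hsrc : ∀ e, jV (K.src e) = Γ.srcV (jE e)) (htgt : ∀ e, jV (K.tgt e) = Γ.tgtV (jE e))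
    (h : ∀ (x : K.V) (B₀ : Finset {b : Set α // M.IsCocircuit b}), ∃ B, B₀ ⊆ B ∧
      ∀ u v : K.V, (∀ b ∈ B, jV u b = jV x b) → (∀ b ∈ B, jV v b = jV x b) →
        K.JoinedByPseudoArcIn (j ⁻¹' cut univ (jV x) B) u v) :
    K.LocallyPseudoArcConnected := by
  intro x U hU hx
  obtain ⟨U₀, hU₀, rfl⟩ := hj.isOpen_iff.1 hU
  have hx' : vertex (jV x) ∈ U₀ := by
    rw [← hV]
    exact hx
  obtain ⟨B₀, ε₀, hB₀⟩ := exists_nbhd_subset hU₀ hx'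
  obtain ⟨B, hB₀B, hB⟩ := h x B₀
  -- With bounds at most `1/2`, a point of an edge cannot be within the bound of one end for one
  -- cocircuit and of the other end for another.
  set ε : {b : Set α // M.IsCocircuit b} → M.E → Ioo (0 : ℝ) 1 := fun b e =>
    min (ε₀ b e) ⟨1 / 2, by norm_num, by norm_num⟩ with hε
  have hε₀ : ∀ b e, ε b e ≤ ε₀ b e := fun b e => min_le_left _ _
  have hεh : ∀ b e, (ε b e : ℝ) ≤ 1 / 2 := fun b e => by
    have : ε b e ≤ ⟨1 / 2, by norm_num, by norm_num⟩ := min_le_right _ _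
    exact this
  have hvert : ∀ {v : K.V}, vertex v ∈ j ⁻¹' (⋂ b ∈ B, Γ.nbhd b (jV x b) (ε b)) ↔
      ∀ b ∈ B, jV v b = jV x b := by
    intro v
    rw [mem_preimage, hV]
    exact mem_iInter₂
  have hedge : ∀ {r : Ioo (0 : ℝ) 1} {e : K.E},
      edgePt r e ∈ j ⁻¹' (⋂ b ∈ B, Γ.nbhd b (jV x b) (ε b)) ↔ ∀ b ∈ B,
      ((jE e : α) ∉ b.1 ∧ Γ.σ b.1 (jE e) = jV x b) ∨
        ((jE e : α) ∈ b.1 ∧ Γ.d b.1 (jE e) = jV x b ∧ 1 - (ε b (jE e) : ℝ) < (r : ℝ)) ∨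
        ((jE e : α) ∈ b.1 ∧ Γ.d b.1 (jE e) = -jV x b ∧ (r : ℝ) < (ε b (jE e) : ℝ)) := by
    intro r e
    rw [mem_preimage, hE]
    exact mem_iInter₂
  refine ⟨j ⁻¹' ⋂ b ∈ B, Γ.nbhd b (jV x b) (ε b), preimage_mono fun p hp => hB₀ ?_,
    (isOpen_biInter_finset fun b _ => isOpen_nbhd b _ _).preimage hj.continuous,
    hvert.2 fun _ _ => rfl, Or.inr ⟨fun u v hu hv => ?_, fun e r hr => ?_⟩⟩
  · exact mem_iInter₂.2 fun b hb => nbhd_mono (hε₀ b) (mem_iInter₂.1 hp b (hB₀B hb))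
  · obtain ⟨L, s, t, φ, hL, hφ, hs, ht, hr⟩ := hB u v (hvert.1 hu) (hvert.1 hv)
    refine ⟨L, s, t, φ, hL, hφ, hs, ht, hr.trans ?_⟩
    rintro (w | ⟨r, e⟩) hp
    · rw [mem_preimage, hV] at hp
      exact hvert.2 (vertex_mem_cut.1 hp).2
    · rw [mem_preimage, hE] at hp
      exact hedge.2 fun b hb => Or.inl ((edgePt_mem_cut.1 hp).2 b hb)
  · rw [hedge] at hr
    -- All cocircuits of `B` through the edge now refer to the same end. The segment towards it
    -- stays in the neighbourhood, and so does that end.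
    by_cases hr2 : (r : ℝ) < 1 / 2
    · have hr' : ∀ b ∈ B, ((jE e : α) ∉ b.1 ∧ Γ.σ b.1 (jE e) = jV x b) ∨
          ((jE e : α) ∈ b.1 ∧ Γ.d b.1 (jE e) = -jV x b ∧ (r : ℝ) < (ε b (jE e) : ℝ)) := by
        intro b hb
        rcases hr b hb with h | ⟨-, -, h⟩ | h
        · exact Or.inl h
        · have := hεh b (jE e)
          linarith
        · exact Or.inr h
      obtain ⟨γ, h1, h2, h3, h4, h5⟩ := K.exists_arc_src e r
        (fun s hs => hedge.2 fun b hb => (hr' b hb).imp id fun h =>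
          Or.inr ⟨h.1, h.2.1, lt_of_le_of_lt (show (s : ℝ) ≤ r from hs) h.2.2⟩)
        (hvert.2 fun b hb => by
          rw [hsrc]
          rcases hr' b hb with ⟨h, h'⟩ | ⟨h, h', -⟩
          · exact (srcV_apply_of_notMem h).trans h'
          · simp only [srcV, h, if_true, h', neg_neg])
      exact ⟨γ, h1, h2, h3, Or.inl h4, h5⟩
    · have hr' : ∀ b ∈ B, ((jE e : α) ∉ b.1 ∧ Γ.σ b.1 (jE e) = jV x b) ∨
          ((jE e : α) ∈ b.1 ∧ Γ.d b.1 (jE e) = jV x b ∧ 1 - (ε b (jE e) : ℝ) < (r : ℝ)) := by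
        intro b hb
        rcases hr b hb with h | h | ⟨-, -, h⟩
        · exact Or.inl h
        · exact Or.inr h
        · have := hεh b (jE e)
          linarith
      obtain ⟨γ, h1, h2, h3, h4, h5⟩ := K.exists_arc_tgt e r
        (fun s hs => hedge.2 fun b hb => (hr' b hb).imp id fun h =>
          Or.inl ⟨h.1, h.2.1, lt_of_lt_of_le h.2.2 (show (r : ℝ) ≤ s from hs)⟩)
        (hvert.2 fun b hb => by
          rw [htgt]
          rcases hr' b hb with ⟨h, h'⟩ | ⟨h, h', -⟩
          · exact (tgtV_apply_of_notMem h).trans h'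
          · simp only [tgtV, h, if_true, h'])
      exact ⟨γ, h1, h2, h3, Or.inr h4, h5⟩

/-! ### The hat space and its standard subspaces -/

/-- The inclusion of `Ĝ(M, Γ)` into `G(M, Γ)`. -/
noncomputable def hatIncl (Γ : M.GraphFramework) : Γ.hatSpace.Point → Γ.toGraphLikeSpace.Point :=
  Γ.toGraphLikeSpace.subIncl Γ.toGraphLikeSpace.hatVertices univ
    (fun e _ => Or.inl ⟨e, Or.inl rfl⟩) (fun e _ => Or.inl ⟨e, Or.inr rfl⟩)

theorem isInducing_hatIncl : Topology.IsInducing Γ.hatIncl :=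
  isInducing_subIncl _ _

theorem hatIncl_injective : Function.Injective Γ.hatIncl :=
  inclusion_injective _ _

/-- The inclusion of a standard subspace of `Ĝ(M, Γ)` into `Ĝ(M, Γ)`. -/
noncomputable def standardIncl (X : Set Γ.hatSpace.E) :
    (Γ.hatSpace.standardSubspace X).Point → Γ.hatSpace.Point :=
  inclusion (Γ.hatSpace.closureVertices X) X

theorem isInducing_standardIncl (X : Set Γ.hatSpace.E) : Topology.IsInducing (standardIncl X) :=
  ⟨rfl⟩

theorem standardIncl_injective (X : Set Γ.hatSpace.E) : Function.Injective (standardIncl X) :=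
  inclusion_injective _ _

theorem subsingleton_vert (hM : M.IsConnectedMatroid) {e : M.E}
    (he : ∀ b, M.IsCocircuit b → (e : α) ∉ b) : Subsingleton (Vert M) := by
  refine ⟨fun u v => funext fun b => absurd ?_ (he b.1 b.2)⟩
  obtain ⟨f, hf⟩ := b.2.nonempty
  have hfE := b.2.subset_ground hf
  rw [hM.ground_eq_singleton e.2 he] at hfE
  rwa [← mem_singleton_iff.1 hfE]

/-- When the Hausdorff property is not available, any two vertices coincide, and trivial pseudo-arcs
suffice. -/
theorem t2Space_or_subsingleton_vert (hM : M.IsConnectedMatroid) (Γ : M.GraphFramework) :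
    T2Space Γ.toGraphLikeSpace.Point ∨ Subsingleton (Vert M) := by
  by_cases h : ∀ e : M.E, ∃ b, M.IsCocircuit b ∧ (e : α) ∈ b
  · exact Or.inl (t2Space h)
  · push Not at h
    obtain ⟨e, he⟩ := h
    exact Or.inr (subsingleton_vert hM he)

theorem isClosedSubgraph_range_hatIncl : Γ.IsClosedSubgraph (range Γ.hatIncl) where
  saturated e _ r' _ := ⟨edgePt r' ⟨e, trivial⟩, rfl⟩
  src_mem e _ := ⟨vertex ⟨Γ.srcV e, Or.inl ⟨e, Or.inl rfl⟩⟩, rfl⟩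
  tgt_mem e _ := ⟨vertex ⟨Γ.tgtV e, Or.inl ⟨e, Or.inr rfl⟩⟩, rfl⟩
  closed v hv _ := ⟨vertex ⟨v, hv⟩, rfl⟩

theorem closedEdge_subset_range_hatIncl (e : M.E) :
    Γ.toGraphLikeSpace.closedEdge e ⊆ range Γ.hatIncl := by
  intro p hp
  rcases mem_closedEdge.1 hp with rfl | rfl | ⟨r, rfl⟩
  · exact ⟨vertex ⟨Γ.srcV e, Or.inl ⟨e, Or.inl rfl⟩⟩, rfl⟩
  · exact ⟨vertex ⟨Γ.tgtV e, Or.inl ⟨e, Or.inr rfl⟩⟩, rfl⟩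
  · exact ⟨edgePt r ⟨e, trivial⟩, rfl⟩

theorem isClosedSubgraph_image_standardSet (X : Set Γ.hatSpace.E) :
    Γ.IsClosedSubgraph (Γ.hatIncl '' Γ.hatSpace.standardSet X) := by
  have hE : ∀ e ∈ edgesOf (Γ.hatIncl '' Γ.hatSpace.standardSet X),
      ∃ e' : X, (e'.1.1 : Γ.toGraphLikeSpace.E) = e := by
    rintro e ⟨r, _, ⟨p, rfl⟩, hp⟩
    rcases p with v | ⟨s, e'⟩
    · cases hp
    · exact ⟨e', (GraphLikePoint.edgePt.inj hp).2⟩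
  have hpt : ∀ (p : (Γ.hatSpace.standardSubspace X).Point),
      Γ.hatIncl (standardIncl X p) ∈ Γ.hatIncl '' Γ.hatSpace.standardSet X := fun p =>
    ⟨_, ⟨p, rfl⟩, rfl⟩
  refine ⟨?_, ?_, ?_, ?_⟩
  · intro e r r' hr
    obtain ⟨e', rfl⟩ := hE e ⟨r, hr⟩
    exact hpt (edgePt r' e')
  · intro e he
    obtain ⟨e', rfl⟩ := hE e he
    exact hpt (vertex ((Γ.hatSpace.standardSubspace X).src e'))
  · intro e he
    obtain ⟨e', rfl⟩ := hE e he
    exact hpt (vertex ((Γ.hatSpace.standardSubspace X).tgt e'))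
  · intro v hv hvc
    have h : (vertex ⟨v, hv⟩ : Γ.hatSpace.Point) ∈ _root_.closure (Γ.hatSpace.innerPoints X) := by
      rw [isInducing_hatIncl.closure_eq_preimage_closure_image]
      refine _root_.closure_mono ?_ hvc
      rintro _ ⟨r, e, he, rfl⟩
      obtain ⟨e', rfl⟩ := hE e he
      exact ⟨edgePt r e'.1, ⟨r, e'.1, e'.2, rfl⟩, rfl⟩
    exact hpt (vertex ⟨⟨v, hv⟩, h⟩)

theorem isLinked_image_standardSet {X : Set Γ.hatSpace.E}
    (h : ∀ v w : Γ.hatSpace.V, vertex v ∈ Γ.hatSpace.standardSet X →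
      vertex w ∈ Γ.hatSpace.standardSet X →
      Γ.hatSpace.JoinedByPseudoArcIn (Γ.hatSpace.standardSet X) v w) :
    IsLinked (Γ.hatIncl '' Γ.hatSpace.standardSet X) := by
  rintro _ _ ⟨u | ⟨r, e⟩, hu, hu'⟩ ⟨v | ⟨s, f⟩, hv, hv'⟩
  · obtain rfl := GraphLikePoint.vertex.inj hu'
    obtain rfl := GraphLikePoint.vertex.inj hv'
    exact (h u v hu hv).linked.image_subIncl
  · cases hv'
  all_goals cases hu'

theorem linked_preimage_hatIncl {H : Set Γ.toGraphLikeSpace.Point} {u v : Γ.hatSpace.V}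
    (h : Linked (G := Γ.toGraphLikeSpace) H u.1 v.1) (hH : H ⊆ range Γ.hatIncl) :
    Linked (G := Γ.hatSpace) (Γ.hatIncl ⁻¹' H) u v :=
  Linked.preimage_subIncl h hH

theorem cut_mono {H H' : Set Γ.toGraphLikeSpace.Point} (h : H ⊆ H') (x : Vert M)
    (B : Finset {b : Set α // M.IsCocircuit b}) : cut H x B ⊆ cut H' x B :=
  inter_subset_inter_left _ h

section T2

variable [T2Space Γ.toGraphLikeSpace.Point]

theorem t2Space_hatSpace : T2Space Γ.hatSpace.Point :=
  (Topology.IsEmbedding.mk isInducing_hatIncl hatIncl_injective).t2Space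

theorem circ_subset_range_hatIncl {o : Set α} (ho : M.IsCircuit o) :
    Γ.circ o ⊆ range Γ.hatIncl := by
  rintro (v | ⟨r, e⟩) hp
  · exact ⟨vertex ⟨v, mem_hatVertices_of_mem_circ ho hp⟩, rfl⟩
  · exact ⟨edgePt r ⟨e, trivial⟩, rfl⟩

/-- `Ĝ(M, Γ)` is linked if `M` is connected. -/
theorem isLinked_range_hatIncl (hM : M.IsConnectedMatroid) : IsLinked (range Γ.hatIncl) := by
  have hcirc : ∀ {o : Set α} {u v : Vert M}, M.IsCircuit o → vertex u ∈ Γ.circ o →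
      vertex v ∈ Γ.circ o → Linked (range Γ.hatIncl) u v := fun ho hu hv =>
    ⟨Γ.circ _, circ_subset_range_hatIncl ho, isContinuum_circ ho, hu, hv⟩
  -- A vertex of the hat space lies on an edge or on a pseudo-circle, hence on the closure of a
  -- circuit. Connectedness of `M` then links the starting vertices of any two edges by a chain of
  -- circuits.
  have hto : ∀ u : Vert M, vertex u ∈ range Γ.hatIncl →
      ∃ e : M.E, Linked (range Γ.hatIncl) u (Γ.srcV e) := by
    rintro u ⟨w | ⟨r, e⟩, hw⟩
    · have hu : u ∈ Γ.toGraphLikeSpace.hatVertices := GraphLikePoint.vertex.inj hw ▸ w.2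
      rcases hu with ⟨e, he⟩ | hu
      · refine ⟨e, _, closedEdge_subset_range_hatIncl e, isContinuum_closedEdge e, ?_,
          src_mem_closedEdge (G := Γ.toGraphLikeSpace) e⟩
        rcases he with he | he
        · exact he ▸ src_mem_closedEdge (G := Γ.toGraphLikeSpace) e
        · exact he ▸ tgt_mem_closedEdge (G := Γ.toGraphLikeSpace) e
      · obtain ⟨o, ho, huo⟩ := exists_isCircuit_of_liesOnPseudoCircle hu
        obtain ⟨e, he⟩ := ho.nonempty
        exact ⟨⟨e, ho.subset_ground he⟩, hcirc ho huo (closedEdge_subset_circ he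
          (src_mem_closedEdge (G := Γ.toGraphLikeSpace) ⟨e, ho.subset_ground he⟩))⟩
    · cases hw
  have hchain : ∀ (e f : M.E), Linked (range Γ.hatIncl) (Γ.srcV e) (Γ.srcV f) := by
    intro e f
    have h := hM.reflTransGen e.2 f.2
    suffices ∀ a, Relation.ReflTransGen M.OnCommonCircuit (e : α) a →
        ∃ ha : a ∈ M.E, Linked (range Γ.hatIncl) (Γ.srcV e) (Γ.srcV ⟨a, ha⟩) from
      (this f h).2
    intro a ha
    induction ha with
    | refl =>
      exact ⟨e.2, Linked.refl (closedEdge_subset_range_hatIncl e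
        (src_mem_closedEdge (G := Γ.toGraphLikeSpace) e))⟩
    | tail _ hab ih =>
      obtain ⟨ha, hlink⟩ := ih
      obtain ⟨o, ho, hao, hbo⟩ := hab
      exact ⟨ho.subset_ground hbo, Linked.trans hlink (hcirc ho
        (closedEdge_subset_circ hao (src_mem_closedEdge (G := Γ.toGraphLikeSpace) ⟨_, ha⟩))
        (closedEdge_subset_circ hbo (src_mem_closedEdge (G := Γ.toGraphLikeSpace)
          ⟨_, ho.subset_ground hbo⟩)))⟩
  intro u v hu hv
  obtain ⟨e, he⟩ := hto u hu
  obtain ⟨f, hf⟩ := hto v hv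
  exact Linked.trans he (Linked.trans (hchain e f) (Linked.symm hf))

end T2

theorem locallyPseudoArcConnected_hatSpace (hM : M.IsConnectedMatroid) (Γ : M.GraphFramework) :
    Γ.hatSpace.LocallyPseudoArcConnected := by
  refine locallyPseudoArcConnected_of_cut Γ.hatSpace (j := Γ.hatIncl) isInducing_hatIncl
    (jV := fun v => v.1) (jE := fun e => e.1) (fun _ => rfl) (fun _ _ => rfl) (fun _ => rfl)
    (fun _ => rfl) fun x B₀ => ?_
  rcases t2Space_or_subsingleton_vert hM Γ with hT | hS
  · obtain ⟨B, hB₀, hB⟩ := (isLinked_range_hatIncl hM).exists_isLinked_cut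
      isClosedSubgraph_range_hatIncl ⟨vertex x, rfl⟩ B₀
    have := t2Space_hatSpace (Γ := Γ)
    refine ⟨B, hB₀, fun u v hu hv => Linked.joinedByPseudoArcIn ?_⟩
    have h := hB u.1 v.1 (vertex_mem_cut.2 ⟨⟨vertex u, rfl⟩, hu⟩)
      (vertex_mem_cut.2 ⟨⟨vertex v, rfl⟩, hv⟩)
    exact (linked_preimage_hatIncl h inter_subset_left).mono
      (preimage_mono (cut_mono (subset_univ _) _ _))
  · refine ⟨B₀, subset_rfl, fun u v hu hv => ?_⟩
    obtain rfl : u = v := Subtype.ext (Subsingleton.elim (α := Vert M) u.1 v.1)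
    exact joinedByPseudoArcIn_refl (vertex_mem_cut.2 ⟨trivial, hu⟩)

theorem locallyPseudoArcConnected_standardSubspace (hM : M.IsConnectedMatroid)
    {X : Set Γ.hatSpace.E} (hX : Γ.hatSpace.IsPseudoArcConnected (Γ.hatSpace.standardSet X)) :
    (Γ.hatSpace.standardSubspace X).LocallyPseudoArcConnected := by
  have hind := isInducing_hatIncl.comp (isInducing_standardIncl X)
  refine locallyPseudoArcConnected_of_cut (Γ.hatSpace.standardSubspace X)
    (j := Γ.hatIncl ∘ standardIncl X) hind (jV := fun v => v.1.1) (jE := fun e => e.1.1)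
    (fun _ => rfl) (fun _ _ => rfl) (fun _ => rfl) (fun _ => rfl) fun x B₀ => ?_
  have hmem : ∀ v : (Γ.hatSpace.standardSubspace X).V,
      vertex v.1.1 ∈ Γ.hatIncl '' Γ.hatSpace.standardSet X := fun v =>
    ⟨_, ⟨vertex v, rfl⟩, rfl⟩
  rcases t2Space_or_subsingleton_vert hM Γ with hT | hS
  · rcases hX with ⟨e, he, -⟩ | ⟨hX, -⟩
    -- A standard subspace containing the vertex `x` is not a set of interior points of one edge.
    · exact absurd (he ⟨vertex x, rfl⟩) vertex_notMem_innerPoints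
    obtain ⟨B, hB₀, hB⟩ := (isLinked_image_standardSet hX).exists_isLinked_cut
      (isClosedSubgraph_image_standardSet X) (hmem x) B₀
    have : T2Space (Γ.hatSpace.standardSubspace X).Point := (Topology.IsEmbedding.mk hind
      (hatIncl_injective.comp (standardIncl_injective X))).t2Space
    refine ⟨B, hB₀, fun u v hu hv => Linked.joinedByPseudoArcIn ?_⟩
    have h := hB u.1.1 v.1.1 (vertex_mem_cut.2 ⟨hmem u, hu⟩) (vertex_mem_cut.2 ⟨hmem v, hv⟩)
    have h' := linked_preimage_hatIncl (u := u.1) (v := v.1) h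
      (inter_subset_left.trans (image_subset_range _ _))
    have hsub : Γ.hatIncl ⁻¹' cut (Γ.hatIncl '' Γ.hatSpace.standardSet X) x.1.1 B ⊆
        range (standardIncl X) := fun p hp => hatIncl_injective.mem_set_image.1 hp.1
    have h'' : Linked (G := Γ.hatSpace.standardSubspace X) (standardIncl X ⁻¹'
        (Γ.hatIncl ⁻¹' cut (Γ.hatIncl '' Γ.hatSpace.standardSet X) x.1.1 B)) u v :=
      Linked.preimage_subIncl h' hsub
    exact h''.mono (preimage_mono (preimage_mono (cut_mono (subset_univ _) _ _)))
  · refine ⟨B₀, subset_rfl, fun u v hu hv => ?_⟩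
    obtain rfl : u = v :=
      Subtype.ext (Subtype.ext (Subsingleton.elim (α := Vert M) u.1.1 v.1.1))
    exact joinedByPseudoArcIn_refl (vertex_mem_cut.2 ⟨trivial, hu⟩)

end Matroid.GraphFramework

theorem mainTheorem6 {α : Type u} (M : Matroid α) (hM : M.IsConnectedMatroid)
    (Γ : M.GraphFramework) :
    (∀ X : Set Γ.hatSpace.E,
      Γ.hatSpace.IsPseudoArcConnected (Γ.hatSpace.standardSet X) →
        (Γ.hatSpace.standardSubspace X).LocallyPseudoArcConnected) ∧
      Γ.hatSpace.LocallyPseudoArcConnected :=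
  ⟨fun _ hX => Matroid.GraphFramework.locallyPseudoArcConnected_standardSubspace hM hX,
    Matroid.GraphFramework.locallyPseudoArcConnected_hatSpace hM Γ⟩
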